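/- **Proposition 2.1.** Let $M$ and $N$ be Hausdorff, second countable manifolds of class $C^2$ and of dimensions $m$ and $n$. "Measurable", "negligible", "weakly differentiable" and $W^{1,1}_{\mathrm{loc}}(M)$ are understood in local charts. A measurable map $u$ from $M$ to a manifold $Y$ of class $C^1$ is *colocally weakly differentiable* if $f\circ u$ is weakly differentiable for every $f\in C^1_c(Y,\mathbb R)$. A colocally weakly differentiable map $u\colon M\to N$ has a *colocal weak derivative* $Tu$: the measurable bundle morphism $Tu\colon TM\to TN$ covering $u$, unique up to negligible sets, such that $T(f\circ u)=Tf\circ Tu$ almost everywhere in $M$ for every $f\in C^1_c(N,\mathbb R)$. It can be seen as a measurable map from $M$ to the bundle $T^*M\otimes TN$ over $M\times N$, whose fibre at $(x,y)$ is $\mathcal L(T_xM,T_yN)$ and whose total space is a manifold of class $C^1$. The map $u\colon M\to N$ is *twice colocally weakly differentiable* if it is colocally weakly differentiable and if $Tu\colon M\to T^*M\otimes TN$ is colocally weakly differentiable. Let $T^2M=T(TM)$, with its two vector bundle structures over $TM$, of projections $\pi_{TM}$ and $T\pi_M$, where $\pi_M\colon TM\to M$. Let $\kappa_M\colon T^2M\to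 T^2M$ be the canonical flip, given in the chart induced by a chart of $M$ by $(z,e,\mu,\nu)\mapsto(z,\mu,e,\nu)$, and, for $e,\nu\in T_xM$, let $\operatorname{Vert}_e(\nu)=\frac{d}{dt}(e+t\nu)|_{t=0}\in T_e(TM)$ be the vertical lift. The fibre $\operatorname{Mor}(T^2M,T^2N)_{x,y}$ consists of the double vector bundle morphisms, that is, of the maps $\upsilon\colon T^2_xM\to T^2_yN$ together with $\upsilon_1,\upsilon_2\in\mathcal L(T_xM,T_yN)$ such that $\pi_{TN}\circ\upsilon=\upsilon_1\circ\pi_{TM}$ and $T\pi_N\circ\upsilon=\upsilon_2\circ T\pi_M$, and such that $\upsilon$ is linear on the fibres of both structures. If $L\in\mathcal L(T_xM,T_yN)$, then a linear map $W\colon T_xM\to T_{(x,y,L)}(T^*M\otimes TN)$ whose component along $M$ is the identity of $T_xM$ is identified with an element of $\operatorname{Mor}(T^2M,T^2N)_{x,y}$, as the tangent map of a section $x'\mapsto (x',y(x'),L(x'))$ is identified with the tangent map of the bundle morphism $(x',e)\mapsto(y(x'),L(x')e)$: in charts, if $W\mu=(\mu,\lambda,A)$, the corresponding morphism maps $(e,\mu,\nu)$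 to $(Le,\lambda,Ae+L\nu)$. For such a morphism and for $f\in C^1(T^*M\otimes TN,\mathbb R)$ the composition with $Tf\colon T(T^*M\otimes TN)\to T\mathbb R$ is defined. If the map $u\colon M\to N$ is twice colocally weakly differentiable, then there exists a measurable map $T^2u\colon M\to\operatorname{Mor}(T^2M,T^2N)$, unique up to negligible sets, that covers $u$ (that is, $T^2u(x)\in\operatorname{Mor}(T^2M,T^2N)_{x,u(x)}$ for almost every $x\in M$) and such that for every function $f\in C^1(T^*M\otimes TN,\mathbb R)$ with $f\circ Tu\in W^{1,1}_{\mathrm{loc}}(M)$, for almost every $x \in M$ the morphism $T^2u(x)$ is of the above form and $$T(f\circ Tu)=Tf\circ T^2u .$$ Moreover, for almost every $x\in M$, $$\kappa_N\circ T^2u(x)=T^2u(x)\circ\kappa_M\ \text{ on } T^2_xM,\qquad T^2u(x)\bigl(\operatorname{Vert}_e(\nu)\bigr)=\operatorname{Vert}_{Tu(x)e}\bigl(Tu(x)\nu\bigr)\ \text{ for all } e,\nu\in T_xM .$$ -/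

import Mathlib

open Set MeasureTheory Filter Bundle
open scoped Manifold ContDiff Topology Bundle

noncomputable section

/-! ## Local measure theory and weak derivatives on a manifold

Throughout, `M` is a manifold modelled on `ℝᵐ`; `extChartAt (𝓡 m) x₀` is a chart of `M` around `x₀`
and `(extChartAt (𝓡 m) x₀).target` is its image, an open subset of `ℝᵐ`.  Since the charts around
the points `x₀` cover `M`, and since null sets, Lebesgue measurable sets and weak derivatives are
invariant under `C¹` diffeomorphisms, it is enough to look at these charts. -/

section FirstOrder

variable {m : ℕ} {M : Type*} [TopologicalSpace M] [ChartedSpace (EuclideanSpace ℝ (Fin m)) M]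

/-- The filter of the sets of full measure of `M`: `∀ᶠ x in manifoldAE m M, P x` means that `P`
holds almost everywhere in `M`, i.e. outside a set whose image in local charts is negligible. -/
def manifoldAE (m : ℕ) (M : Type*) [TopologicalSpace M]
    [ChartedSpace (EuclideanSpace ℝ (Fin m)) M] : Filter M :=
  ⨆ x₀ : M, Filter.map (extChartAt (𝓡 m) x₀).symm
    (ae ((volume : Measure (EuclideanSpace ℝ (Fin m))).restrict (extChartAt (𝓡 m) x₀).target))

/-- A map `u` from `M` to a topological space is measurable if, in local charts of `M`, the
preimages of open sets are Lebesgue measurable. -/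
def ManifoldMeasurable (m : ℕ) {M Y : Type*} [TopologicalSpace M]
    [ChartedSpace (EuclideanSpace ℝ (Fin m)) M] [TopologicalSpace Y] (u : M → Y) : Prop :=
  ∀ x₀ : M, ∀ U : Set Y, IsOpen U →
    NullMeasurableSet {z | z ∈ (extChartAt (𝓡 m) x₀).target ∧ u ((extChartAt (𝓡 m) x₀).symm z) ∈ U}
      (volume : Measure (EuclideanSpace ℝ (Fin m)))

/-- On the open set `Ω ⊆ ℝᵐ`, the function `g` belongs to `W^{1,1}_loc(Ω)` and `G` is its weak
derivative. -/
def HasWeakFDerivOn (Ω : Set (EuclideanSpace ℝ (Fin m))) (g : EuclideanSpace ℝ (Fin m) → ℝ)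
    (G : EuclideanSpace ℝ (Fin m) → EuclideanSpace ℝ (Fin m) →L[ℝ] ℝ) : Prop :=
  LocallyIntegrableOn g Ω ∧ LocallyIntegrableOn G Ω ∧
    ∀ φ : EuclideanSpace ℝ (Fin m) → ℝ, ContDiff ℝ ∞ φ → HasCompactSupport φ → tsupport φ ⊆ Ω →
      ∀ v, ∫ z in Ω, g z * fderiv ℝ φ z v = -∫ z in Ω, G z v * φ z

/-- `g : M → ℝ` belongs to `W^{1,1}_loc(M)`, and its weak derivative at almost every `x` is the
linear form `G x` on `T_x M`. -/
def HasWeakMFDeriv (g : M → ℝ) (G : ∀ x : M, TangentSpace (𝓡 m) x →L[ℝ] ℝ) : Prop :=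
  ∀ x₀ : M, HasWeakFDerivOn (extChartAt (𝓡 m) x₀).target
    (fun z => g ((extChartAt (𝓡 m) x₀).symm z))
    (fun z => (G ((extChartAt (𝓡 m) x₀).symm z)).comp
      (mfderiv 𝓘(ℝ, EuclideanSpace ℝ (Fin m)) (𝓡 m) (extChartAt (𝓡 m) x₀).symm z))

/-- `g : M → ℝ` is weakly differentiable, i.e. belongs to `W^{1,1}_loc(M)`. -/
def WeaklyDifferentiable (m : ℕ) {M : Type*} [TopologicalSpace M]
    [ChartedSpace (EuclideanSpace ℝ (Fin m)) M] (g : M → ℝ) : Prop :=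
  ∃ G : ∀ x : M, TangentSpace (𝓡 m) x →L[ℝ] ℝ, HasWeakMFDeriv g G

/-- A measurable map `u : M → Y` into a `C¹` manifold is colocally weakly differentiable if
`f ∘ u` is weakly differentiable for every `f ∈ C¹_c(Y, ℝ)`. -/
def ColocallyWeaklyDifferentiable (m : ℕ) {M : Type*} [TopologicalSpace M]
    [ChartedSpace (EuclideanSpace ℝ (Fin m)) M]
    {EY HY Y : Type*} [NormedAddCommGroup EY] [NormedSpace ℝ EY] [TopologicalSpace HY]
    (IY : ModelWithCorners ℝ EY HY) [TopologicalSpace Y] [ChartedSpace HY Y] (u : M → Y) : Prop :=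
  ManifoldMeasurable m u ∧
    ∀ f : Y → ℝ, ContMDiff IY 𝓘(ℝ, ℝ) 1 f → HasCompactSupport f →
      WeaklyDifferentiable m (fun x => f (u x))

end FirstOrder

/-! ## The bundle `T*M ⊗ TN` over `M × N` -/

section HomBundle

/-- The pullback of `TM` to `M × N`; its fibre at `(x, y)` is `T_x M`. -/
abbrev SrcTangent (m n : ℕ) (M N : Type*)
    [TopologicalSpace M] [ChartedSpace (EuclideanSpace ℝ (Fin m)) M]
    [TopologicalSpace N] [ChartedSpace (EuclideanSpace ℝ (Fin n)) N] : M × N → Type :=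
  (ContMDiffMap.fst : C^1⟮(𝓡 m).prod (𝓡 n), M × N; 𝓡 m, M⟯) *ᵖ (TangentSpace (𝓡 m))

/-- The pullback of `TN` to `M × N`; its fibre at `(x, y)` is `T_y N`. -/
abbrev TgtTangent (m n : ℕ) (M N : Type*)
    [TopologicalSpace M] [ChartedSpace (EuclideanSpace ℝ (Fin m)) M]
    [TopologicalSpace N] [ChartedSpace (EuclideanSpace ℝ (Fin n)) N] : M × N → Type :=
  (ContMDiffMap.snd : C^1⟮(𝓡 m).prod (𝓡 n), M × N; 𝓡 n, N⟯) *ᵖ (TangentSpace (𝓡 n))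

variable {m n : ℕ}
  {M : Type*} [TopologicalSpace M] [ChartedSpace (EuclideanSpace ℝ (Fin m)) M]
  {N : Type*} [TopologicalSpace N] [ChartedSpace (EuclideanSpace ℝ (Fin n)) N]

instance instAddCommGroupSrcTangent (p : M × N) : AddCommGroup (SrcTangent m n M N p) :=
  inferInstanceAs (AddCommGroup (TangentSpace (𝓡 m) p.1))

instance instAddCommGroupTgtTangent (p : M × N) : AddCommGroup (TgtTangent m n M N p) :=
  inferInstanceAs (AddCommGroup (TangentSpace (𝓡 n) p.2))

instance instIsTopologicalAddGroupTgtTangent (p : M × N) :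
    IsTopologicalAddGroup (TgtTangent m n M N p) :=
  inferInstanceAs (IsTopologicalAddGroup (TangentSpace (𝓡 n) p.2))

instance instContinuousSMulTgtTangent (p : M × N) : ContinuousSMul ℝ (TgtTangent m n M N p) :=
  inferInstanceAs (ContinuousSMul ℝ (TangentSpace (𝓡 n) p.2))

/-- The total space of the vector bundle `T*M ⊗ TN` over `M × N`, whose fibre at `(x, y)` is
`T_x* M ⊗ T_y N = 𝓛(T_x M, T_y N)`.  For `C²` manifolds `M`, `N`, Mathlib's vector bundle
constructions make it a `C¹` manifold modelled on `homModel m n`. -/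
abbrev HomBundle (m n : ℕ) (M N : Type*)
    [TopologicalSpace M] [ChartedSpace (EuclideanSpace ℝ (Fin m)) M]
    [TopologicalSpace N] [ChartedSpace (EuclideanSpace ℝ (Fin n)) N] : Type _ :=
  TotalSpace (EuclideanSpace ℝ (Fin m) →L[ℝ] EuclideanSpace ℝ (Fin n))
    (fun p : M × N => SrcTangent m n M N p →L[ℝ] TgtTangent m n M N p)

/-- The model with corners of the manifold `T*M ⊗ TN`. -/
abbrev homModel (m n : ℕ) :=
  ((𝓡 m).prod (𝓡 n)).prod 𝓘(ℝ, EuclideanSpace ℝ (Fin m) →L[ℝ] EuclideanSpace ℝ (Fin n))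

/-- The point of `T*M ⊗ TN` over `(x, y)` given by the linear map `L : T_x M → T_y N`. -/
def homPoint (x : M) (y : N) (L : TangentSpace (𝓡 m) x →L[ℝ] TangentSpace (𝓡 n) y) :
    HomBundle m n M N := ⟨(x, y), L⟩

end HomBundle

/-! ## Colocal weak derivative and twice colocally weakly differentiable maps -/

section Colocal

variable {m n : ℕ}
  {M : Type*} [TopologicalSpace M] [ChartedSpace (EuclideanSpace ℝ (Fin m)) M]
  [IsManifold (𝓡 m) 2 M]
  {N : Type*} [TopologicalSpace N] [ChartedSpace (EuclideanSpace ℝ (Fin n)) N]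
  [IsManifold (𝓡 n) 2 N]

/-- `Du` is (a representative of) the colocal weak derivative `Tu` of `u`: a measurable bundle
morphism covering `u`, such that for every `f ∈ C¹_c(N, ℝ)` the weak derivative of `f ∘ u` is
`df(u) ∘ Du`, i.e. `T(f ∘ u) = Tf ∘ Tu` almost everywhere. -/
def IsColocalWeakDeriv (u : M → N)
    (Du : ∀ x : M, TangentSpace (𝓡 m) x →L[ℝ] TangentSpace (𝓡 n) (u x)) : Prop :=
  ManifoldMeasurable m (fun x => homPoint x (u x) (Du x)) ∧
    ∀ f : N → ℝ, ContMDiff (𝓡 n) 𝓘(ℝ, ℝ) 1 f → HasCompactSupport f →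
      HasWeakMFDeriv (fun x => f (u x)) (fun x => (mfderiv (𝓡 n) 𝓘(ℝ, ℝ) f (u x)).comp (Du x))

/-- `u` is twice colocally weakly differentiable: it is colocally weakly differentiable and its
colocal weak derivative (which exists and is unique up to null sets), seen as a map from `M` to
the `C¹` manifold `T*M ⊗ TN`, is itself colocally weakly differentiable. -/
def TwiceColocallyWeaklyDifferentiable (m n : ℕ)
    {M : Type*} [TopologicalSpace M] [ChartedSpace (EuclideanSpace ℝ (Fin m)) M]
    [IsManifold (𝓡 m) 2 M]
    {N : Type*} [TopologicalSpace N] [ChartedSpace (EuclideanSpace ℝ (Fin n)) N]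
    [IsManifold (𝓡 n) 2 N] (u : M → N) : Prop :=
  ColocallyWeaklyDifferentiable m (𝓡 n) u ∧
    ∀ Du : ∀ x : M, TangentSpace (𝓡 m) x →L[ℝ] TangentSpace (𝓡 n) (u x),
      IsColocalWeakDeriv u Du →
        ColocallyWeaklyDifferentiable m (homModel m n) (fun x => homPoint x (u x) (Du x))

end Colocal

/-! ## The second-order tangent bundle

In Mathlib, `T_x M` is a copy of `ℝᵐ`: a tangent vector is given by its coordinates in the
preferred chart `ψ` at `x`.  The preferred chart of `TM` at `p = (x, e)` is `Tψ`, whatever `e` is,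
so that `T_p(TM)` is a copy of `ℝᵐ × ℝᵐ` and the vector of `T_p(TM)` with components `(μ, ν)` is
the one with coordinates `(ψ x, e, μ, ν)` in the chart `T²ψ` of `T²M`. -/

section SecondTangent

variable {m n : ℕ}
  {M : Type*} [TopologicalSpace M] [ChartedSpace (EuclideanSpace ℝ (Fin m)) M]
  [IsManifold (𝓡 m) 2 M]
  {N : Type*} [TopologicalSpace N] [ChartedSpace (EuclideanSpace ℝ (Fin n)) N]
  [IsManifold (𝓡 n) 2 N]

/-- The second-order tangent bundle `T²M = T(TM)`. -/
abbrev SecondTangent (m : ℕ) (M : Type*) [TopologicalSpace M]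
    [ChartedSpace (EuclideanSpace ℝ (Fin m)) M] [IsManifold (𝓡 m) 2 M] : Type _ :=
  TangentBundle (𝓡 m).tangent (TangentBundle (𝓡 m) M)

/-- The element of `T_p(TM)` with components `(μ, ν)`. -/
def secondVec (p : TangentBundle (𝓡 m) M) (μ ν : TangentSpace (𝓡 m) p.proj) :
    TangentSpace (𝓡 m).tangent p :=
  ((μ, ν) : EuclideanSpace ℝ (Fin m) × EuclideanSpace ℝ (Fin m))

/-- The component `μ` of a vector `(μ, ν)` of `T_p(TM)`. -/
def secondHor {p : TangentBundle (𝓡 m) M} (ζ : TangentSpace (𝓡 m).tangent p) :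
    TangentSpace (𝓡 m) p.proj :=
  (ζ : EuclideanSpace ℝ (Fin m) × EuclideanSpace ℝ (Fin m)).1

/-- The component `ν` of a vector `(μ, ν)` of `T_p(TM)`. -/
def secondVer {p : TangentBundle (𝓡 m) M} (ζ : TangentSpace (𝓡 m).tangent p) :
    TangentSpace (𝓡 m) p.proj :=
  (ζ : EuclideanSpace ℝ (Fin m) × EuclideanSpace ℝ (Fin m)).2

/-- The tangent map `Tπ_M : T_p(TM) → T_x M` of the projection `π_M : TM → M`, at `p = (x, e)`. -/
def tangentProj (p : TangentBundle (𝓡 m) M) :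
    TangentSpace (𝓡 m).tangent p →L[ℝ] TangentSpace (𝓡 m) p.proj :=
  mfderiv (𝓡 m).tangent (𝓡 m)
    (fun q : TangentBundle (𝓡 m) M => q.proj) p

/-- The vertical lift `Vert_e(ν) ∈ T_{(x, e)}(TM)` of `ν ∈ T_x M`: the derivative at `e`, in the
direction `ν`, of the inclusion of the fibre `T_x M` in `TM`, that is `d/dt (e + t ν)` at `t = 0`. -/
def vertLift (x : M) (e ν : TangentSpace (𝓡 m) x) :
    TangentSpace (𝓡 m).tangent (⟨x, e⟩ : TangentBundle (𝓡 m) M) :=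
  mfderiv 𝓘(ℝ, EuclideanSpace ℝ (Fin m)) (𝓡 m).tangent
    (fun w : EuclideanSpace ℝ (Fin m) => (⟨x, w⟩ : TangentBundle (𝓡 m) M)) e ν

/-- The canonical flip `κ_M : T²M → T²M`: in the chart `T²ψ` of `T²M` induced by a chart `ψ` of `M`,
it maps `(z, e, μ, ν)` to `(z, μ, e, ν)`. -/
def canonicalFlip (ξ : SecondTangent m M) : SecondTangent m M :=
  ⟨⟨ξ.proj.proj, secondHor ξ.2⟩, secondVec ⟨ξ.proj.proj, secondHor ξ.2⟩ ξ.proj.2 (secondVer ξ.2)⟩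

/-- The fibre over `(x, y)` of `Mor(T²M, T²N)`: double vector bundle morphisms `υ : T²_x M → T²_y N`.

`υ` covers `fst = υ₁` for the structure `π_{TM} : T²M → TM`, and is linear on the fibres of that
structure: it consists of the linear maps `toFun e : T_{(x, e)}(TM) → T_{(y, υ₁ e)}(TN)`.
It covers `snd = υ₂` for the structure `Tπ_M : T²M → TM` (`proj_toFun`), and is linear on the fibres
of that structure, whose operations are the tangent maps of those of `TM`, that is, in components,
`(e, μ, ν) + (e', μ, ν') = (e + e', μ, ν + ν')` and `c (e, μ, ν) = (c e, μ, c ν)`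
(`ver_add`, `ver_smul`). -/
@[ext]
structure DoubleMor {m n : ℕ}
    {M : Type*} [TopologicalSpace M] [ChartedSpace (EuclideanSpace ℝ (Fin m)) M]
    [IsManifold (𝓡 m) 2 M]
    {N : Type*} [TopologicalSpace N] [ChartedSpace (EuclideanSpace ℝ (Fin n)) N]
    [IsManifold (𝓡 n) 2 N] (x : M) (y : N) where
  fst : TangentSpace (𝓡 m) x →L[ℝ] TangentSpace (𝓡 n) y
  snd : TangentSpace (𝓡 m) x →L[ℝ] TangentSpace (𝓡 n) y
  toFun : ∀ e : TangentSpace (𝓡 m) x,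
    TangentSpace (𝓡 m).tangent (⟨x, e⟩ : TangentBundle (𝓡 m) M) →L[ℝ]
      TangentSpace (𝓡 n).tangent (⟨y, fst e⟩ : TangentBundle (𝓡 n) N)
  proj_toFun : ∀ (e : TangentSpace (𝓡 m) x)
    (ζ : TangentSpace (𝓡 m).tangent (⟨x, e⟩ : TangentBundle (𝓡 m) M)),
    tangentProj (⟨y, fst e⟩ : TangentBundle (𝓡 n) N) (toFun e ζ) =
      snd (tangentProj (⟨x, e⟩ : TangentBundle (𝓡 m) M) ζ)
  ver_add : ∀ e e' μ ν ν' : TangentSpace (𝓡 m) x,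
    secondVer (toFun (e + e') (secondVec ⟨x, e + e'⟩ μ (ν + ν'))) =
      secondVer (toFun e (secondVec ⟨x, e⟩ μ ν)) + secondVer (toFun e' (secondVec ⟨x, e'⟩ μ ν'))
  ver_smul : ∀ (c : ℝ) (e μ ν : TangentSpace (𝓡 m) x),
    secondVer (toFun (c • e) (secondVec ⟨x, c • e⟩ μ (c • ν))) =
      c • secondVer (toFun e (secondVec ⟨x, e⟩ μ ν))

/-- The map `T²M → T²N` defined by a family `V x ∈ Mor(T²M, T²N)_{x, u x}`. -/
def secondMap (u : M → N) (V : ∀ x : M, DoubleMor (m := m) (n := n) x (u x))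
    (ξ : SecondTangent m M) : SecondTangent n N :=
  ⟨⟨u ξ.proj.proj, (V ξ.proj.proj).fst ξ.proj.2⟩, (V ξ.proj.proj).toFun ξ.proj.2 ξ.2⟩

/-- A map `V : M → Mor(T²M, T²N)` covering `u` is measurable if its components in local charts are,
that is, if it maps the local sections `z ↦ (z, e, μ, ν)` of `T²M` that have constant components
`e, μ, ν` in a chart to measurable maps with values in `T²N`. -/
def SecondMeasurable (u : M → N) (V : ∀ x : M, DoubleMor (m := m) (n := n) x (u x)) : Prop :=
  ∀ (x₀ : M) (e μ ν : EuclideanSpace ℝ (Fin m)) (U : Set (SecondTangent n N)), IsOpen U →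
    NullMeasurableSet {z | z ∈ (extChartAt (𝓡 m) x₀).target ∧
        secondMap u V ((extChartAt (𝓡 m).tangent.tangent
          (⟨⟨x₀, 0⟩, 0⟩ : SecondTangent m M)).symm ((z, e), (μ, ν))) ∈ U}
      (volume : Measure (EuclideanSpace ℝ (Fin m)))

/-- A vector `w` tangent to `T*M ⊗ TN` at a point over `(x, y)` has components
`w = ((μ, λ), A) ∈ (T_x M × T_y N) × 𝓛(T_x M, T_y N)`; this is the component `μ`. -/
def homSrc {x : M} {y : N} {L : TangentSpace (𝓡 m) x →L[ℝ] TangentSpace (𝓡 n) y}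
    (w : TangentSpace (homModel m n) (homPoint x y L)) :
    TangentSpace (𝓡 m) x :=
  (w : (EuclideanSpace ℝ (Fin m) × EuclideanSpace ℝ (Fin n)) ×
    (EuclideanSpace ℝ (Fin m) →L[ℝ] EuclideanSpace ℝ (Fin n))).1.1

/-- The component `λ` of a vector `((μ, λ), A)` tangent to `T*M ⊗ TN`. -/
def homTgt {x : M} {y : N} {L : TangentSpace (𝓡 m) x →L[ℝ] TangentSpace (𝓡 n) y}
    (w : TangentSpace (homModel m n) (homPoint x y L)) :
    TangentSpace (𝓡 n) y :=
  (w : (EuclideanSpace ℝ (Fin m) × EuclideanSpace ℝ (Fin n)) ×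
    (EuclideanSpace ℝ (Fin m) →L[ℝ] EuclideanSpace ℝ (Fin n))).1.2

/-- The component `A` of a vector `((μ, λ), A)` tangent to `T*M ⊗ TN`. -/
def homVer {x : M} {y : N} {L : TangentSpace (𝓡 m) x →L[ℝ] TangentSpace (𝓡 n) y}
    (w : TangentSpace (homModel m n) (homPoint x y L)) :
    TangentSpace (𝓡 m) x →L[ℝ] TangentSpace (𝓡 n) y :=
  (w : (EuclideanSpace ℝ (Fin m) × EuclideanSpace ℝ (Fin n)) ×
    (EuclideanSpace ℝ (Fin m) →L[ℝ] EuclideanSpace ℝ (Fin n))).2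

/-- The inclusion of `T*M ⊗ T(T*M ⊗ TN)` in `Mor(T²M, T²N)`.

A linear map `W : T_x M → T_{(x, y, L)}(T*M ⊗ TN)`, the components of `W μ` being `((μ, λ), A)`
with the same `μ`, is the tangent map at `x` of a map `x' ↦ (x', y(x'), L(x'))`.  It is identified
with the tangent map of the bundle morphism `(x', e) ↦ (y(x'), L(x') e)`, i.e. with the element of
`Mor(T²M, T²N)` that maps `(e, μ, ν)` to `(L e, λ, A e + L ν)`. -/
def RepresentedBy {x : M} {y : N} (v : DoubleMor (m := m) (n := n) x y)
    (W : TangentSpace (𝓡 m) x →L[ℝ] TangentSpace (homModel m n) (homPoint x y v.fst)) : Prop :=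
  (∀ μ, homSrc (W μ) = μ) ∧
    ∀ e μ ν : TangentSpace (𝓡 m) x,
      v.toFun e (secondVec ⟨x, e⟩ μ ν) =
        secondVec ⟨y, v.fst e⟩ (homTgt (W μ)) (homVer (W μ) e + v.fst ν)

/-- `V` is a colocal weak derivative of the bundle morphism `Du`: a measurable map
`V : M → Mor(T²M, T²N)` that covers `u`, such that for every `f ∈ C¹(T*M ⊗ TN, ℝ)` with
`f ∘ Du ∈ W^{1,1}_loc(M)` one has `T(f ∘ Du) = Tf ∘ V` almost everywhere.

The composition with `Tf : T(T*M ⊗ TN) → Tℝ = ℝ × ℝ` makes sense for `V x` represented by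
`W : T_x M → T_{(x, u x, (V x).fst)}(T*M ⊗ TN)`; the equality is that of the base points in `ℝ` and
of the linear parts. -/
def IsSecondColocalWeakDeriv (u : M → N)
    (Du : ∀ x : M, TangentSpace (𝓡 m) x →L[ℝ] TangentSpace (𝓡 n) (u x))
    (V : ∀ x : M, DoubleMor (m := m) (n := n) x (u x)) : Prop :=
  SecondMeasurable u V ∧
    ∀ f : HomBundle m n M N → ℝ, ContMDiff (homModel m n) 𝓘(ℝ, ℝ) 1 f →
      ∀ G : ∀ x : M, TangentSpace (𝓡 m) x →L[ℝ] ℝ,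
        HasWeakMFDeriv (fun x => f (homPoint x (u x) (Du x))) G →
          ∀ᶠ x in manifoldAE m M,
            ∃ W : TangentSpace (𝓡 m) x →L[ℝ]
                TangentSpace (homModel m n) (homPoint x (u x) (V x).fst),
              RepresentedBy (V x) W ∧
              f (homPoint x (u x) (Du x)) = f (homPoint x (u x) (V x).fst) ∧
              G x = (mfderiv (homModel m n) 𝓘(ℝ, ℝ) f (homPoint x (u x) (V x).fst)).comp W

end SecondTangent

end

/-! Every property of `T²u` is read off from weak derivatives of real functions `f ∘ Tu` in charts,
restricted to lines. A weakly differentiable function satisfies the fundamental theorem of calculus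
on almost every segment, and conversely (`HasWeakLineDerivOn.ae_prod_eq`,
`HasWeakLineDerivOn.of_ae_sub_eq`). This gives the chain rule for Lipschitz `C¹` functions and the
vanishing of the derivative almost everywhere on the zero set, hence `HasWeakFDerivOn.ae_chain`: a
chain rule on a set where a function merely coincides with a composition. Such a statement is
indispensable, because the preimage under `u` or `Tu` of a chart domain is measurable but in general
not open.

For a colocally weakly differentiable map into a manifold `Y`, countably many compactly supported
coordinate functions separate points and tangent vectors. Their weak derivatives, assembled chart by
chart, form a weak tangent map (`ColocallyWeaklyDifferentiable.exists_isWeakTangentMap`). With `Y =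
N` this is `Tu`; with `Y = T*M ⊗ TN` it is a family `W` of linear maps on the spaces `T_xM`. Writing
the components of `W μ` as `((μ', λ), A)`, tests with functions pulled back from `M` and from `N`
give `μ' = μ` and `λ = Tu μ`. The morphism of `W` is then the second derivative, and any other
candidate agrees with it almost everywhere (`IsSecondColocalWeakDeriv.eq_homMor`).

The vertical lift formula is the case `μ = 0`. Commutation with the flips means `λ = Tu μ` together
with the symmetry of `A` in `(μ, e)`. That symmetry is Schwarz's theorem for `f ∘ u`, but the first
derivatives of `f ∘ u` need not be weakly differentiable: only cutoffs of them, in the variable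
`Tu`, are. The substitute is `HasWeakLineDerivOn.ae_mixed_eq`: if a weakly differentiable field
coincides with a gradient on the set where a weakly differentiable function `h` is nonzero, its
mixed derivatives agree almost everywhere there. In the plane, near a Lebesgue point of that set,
many horizontal and vertical lines avoid the zeros of `h` up to null sets. They bound rectangles
comparable to the small square, on which Green's formula makes the curl integrate to zero. -/

noncomputable section

set_option linter.unusedSectionVars false

/-! ### Weak directional derivatives and the fundamental theorem of calculus on lines -/

section WeakLineDerivative

variable {E : Type*} [NormedAddCommGroup E] [NormedSpace ℝ E] [MeasurableSpace E] [BorelSpace E]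

/-- `D` is the weak derivative of `g` in the direction `v` on `Ω`. -/
def HasWeakLineDerivOn (μ : Measure E) (Ω : Set E) (v : E) (g D : E → ℝ) : Prop :=
  LocallyIntegrableOn g Ω μ ∧ LocallyIntegrableOn D Ω μ ∧
    ∀ φ : E → ℝ, ContDiff ℝ ∞ φ → HasCompactSupport φ → tsupport φ ⊆ Ω →
      ∫ z in Ω, g z * fderiv ℝ φ z v ∂μ = -∫ z in Ω, D z * φ z ∂μ

variable [FiniteDimensional ℝ E] {μ : Measure E} [μ.IsAddHaarMeasure]

/-- The shear `(a, x) ↦ (a, x + c a)` preserves the product measure. -/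
theorem measurePreserving_shear {A : Type*} [MeasurableSpace A] (ν : Measure A) [SFinite ν]
    {c : A → E} (hc : Measurable c) :
    MeasurePreserving (fun p : A × E => (p.1, p.2 + c p.1)) (ν.prod μ) (ν.prod μ) := by
  refine (MeasurePreserving.id ν).skew_product (g := fun a x => x + c a) ?_ ?_
  · exact measurable_snd.add (hc.comp measurable_fst)
  · exact Eventually.of_forall fun a => (measurePreserving_add_right μ (c a)).map_eq

theorem integrable_shear {A : Type*} [MeasurableSpace A] (ν : Measure A) [IsFiniteMeasure ν]
    {c : A → E} (hc : Measurable c) {D : E → ℝ} (hD : Integrable D μ) :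
    Integrable (fun p : A × E => D (p.2 + c p.1)) (ν.prod μ) :=
  (measurePreserving_shear (μ := μ) ν hc).integrable_comp_of_integrable (hD.comp_snd ν)

/-- A property that holds almost everywhere holds almost everywhere on almost all translates of a
family of points. -/
theorem ae_prod_translate {A : Type*} [MeasurableSpace A] (ν : Measure A) [SFinite ν]
    {c : A → E} (hc : Measurable c) {P : E → Prop} (hP : ∀ᵐ x ∂μ, P x) :
    ∀ᵐ p ∂(μ.prod ν), P (p.1 + c p.2) := by
  have h1 : ∀ᵐ p ∂(ν.prod μ), P p.2 := Measure.quasiMeasurePreserving_snd.ae hP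
  have h2 : ∀ᵐ p ∂(ν.prod μ), P (p.2 + c p.1) :=
    (measurePreserving_shear (μ := μ) ν hc).quasiMeasurePreserving.ae h1
  exact (Measure.measurePreserving_swap (μ := μ) (ν := ν)).quasiMeasurePreserving.ae h2

theorem ae_ae_line (ν : Measure ℝ) [SFinite ν] (v : E) {P : E → Prop} (hP : ∀ᵐ x ∂μ, P x) :
    ∀ᵐ x ∂μ, ∀ᵐ s ∂ν, P (x + s • v) :=
  Measure.ae_ae_of_ae_prod
    (ae_prod_translate ν (c := fun s : ℝ => s • v) (measurable_id.smul_const v) hP)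

theorem integral_mul_comp_sub {φ : E → ℝ} {f : E → ℝ} (w : E) :
    ∫ x, f x * φ (x - w) ∂μ = ∫ x, f (x + w) * φ x ∂μ := by
  rw [← integral_add_right_eq_self (μ := μ) (fun x => f x * φ (x - w)) w]
  simp

/-- Differentiation under the integral sign falls entirely on the test function, so no regularity of
`g` is needed. Translating `φ` by `σ • v` is dual to translating `g` by `-σ • v`. -/
theorem hasDerivAt_integral_mul_translate {g : E → ℝ} (hg : Integrable g μ) {φ : E → ℝ}
    (hφ : ContDiff ℝ ∞ φ) (hφc : HasCompactSupport φ) (v : E) (σ : ℝ) :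
    HasDerivAt (fun σ : ℝ => ∫ x, g x * φ (x - σ • v) ∂μ)
      (∫ x, g x * -(fderiv ℝ φ (x - σ • v) v) ∂μ) σ := by
  have hd : Differentiable ℝ φ := hφ.differentiable (by simp)
  have hdc : Continuous (fderiv ℝ φ) := hφ.continuous_fderiv (by simp)
  obtain ⟨C, hC⟩ := (hφc.fderiv ℝ).exists_bound_of_continuous hdc
  obtain ⟨C', hC'⟩ := hφc.exists_bound_of_continuous hφ.continuous
  refine (hasDerivAt_integral_of_dominated_loc_of_deriv_le (s := univ)
    (F := fun σ x => g x * φ (x - σ • v)) (F' := fun σ x => g x * -(fderiv ℝ φ (x - σ • v) v))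
    (bound := fun x => ‖g x‖ * (C * ‖v‖)) univ_mem ?_ ?_ ?_ ?_ ?_ ?_).2
  · exact Eventually.of_forall fun σ => hg.aestronglyMeasurable.mul
      (hφ.continuous.comp (by fun_prop)).aestronglyMeasurable
  · exact hg.mul_bdd (c := C') (hφ.continuous.comp (by fun_prop)).aestronglyMeasurable
      (Eventually.of_forall fun x => hC' _)
  · exact hg.aestronglyMeasurable.mul (Continuous.aestronglyMeasurable (by fun_prop))
  · refine Eventually.of_forall fun x σ _ => ?_
    rw [norm_mul, norm_neg]
    gcongr
    exact ((fderiv ℝ φ _).le_opNorm v).trans (by gcongr; exact hC _)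
  · exact hg.norm.mul_const _
  · refine Eventually.of_forall fun x σ _ => ?_
    have h1 : HasDerivAt (fun σ : ℝ => x - σ • v) (-v) σ := by
      simpa using ((hasDerivAt_id σ).smul_const v).const_sub x
    have h2 := (hd (x - σ • v)).hasFDerivAt.comp_hasDerivAt σ h1
    simpa using h2.const_mul (g x)

theorem setIntegral_eq_integral_indicator_mul {Ω C : Set E}
    (hCΩ : C ⊆ Ω) {f ψ : E → ℝ} (hψ : ∀ x ∉ C, ψ x = 0) :
    ∫ x in Ω, f x * ψ x ∂μ = ∫ x, C.indicator f x * ψ x ∂μ := by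
  have h : (fun x => C.indicator f x * ψ x) = fun x => f x * ψ x := by
    funext x
    by_cases hx : x ∈ C
    · simp [hx]
    · simp [hx, hψ x hx]
  rw [h]
  exact setIntegral_eq_integral_of_forall_compl_eq_zero fun x hx => by
    rw [hψ x fun h => hx (hCΩ h), mul_zero]

/-- Weakly differentiable functions satisfy the fundamental theorem of calculus on almost every
translate of a segment. -/
theorem HasWeakLineDerivOn.ae_sub_eq {Ω : Set E} {v : E} {g D : E → ℝ}
    (h : HasWeakLineDerivOn μ Ω v g D) {U C : Set E} (hU : IsOpen U) (hC : IsCompact C)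
    (hCΩ : C ⊆ Ω) (hUC : ∀ x ∈ U, ∀ σ ∈ Icc (0 : ℝ) 1, x + σ • v ∈ C) :
    ∀ᵐ x ∂μ, x ∈ U → IntervalIntegrable (fun σ : ℝ => D (x + σ • v)) volume 0 1 ∧
      g (x + v) - g x = ∫ σ in (0 : ℝ)..1, D (x + σ • v) := by
  obtain ⟨hg, hD, hw⟩ := h
  -- Truncation to the compact set `C` turns local integrability into integrability, so that
  -- translations and Fubini are available on the whole space. Nothing changes for base points in
  -- `U`, whose segments stay in `C`.
  set g' := C.indicator g with hg'
  set D' := C.indicator D with hD'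
  have ig : Integrable g' μ :=
    (integrable_indicator_iff hC.measurableSet).2 (hg.integrableOn_compact_subset hCΩ hC)
  have iD : Integrable D' μ :=
    (integrable_indicator_iff hC.measurableSet).2 (hD.integrableOn_compact_subset hCΩ hC)
  have ish := integrable_shear (volume.restrict (Ioc (0 : ℝ) 1)) (measurable_id.smul_const v) iD
  have hsec : ∀ᵐ x ∂μ, Integrable (fun σ : ℝ => D' (x + σ • v)) (volume.restrict (Ioc (0 : ℝ) 1)) :=
    ish.prod_left_ae
  have iint : Integrable (fun x => ∫ σ in (0 : ℝ)..1, D' (x + σ • v)) μ := by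
    simp_rw [intervalIntegral.integral_of_le zero_le_one]
    exact ish.integral_prod_right
  have iF : Integrable (fun x => g' (x + v) - g' x - ∫ σ in (0 : ℝ)..1, D' (x + σ • v)) μ :=
    ((ig.comp_add_right v).sub ig).sub iint
  have key : ∀ᵐ x ∂μ, x ∈ U → g' (x + v) - g' x - ∫ σ in (0 : ℝ)..1, D' (x + σ • v) = 0 := by
    refine hU.ae_eq_zero_of_integral_contDiff_smul_eq_zero (iF.locallyIntegrable.locallyIntegrableOn U)
      fun φ hφ hφc hφU => ?_
    obtain ⟨B, hB⟩ := hφc.exists_bound_of_continuous hφ.continuous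
    -- Let c(σ) = ∫ g' φ(· - σv). For σ in [0, 1] the translated test function is supported in `C`,
    -- and the definition of the weak derivative reads c'(σ) = ∫ D' φ(· - σv). Integrating over [0,
    -- 1] and undoing the translations shows that the defect in the claimed identity is orthogonal
    -- to `φ`.
    have hder := hasDerivAt_integral_mul_translate ig hφ hφc v
    have hcont : Continuous fun σ : ℝ => ∫ x, D' x * φ (x - σ • v) ∂μ :=
      continuous_iff_continuousAt.2 fun σ =>
        (hasDerivAt_integral_mul_translate iD hφ hφc v σ).continuousAt
    have hder' : ∀ σ ∈ uIcc (0 : ℝ) 1,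
        HasDerivAt (fun σ : ℝ => ∫ x, g' x * φ (x - σ • v) ∂μ)
          (∫ x, D' x * φ (x - σ • v) ∂μ) σ := by
      intro σ hσ
      rw [uIcc_of_le zero_le_one] at hσ
      have hts : ∀ x ∉ C, x - σ • v ∉ tsupport φ := fun x hx hx' => hx (by
        simpa using hUC _ (hφU hx') σ hσ)
      convert hder σ using 1
      have hφ' : ContDiff ℝ ∞ fun x => φ (x - σ • v) := hφ.comp (by fun_prop)
      have hcs : HasCompactSupport fun x => φ (x - σ • v) :=
        HasCompactSupport.of_support_subset_isCompact hC fun x hx => by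
          by_contra hxC
          exact hx (image_eq_zero_of_notMem_tsupport (hts x hxC))
      have htsup : tsupport (fun x => φ (x - σ • v)) ⊆ Ω := by
        refine subset_trans (closure_minimal ?_ hC.isClosed) hCΩ
        intro x hx
        by_contra hxC
        exact hx (image_eq_zero_of_notMem_tsupport (hts x hxC))
      have hfd : ∀ x, fderiv ℝ (fun x => φ (x - σ • v)) x = fderiv ℝ φ (x - σ • v) := fun x => by
        simpa [sub_eq_add_neg] using fderiv_comp_add_right (𝕜 := ℝ) (f := φ) (x := x) (-(σ • v))
      have := hw _ hφ' hcs htsup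
      simp_rw [hfd] at this
      rw [setIntegral_eq_integral_indicator_mul hCΩ,
        setIntegral_eq_integral_indicator_mul hCΩ] at this
      · simp_rw [mul_neg, integral_neg]
        rw [this, neg_neg]
      · exact fun x hx => image_eq_zero_of_notMem_tsupport (hts x hx)
      · intro x hx
        rw [image_eq_zero_of_notMem_tsupport
          (fun hh => hts x hx (tsupport_fderiv_subset ℝ hh))]
        simp
    have hftc := intervalIntegral.integral_eq_sub_of_hasDerivAt hder'
      (hcont.intervalIntegrable 0 1)
    have hswap : ∫ σ in (0 : ℝ)..1, ∫ x, D' x * φ (x - σ • v) ∂μ =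
        ∫ x, φ x * (∫ σ in (0 : ℝ)..1, D' (x + σ • v)) ∂μ := by
      simp_rw [integral_mul_comp_sub, intervalIntegral.integral_of_le zero_le_one]
      rw [integral_integral_swap]
      · refine integral_congr_ae (Eventually.of_forall fun x => ?_)
        simp only [integral_mul_const]
        ring
      · exact ish.mul_bdd (c := B) (hφ.continuous.comp continuous_snd).aestronglyMeasurable
          (Eventually.of_forall fun x => hB _)
    have i1 : Integrable (fun x => φ x * g' (x + v)) μ :=
      (ig.comp_add_right v).bdd_mul (c := B) hφ.continuous.aestronglyMeasurable
        (Eventually.of_forall hB)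
    have i2 : Integrable (fun x => φ x * g' x) μ :=
      ig.bdd_mul (c := B) hφ.continuous.aestronglyMeasurable (Eventually.of_forall hB)
    have i3 : Integrable (fun x => φ x * ∫ σ in (0 : ℝ)..1, D' (x + σ • v)) μ :=
      iint.bdd_mul (c := B) hφ.continuous.aestronglyMeasurable (Eventually.of_forall hB)
    simp_rw [smul_eq_mul, mul_sub]
    have i12 : Integrable (fun x => φ x * g' (x + v) - φ x * g' x) μ := i1.sub i2
    rw [integral_sub i12 i3, integral_sub i1 i2, ← hswap, hftc]
    simp only [integral_mul_comp_sub, one_smul, zero_smul, add_zero]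
    simp_rw [mul_comm (φ _)]
    ring
  filter_upwards [key, hsec] with x hx hx2 hxU
  have hE : ∀ σ ∈ Icc (0 : ℝ) 1, D' (x + σ • v) = D (x + σ • v) := fun σ hσ =>
    indicator_of_mem (hUC x hxU σ hσ) _
  have h0 : g' x = g x := indicator_of_mem (by simpa using hUC x hxU 0 (by simp)) _
  have h1 : g' (x + v) = g (x + v) := indicator_of_mem (by simpa using hUC x hxU 1 (by simp)) _
  constructor
  · rw [intervalIntegrable_iff_integrableOn_Ioc_of_le zero_le_one]
    exact Integrable.congr hx2 ((ae_restrict_iff' measurableSet_Ioc).2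
      (Eventually.of_forall fun σ hσ => hE σ ⟨hσ.1.le, hσ.2⟩))
  · have := hx hxU
    rw [h0, h1, sub_eq_zero] at this
    rw [this]
    refine intervalIntegral.integral_congr fun σ hσ => ?_
    rw [uIcc_of_le zero_le_one] at hσ
    exact hE σ hσ

end WeakLineDerivative

section WeakLineDerivative

variable {E : Type*} [NormedAddCommGroup E] [NormedSpace ℝ E] [MeasurableSpace E] [BorelSpace E]
  [FiniteDimensional ℝ E] {μ : Measure E} [μ.IsAddHaarMeasure]

theorem HasWeakLineDerivOn.const_smul {Ω : Set E} {v : E} {g D : E → ℝ}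
    (h : HasWeakLineDerivOn μ Ω v g D) (c : ℝ) :
    HasWeakLineDerivOn μ Ω (c • v) g (fun x => c * D x) := by
  refine ⟨h.1, h.2.1.smul c, fun φ hφ hc hΩ => ?_⟩
  have := h.2.2 φ hφ hc hΩ
  simp_rw [map_smul, smul_eq_mul, mul_left_comm _ c, mul_assoc c]
  rw [integral_const_mul, integral_const_mul, this, mul_neg]

/-- On almost every line, a weakly differentiable function is almost everywhere equal to the
primitive of its weak derivative. -/
theorem HasWeakLineDerivOn.ae_prod_eq {Ω : Set E} {v : E} {g D : E → ℝ}
    (h : HasWeakLineDerivOn μ Ω v g D) {U C : Set E} (hU : IsOpen U) (hC : IsCompact C)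
    (hCΩ : C ⊆ Ω) (hUC : ∀ x ∈ U, ∀ σ ∈ Icc (0 : ℝ) 1, x + σ • v ∈ C) :
    ∀ᵐ p : E × ℝ ∂(μ.prod (volume.restrict (Icc (0 : ℝ) 1))), p.1 ∈ U →
      g (p.1 + p.2 • v) = g p.1 + ∫ σ in (0 : ℝ)..p.2, D (p.1 + σ • v) := by
  have ig : Integrable (C.indicator g) μ :=
    (integrable_indicator_iff hC.measurableSet).2 (h.1.integrableOn_compact_subset hCΩ hC)
  have iD : Integrable (C.indicator D) μ :=
    (integrable_indicator_iff hC.measurableSet).2 (h.2.1.integrableOn_compact_subset hCΩ hC)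
  -- For every fixed `s` the identity follows from `HasWeakLineDerivOn.ae_sub_eq` in the direction
  -- `s • v`. Passing from each `s` to almost every pair requires a measurable exceptional set,
  -- hence measurable representatives of `g` and `D`.
  obtain ⟨g', hg', hgg⟩ := ig.aestronglyMeasurable
  obtain ⟨D', hD', hDD⟩ := iD.aestronglyMeasurable
  set S : Set (E × ℝ) := {p | p.1 ∈ U →
    g' (p.1 + p.2 • v) - g' p.1 = ∫ σ in Ioc (0 : ℝ) 1, p.2 * D' (p.1 + σ • p.2 • v)} with hS
  have hSm : MeasurableSet S := by
    have hm1 : Measurable fun p : E × ℝ => g' (p.1 + p.2 • v) - g' p.1 := by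
      have := hg'.measurable
      fun_prop
    have hm2 : Measurable fun p : E × ℝ =>
        ∫ σ in Ioc (0 : ℝ) 1, p.2 * D' (p.1 + σ • p.2 • v) := by
      have hs : StronglyMeasurable (fun q : (E × ℝ) × ℝ =>
          q.1.2 * D' (q.1.1 + q.2 • q.1.2 • v)) := by
        have := hD'.measurable
        exact Measurable.stronglyMeasurable (by fun_prop)
      exact hs.integral_prod_right.measurable
    rw [hS]
    simp only [imp_iff_not_or]
    exact ((hU.measurableSet.preimage measurable_fst).compl).union (measurableSet_eq_fun hm1 hm2)
  have hslice : ∀ s ∈ Icc (0 : ℝ) 1, ∀ᵐ x ∂μ, (x, s) ∈ S := by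
    intro s hs
    have hUC' : ∀ x ∈ U, ∀ σ ∈ Icc (0 : ℝ) 1, x + σ • s • v ∈ C := fun x hx σ hσ => by
      rw [smul_smul]
      exact hUC x hx _ ⟨mul_nonneg hσ.1 hs.1, mul_le_one₀ hσ.2 hs.1 hs.2⟩
    have h1 := (h.const_smul s).ae_sub_eq hU hC hCΩ hUC'
    have h2 := ae_ae_line (volume.restrict (Ioc (0 : ℝ) 1)) (s • v) hDD
    have h3 : ∀ᵐ x ∂μ, C.indicator g (x + s • v) = g' (x + s • v) :=
      (measurePreserving_add_right μ (s • v)).quasiMeasurePreserving.ae hgg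
    filter_upwards [h1, h2, h3, hgg] with x hx1 hx2 hx3 hx4 hxU
    have e0 : x ∈ C := by simpa using hUC x hxU 0 (by simp)
    have e1 : x + s • v ∈ C := hUC x hxU s hs
    rw [indicator_of_mem e0] at hx4
    rw [indicator_of_mem e1] at hx3
    simp only
    rw [← hx3, ← hx4, (hx1 hxU).2, intervalIntegral.integral_of_le zero_le_one]
    refine setIntegral_congr_ae measurableSet_Ioc ?_
    filter_upwards [(ae_restrict_iff' measurableSet_Ioc).1 hx2] with σ hσ hσ'
    rw [← hσ hσ', indicator_of_mem (hUC' x hxU σ ⟨hσ'.1.le, hσ'.2⟩)]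
  have hprod : ∀ᵐ p ∂((volume.restrict (Icc (0 : ℝ) 1)).prod μ), p.swap ∈ S :=
    (Measure.ae_prod_iff_ae_ae (hSm.preimage measurable_swap)).2
      ((ae_restrict_iff' measurableSet_Icc).2 (Eventually.of_forall hslice))
  have hprod' : ∀ᵐ p ∂(μ.prod (volume.restrict (Icc (0 : ℝ) 1))), p ∈ S := by
    simpa using (Measure.measurePreserving_swap (μ := μ)
      (ν := volume.restrict (Icc (0 : ℝ) 1))).quasiMeasurePreserving.ae hprod
  have h2 := Measure.quasiMeasurePreserving_fst (μ := μ) (ν := volume.restrict (Icc (0 : ℝ) 1)) |>.ae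
    (ae_ae_line (volume.restrict (Icc (0 : ℝ) 1)) v hDD)
  have h3 := ae_prod_translate (volume.restrict (Icc (0 : ℝ) 1)) (c := fun s : ℝ => s • v)
    (measurable_id.smul_const v) hgg
  have h4 := Measure.quasiMeasurePreserving_fst (μ := μ) (ν := volume.restrict (Icc (0 : ℝ) 1)) |>.ae
    hgg
  have h5 := Measure.quasiMeasurePreserving_snd (μ := μ) (ν := volume.restrict (Icc (0 : ℝ) 1)) |>.ae
    (ae_restrict_mem measurableSet_Icc)
  filter_upwards [hprod', h2, h3, h4, h5] with ⟨x, s⟩ hs hx2 hs3 hx4 hsI hxU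
  have hx2' := (ae_restrict_iff' measurableSet_Icc).1 hx2
  simp only at hs3 hx4 hsI hxU
  have e0 : x ∈ C := by simpa using hUC x hxU 0 (by simp)
  have e1 : x + s • v ∈ C := hUC x hxU s hsI
  rw [indicator_of_mem e0] at hx4
  rw [indicator_of_mem e1] at hs3
  have := hs hxU
  simp only at this
  rw [hs3, hx4]
  rw [sub_eq_iff_eq_add'] at this
  rw [this, ← intervalIntegral.integral_of_le zero_le_one, intervalIntegral.integral_const_mul]
  simp_rw [smul_smul]
  rw [intervalIntegral.mul_integral_comp_mul_right (f := fun σ => D' (x + σ • v)), zero_mul,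
    one_mul]
  congr 1
  refine intervalIntegral.integral_congr_ae ?_
  filter_upwards [hx2'] with σ hσ hσ'
  rw [uIoc_of_le hsI.1] at hσ'
  have hσI : σ ∈ Icc (0 : ℝ) 1 := ⟨hσ'.1.le, hσ'.2.trans hsI.2⟩
  rw [← hσ hσI, indicator_of_mem (hUC x hxU σ hσI)]

theorem HasWeakLineDerivOn.ae_ae_eq {Ω : Set E} {v : E} {g D : E → ℝ}
    (h : HasWeakLineDerivOn μ Ω v g D) {U C : Set E} (hU : IsOpen U) (hC : IsCompact C)
    (hCΩ : C ⊆ Ω) (hUC : ∀ x ∈ U, ∀ σ ∈ Icc (0 : ℝ) 1, x + σ • v ∈ C) :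
    ∀ᵐ x ∂μ, x ∈ U → ∀ᵐ s ∂(volume.restrict (Icc (0 : ℝ) 1)),
      g (x + s • v) = g x + ∫ σ in (0 : ℝ)..s, D (x + σ • v) := by
  filter_upwards [Measure.ae_ae_of_ae_prod (h.ae_prod_eq hU hC hCΩ hUC)] with x hx hxU
  exact hx.mono fun s hs => hs hxU

/-- The fundamental theorem of calculus on almost every segment characterizes the weak
derivative. -/
theorem HasWeakLineDerivOn.of_ae_sub_eq {Ω : Set E} (hΩ : IsOpen Ω) {v : E} {g D : E → ℝ}
    (hg : LocallyIntegrableOn g Ω μ) (hD : LocallyIntegrableOn D Ω μ)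
    (H : ∀ K ⊆ Ω, IsCompact K → ∃ ε > 0, ∀ s ∈ Ioo (0 : ℝ) ε, ∀ᵐ x ∂μ, x ∈ K →
      g (x + s • v) - g x = ∫ σ in (0 : ℝ)..1, s * D (x + σ • s • v)) :
    HasWeakLineDerivOn μ Ω v g D := by
  refine ⟨hg, hD, fun φ hφ hφc hφΩ => ?_⟩
  obtain ⟨δ, hδ, hδΩ⟩ := IsCompact.exists_cthickening_subset_open hφc hΩ hφΩ
  set C := Metric.cthickening δ (tsupport φ) with hCdef
  have hC : IsCompact C := IsCompact.cthickening hφc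
  obtain ⟨ε, hε, hH⟩ := H _ hφΩ hφc
  have ig : Integrable (C.indicator g) μ :=
    (integrable_indicator_iff hC.measurableSet).2 (hg.integrableOn_compact_subset hδΩ hC)
  have iD : Integrable (C.indicator D) μ :=
    (integrable_indicator_iff hC.measurableSet).2 (hD.integrableOn_compact_subset hδΩ hC)
  obtain ⟨B, hB⟩ := hφc.exists_bound_of_continuous hφ.continuous
  have hsub : tsupport φ ⊆ C := Metric.self_subset_cthickening _
  have hφ0 : ∀ x ∉ C, φ x = 0 := fun x hx =>
    image_eq_zero_of_notMem_tsupport fun h => hx (hsub h)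
  have hfφ0 : ∀ x ∉ C, fderiv ℝ φ x v = 0 := fun x hx => by
    rw [image_eq_zero_of_notMem_tsupport fun h => hx (hsub (tsupport_fderiv_subset ℝ h))]; rfl
  rw [setIntegral_eq_integral_indicator_mul hδΩ hfφ0, setIntegral_eq_integral_indicator_mul hδΩ hφ0]
  -- The function c(s) = ∫ g φ(· - sv) has derivative -∫ g ∂ᵥφ at 0. By hypothesis its increment
  -- from 0 to a small s > 0 is the integral over [0, s] of the continuous function ∫ D φ(· - σv),
  -- whose value at 0 is ∫ D φ. Equality of the two right derivatives at 0 is the claim.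
  have hder := hasDerivAt_integral_mul_translate ig hφ hφc v 0
  have hdcont : Continuous fun σ : ℝ => ∫ x, C.indicator D x * φ (x - σ • v) ∂μ :=
    continuous_iff_continuousAt.2 fun σ =>
      (hasDerivAt_integral_mul_translate iD hφ hφc v σ).continuousAt
  have hder2 := (hdcont.integral_hasStrictDerivAt 0 0).hasDerivAt
  set c := fun σ : ℝ => ∫ x, C.indicator g x * φ (x - σ • v) ∂μ with hc
  obtain ⟨η, hη, hηv⟩ : ∃ η > 0, η * ‖v‖ ≤ δ := by
    refine ⟨δ / (‖v‖ + 1), by positivity, ?_⟩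
    rw [div_mul_eq_mul_div, div_le_iff₀ (by positivity)]
    nlinarith [norm_nonneg v]
  have heq : ∀ s ∈ Ioo (0 : ℝ) (min ε η),
      c s - c 0 = ∫ σ in (0 : ℝ)..s, ∫ x, C.indicator D x * φ (x - σ • v) ∂μ := by
    intro s hs
    have hmem : ∀ x ∈ tsupport φ, ∀ σ ∈ Icc (0 : ℝ) 1, x + σ • s • v ∈ C := fun x hx σ hσ => by
      refine Metric.mem_cthickening_of_dist_le _ x δ _ hx ?_
      rw [dist_eq_norm, add_sub_cancel_left, norm_smul, norm_smul, Real.norm_of_nonneg hσ.1,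
        Real.norm_of_nonneg hs.1.le]
      have h1 : s * ‖v‖ ≤ η * ‖v‖ := by
        gcongr
        exact hs.2.le.trans (min_le_right _ _)
      have h2 : σ * (s * ‖v‖) ≤ s * ‖v‖ :=
        mul_le_of_le_one_left (mul_nonneg hs.1.le (norm_nonneg v)) hσ.2
      linarith
    have ish := integrable_shear (volume.restrict (Ioc (0 : ℝ) 1)) (measurable_id.smul_const (s • v)) iD
    have i1 : Integrable (fun x => C.indicator g (x + s • v) * φ x) μ :=
      (ig.comp_add_right (s • v)).mul_bdd (c := B) hφ.continuous.aestronglyMeasurable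
        (Eventually.of_forall hB)
    have i2 : Integrable (fun x => C.indicator g x * φ x) μ :=
      ig.mul_bdd (c := B) hφ.continuous.aestronglyMeasurable (Eventually.of_forall hB)
    have hcs : c s - c 0 = ∫ x, (∫ σ in (0 : ℝ)..1, s * C.indicator D (x + σ • s • v)) * φ x ∂μ := by
      simp only [hc, integral_mul_comp_sub, zero_smul, add_zero]
      rw [← integral_sub i1 i2]
      refine integral_congr_ae ?_
      filter_upwards [hH s ⟨hs.1, hs.2.trans_le (min_le_left _ _)⟩] with x hx
      by_cases hxK : x ∈ tsupport φ
      · have e0 : x ∈ C := by simpa using hmem x hxK 0 (by simp)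
        have e1 : x + s • v ∈ C := by simpa using hmem x hxK 1 (by simp)
        rw [indicator_of_mem e0, indicator_of_mem e1, ← sub_mul, hx hxK]
        congr 1
        refine intervalIntegral.integral_congr fun σ hσ => ?_
        rw [uIcc_of_le zero_le_one] at hσ
        rw [indicator_of_mem (hmem x hxK σ hσ)]
      · simp [image_eq_zero_of_notMem_tsupport hxK]
    rw [hcs]
    have e3 : ∫ σ in (0 : ℝ)..s, ∫ x, C.indicator D x * φ (x - σ • v) ∂μ =
        ∫ σ in (0 : ℝ)..1, ∫ x, s * C.indicator D (x + σ • s • v) * φ x ∂μ := by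
      have : ∀ σ : ℝ, ∫ x, s * C.indicator D (x + σ • s • v) * φ x ∂μ =
          s * ∫ x, C.indicator D (x + σ • s • v) * φ x ∂μ := fun σ => by
        rw [← integral_const_mul]
        simp_rw [mul_assoc]
      simp_rw [this]
      rw [intervalIntegral.integral_const_mul]
      simp_rw [integral_mul_comp_sub, smul_smul]
      rw [intervalIntegral.mul_integral_comp_mul_right
        (f := fun σ => ∫ x, C.indicator D (x + σ • v) * φ x ∂μ), zero_mul, one_mul]
    rw [e3]
    rw [intervalIntegral.integral_of_le zero_le_one, integral_integral_swap]
    · simp_rw [intervalIntegral.integral_of_le zero_le_one]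
      exact integral_congr_ae (Eventually.of_forall fun x => by simp only [integral_mul_const])
    · exact (ish.const_mul s).mul_bdd (c := B) (hφ.continuous.comp continuous_snd).aestronglyMeasurable
        (Eventually.of_forall fun x => hB _)
  have hev : ∀ᶠ s in 𝓝[>] (0 : ℝ),
      c s = c 0 + ∫ σ in (0 : ℝ)..s, ∫ x, C.indicator D x * φ (x - σ • v) ∂μ := by
    filter_upwards [Ioo_mem_nhdsGT (lt_min hε hη)] with s hs
    rw [← heq s hs]; ring
  have hd1 : HasDerivWithinAt c (∫ x, C.indicator D x * φ (x - (0 : ℝ) • v) ∂μ) (Ioi 0) 0 :=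
    ((hder2.const_add (c 0)).hasDerivWithinAt).congr_of_eventuallyEq hev (by simp)
  have := (uniqueDiffWithinAt_Ioi (0 : ℝ)).eq_deriv _ hder.hasDerivWithinAt hd1
  simp only [mul_neg, integral_neg, zero_smul, sub_zero] at this
  linarith

end WeakLineDerivative

/-! ### The chain rule, and the weak derivative on the zero set -/

section ChainRule

/-- The chain rule for the composition of a Lipschitz `C¹` function with primitives of integrable
functions. -/
theorem comp_primitive_sub_eq_integral {ι : Type*} [Fintype ι] {Φ : (ι → ℝ) → ℝ}
    (hΦ : ContDiff ℝ 1 Φ) {L : NNReal} (hL : LipschitzWith L Φ) {κ : ι → ℝ → ℝ}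
    (hκ : ∀ i, IntervalIntegrable (κ i) volume 0 1) {a : ι → ℝ} {Γ : ℝ → ι → ℝ}
    (hΓ : ∀ i, ∀ᵐ s ∂(volume.restrict (Icc (0 : ℝ) 1)), Γ s i = a i + ∫ σ in (0 : ℝ)..s, κ i σ) :
    Φ (fun i => a i + ∫ σ in (0 : ℝ)..1, κ i σ) - Φ a =
      ∫ s in (0 : ℝ)..1, fderiv ℝ Φ (Γ s) (fun i => κ i s) := by
  set γ : ℝ → ι → ℝ := fun s i => a i + ∫ σ in (0 : ℝ)..s, κ i σ with hγ
  have hac : ∀ i, AbsolutelyContinuousOnInterval (fun s => ∫ σ in (0 : ℝ)..s, κ i σ) 0 1 := fun i =>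
    (hκ i).absolutelyContinuousOnInterval_intervalIntegral (c := 0) (by simp)
  -- The variation sums of `Φ ∘ γ` are at most `L` times the sum of those of the components, which
  -- are absolutely continuous as primitives of integrable functions.
  have hac' : AbsolutelyContinuousOnInterval (Φ ∘ γ) 0 1 := by
    have hlim : Tendsto (fun F : ℕ × (ℕ → ℝ × ℝ) => (L : ℝ) * ∑ i, ∑ k ∈ Finset.range F.1,
        dist (∫ σ in (0 : ℝ)..(F.2 k).1, κ i σ) (∫ σ in (0 : ℝ)..(F.2 k).2, κ i σ))
        (AbsolutelyContinuousOnInterval.totalLengthFilter ⊓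
          𝓟 (AbsolutelyContinuousOnInterval.disjWithin 0 1)) (𝓝 0) := by
      have h := (tendsto_finsetSum Finset.univ fun i _ => hac i).const_mul (L : ℝ)
      simpa using h
    refine squeeze_zero (fun F => Finset.sum_nonneg fun _ _ => dist_nonneg) (fun F => ?_) hlim
    rw [Finset.sum_comm, Finset.mul_sum]
    refine Finset.sum_le_sum fun k _ => ?_
    refine (hL.dist_le_mul _ _).trans ?_
    gcongr
    refine (dist_pi_le_iff (Finset.sum_nonneg fun _ _ => dist_nonneg)).2 fun i => ?_
    simp only [hγ, dist_add_left]
    exact Finset.single_le_sum (f := fun i => dist (∫ σ in (0 : ℝ)..(F.2 k).1, κ i σ)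
      (∫ σ in (0 : ℝ)..(F.2 k).2, κ i σ)) (fun _ _ => dist_nonneg) (Finset.mem_univ i)
  have h := hac'.integral_deriv_eq_sub
  have h0 : γ 0 = a := by
    funext i; simp [hγ]
  rw [Function.comp_apply, Function.comp_apply, h0] at h
  change Φ (γ 1) - Φ a = _
  rw [← h]
  have hder : ∀ᵐ s : ℝ, ∀ i, s ∈ uIcc (0 : ℝ) 1 →
      HasDerivAt (fun s => ∫ σ in (0 : ℝ)..s, κ i σ) (κ i s) s := by
    rw [ae_all_iff]
    intro i
    filter_upwards [(hκ i).ae_hasDerivAt_integral] with s hs hs'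
    exact hs hs' 0 (by simp)
  -- `Γ` stands for the original functions restricted to the line, which equal the primitives `γ`
  -- only almost everywhere; this suffices under the integral.
  have hΓ' : ∀ᵐ s : ℝ, ∀ i, s ∈ Icc (0 : ℝ) 1 → Γ s i = γ s i := by
    rw [ae_all_iff]
    exact fun i => (ae_restrict_iff' measurableSet_Icc).1 (hΓ i)
  refine intervalIntegral.integral_congr_ae ?_
  filter_upwards [hder, hΓ'] with s hs hs' hsI
  rw [uIoc_of_le zero_le_one] at hsI
  have hsI' : s ∈ Icc (0 : ℝ) 1 := ⟨hsI.1.le, hsI.2⟩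
  have h1 : Γ s = γ s := funext fun i => hs' i hsI'
  have h2 : HasDerivAt γ (fun i => κ i s) s := hasDerivAt_pi.2 fun i =>
    (hs i (by rwa [uIcc_of_le zero_le_one])).const_add (a i)
  rw [h1]
  exact ((hΦ.differentiable one_ne_zero (γ s)).hasFDerivAt.comp_hasDerivAt s h2).deriv

variable {E : Type*} [NormedAddCommGroup E] [NormedSpace ℝ E]

theorem pi_norm_le_sum_norm {ι : Type*} [Fintype ι] (p : ι → ℝ) : ‖p‖ ≤ ∑ i, ‖p i‖ :=
  (pi_norm_le_iff_of_nonneg (Finset.sum_nonneg fun _ _ => norm_nonneg _)).2 fun i =>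
    Finset.single_le_sum (f := fun i => ‖p i‖) (fun _ _ => norm_nonneg _) (Finset.mem_univ i)

/-- Provides the pair of sets used by the theorems on lines: base points vary in the open set `U`,
and short segments issued from them stay in the compact set `C`. -/
theorem exists_tube [FiniteDimensional ℝ E] {K Ω : Set E} (hK : IsCompact K) (hΩ : IsOpen Ω)
    (hKΩ : K ⊆ Ω) :
    ∃ r > 0, ∃ U C : Set E, IsOpen U ∧ IsCompact C ∧ K ⊆ U ∧ C ⊆ Ω ∧
      ∀ x ∈ U, ∀ w, ‖w‖ ≤ r → x + w ∈ C := by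
  obtain ⟨δ, hδ, hδΩ⟩ := hK.exists_cthickening_subset_open hΩ hKΩ
  refine ⟨δ / 2, by positivity, Metric.thickening (δ / 2) K, Metric.cthickening δ K,
    Metric.isOpen_thickening, hK.cthickening, Metric.self_subset_thickening (by positivity) K, hδΩ,
    fun x hx w hw => ?_⟩
  obtain ⟨z, hz, hxz⟩ := Metric.mem_thickening_iff.1 hx
  refine Metric.mem_cthickening_of_dist_le _ z δ K hz ?_
  calc dist (x + w) z ≤ dist (x + w) x + dist x z := dist_triangle _ _ _
    _ ≤ δ / 2 + δ / 2 := by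
        gcongr
        simpa [dist_eq_norm] using hw
    _ = δ := by ring

theorem exists_pos_forall_norm_smul_smul_le (v : E) {r : ℝ} (hr : 0 < r) :
    ∃ ε > 0, ∀ s ∈ Ioo (0 : ℝ) ε, ∀ σ ∈ Icc (0 : ℝ) 1, ‖σ • s • v‖ ≤ r := by
  refine ⟨r / (‖v‖ + 1), by positivity, fun s hs σ hσ => ?_⟩
  rw [norm_smul, norm_smul, Real.norm_of_nonneg hσ.1, Real.norm_of_nonneg hs.1.le]
  have h1 : s * (‖v‖ + 1) ≤ r := ((lt_div_iff₀ (by positivity)).1 hs.2).le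
  have h2 : σ * (s * ‖v‖) ≤ s * ‖v‖ :=
    mul_le_of_le_one_left (mul_nonneg hs.1.le (norm_nonneg v)) hσ.2
  nlinarith [hs.1]

variable [MeasurableSpace E] [BorelSpace E]
  [FiniteDimensional ℝ E] {μ : Measure E} [μ.IsAddHaarMeasure]

/-- The chain rule for weak derivatives. -/
theorem HasWeakLineDerivOn.comp {ι : Type*} [Fintype ι] {Φ : (ι → ℝ) → ℝ}
    (hΦ : ContDiff ℝ 1 Φ) {L : NNReal} (hL : LipschitzWith L Φ) {Ω : Set E} (hΩ : IsOpen Ω) {v : E}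
    {g D : ι → E → ℝ} (h : ∀ i, HasWeakLineDerivOn μ Ω v (g i) (D i)) :
    HasWeakLineDerivOn μ Ω v (fun x => Φ fun i => g i x)
      (fun x => fderiv ℝ Φ (fun i => g i x) fun i => D i x) := by
  have hlc : IsLocallyClosed Ω := hΩ.isLocallyClosed
  have hgK : ∀ K ⊆ Ω, IsCompact K → ∀ i, IntegrableOn (g i) K μ := fun K hKΩ hK i =>
    (h i).1.integrableOn_compact_subset hKΩ hK
  have hDK : ∀ K ⊆ Ω, IsCompact K → ∀ i, IntegrableOn (D i) K μ := fun K hKΩ hK i =>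
    (h i).2.1.integrableOn_compact_subset hKΩ hK
  have hfc : Continuous (fderiv ℝ Φ) := hΦ.continuous_fderiv one_ne_zero
  -- The characterization by segments reduces the rule to one variable, where
  -- `comp_primitive_sub_eq_integral` applies. The Lipschitz bound dominates both the composition
  -- and its derivative, giving their local integrability.
  refine HasWeakLineDerivOn.of_ae_sub_eq hΩ ?_ ?_ ?_
  · refine (locallyIntegrableOn_iff hlc).2 fun K hKΩ hK => ?_
    have : IsFiniteMeasure (μ.restrict K) := ⟨by simpa using hK.measure_lt_top⟩
    refine Integrable.mono' (g := fun x => ‖Φ 0‖ + L * ∑ i, ‖g i x‖)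
      ((integrable_const _).add ((integrable_finsetSum _ fun i _ => (hgK K hKΩ hK i).norm).const_mul _))
      (hΦ.continuous.comp_aestronglyMeasurable
        (aemeasurable_pi_iff.2 fun i => (hgK K hKΩ hK i).aestronglyMeasurable.aemeasurable).aestronglyMeasurable)
      (Eventually.of_forall fun x => ?_)
    have h1 : ‖Φ (fun i => g i x) - Φ 0‖ ≤ L * ‖(fun i => g i x) - 0‖ := hL.norm_sub_le _ _
    have h2 : ‖(fun i => g i x)‖ ≤ ∑ i, ‖g i x‖ := pi_norm_le_sum_norm _
    rw [sub_zero] at h1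
    calc ‖Φ fun i => g i x‖ ≤ ‖Φ 0‖ + ‖Φ (fun i => g i x) - Φ 0‖ := norm_le_norm_add_norm_sub' _ _
      _ ≤ _ := by gcongr; exact h1.trans (by gcongr)
  · refine (locallyIntegrableOn_iff hlc).2 fun K hKΩ hK => ?_
    have hc : Continuous fun p : (ι → ℝ) × (ι → ℝ) => fderiv ℝ Φ p.1 p.2 := by fun_prop
    refine Integrable.mono' (g := fun x => L * ∑ i, ‖D i x‖)
      ((integrable_finsetSum _ fun i _ => (hDK K hKΩ hK i).norm).const_mul _)
      (hc.comp_aestronglyMeasurable (AEStronglyMeasurable.prodMk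
        (aemeasurable_pi_iff.2 fun i => (hgK K hKΩ hK i).aestronglyMeasurable.aemeasurable).aestronglyMeasurable
        (aemeasurable_pi_iff.2 fun i => (hDK K hKΩ hK i).aestronglyMeasurable.aemeasurable).aestronglyMeasurable))
      (Eventually.of_forall fun x => ?_)
    refine ((fderiv ℝ Φ _).le_opNorm _).trans ?_
    gcongr
    · exact norm_fderiv_le_of_lipschitz ℝ hL
    · exact pi_norm_le_sum_norm _
  · intro K hKΩ hK
    obtain ⟨r, hr, U, C, hU, hC, hKU, hCΩ, hUC⟩ := exists_tube hK hΩ hKΩ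
    obtain ⟨ε, hε, hεr⟩ := exists_pos_forall_norm_smul_smul_le v hr
    refine ⟨ε, hε, fun s hs => ?_⟩
    have hUC' : ∀ x ∈ U, ∀ σ ∈ Icc (0 : ℝ) 1, x + σ • s • v ∈ C := fun x hx σ hσ =>
      hUC x hx _ (hεr s hs σ hσ)
    have h1 := ae_all_iff.2 fun i => ((h i).const_smul s).ae_sub_eq hU hC hCΩ hUC'
    have h2 := ae_all_iff.2 fun i => ((h i).const_smul s).ae_ae_eq hU hC hCΩ hUC'
    filter_upwards [h1, h2] with x hx1 hx2 hxK
    have hx1' := fun i => hx1 i (hKU hxK)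
    have hx2' := fun i => hx2 i (hKU hxK)
    have := comp_primitive_sub_eq_integral hΦ hL (fun i => (hx1' i).1) (a := fun i => g i x)
      (Γ := fun σ i => g i (x + σ • s • v)) hx2'
    have e : (fun i => g i x + ∫ σ in (0 : ℝ)..1, s * D i (x + σ • s • v)) =
        fun i => g i (x + s • v) := by
      funext i
      rw [← (hx1' i).2]; ring
    rw [e] at this
    rw [this]
    refine intervalIntegral.integral_congr fun σ _ => ?_
    have : (fun i => s * D i (x + σ • s • v)) = s • fun i => D i (x + σ • s • v) := rfl
    simp only [this, map_smul, smul_eq_mul]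

theorem HasWeakLineDerivOn.comp_real {Φ : ℝ → ℝ}
    (hΦ : ContDiff ℝ 1 Φ) {L : NNReal} (hL : LipschitzWith L Φ) {Ω : Set E} (hΩ : IsOpen Ω) {v : E}
    {g D : E → ℝ} (h : HasWeakLineDerivOn μ Ω v g D) :
    HasWeakLineDerivOn μ Ω v (fun x => Φ (g x)) (fun x => deriv Φ (g x) * D x) := by
  have h1 : ContDiff ℝ 1 fun p : Unit → ℝ => Φ (p ()) := hΦ.comp (contDiff_apply ℝ ℝ ())
  have h2 : LipschitzWith L fun p : Unit → ℝ => Φ (p ()) := by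
    have := hL.comp (LipschitzWith.eval (α := fun _ : Unit => ℝ) ())
    rwa [mul_one] at this
  have := HasWeakLineDerivOn.comp h1 h2 hΩ (g := fun _ => g) (D := fun _ => D) fun _ => h
  convert this using 2 with x
  have h3 : HasFDerivAt (fun p : Unit → ℝ => Φ (p ()))
      (deriv Φ (g x) • (ContinuousLinearMap.proj () : (Unit → ℝ) →L[ℝ] ℝ)) (fun _ => g x) :=
    HasDerivAt.comp_hasFDerivAt (h₂ := Φ) (fun _ : Unit => g x)
      (hΦ.differentiable one_ne_zero (g x)).hasDerivAt
      (ContinuousLinearMap.hasFDerivAt (ContinuousLinearMap.proj () : (Unit → ℝ) →L[ℝ] ℝ))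
  rw [h3.fderiv]
  simp

theorem LocallyIntegrableOn.integrable_mul_of_tsupport {Ω : Set E} {f ψ : E → ℝ}
    (hf : LocallyIntegrableOn f Ω μ) (hψ : Continuous ψ) (hψc : HasCompactSupport ψ)
    (hψΩ : tsupport ψ ⊆ Ω) : Integrable (fun x => f x * ψ x) μ := by
  obtain ⟨B, hB⟩ := hψc.exists_bound_of_continuous hψ
  have h1 : IntegrableOn (fun x => f x * ψ x) (tsupport ψ) μ :=
    (hf.integrableOn_compact_subset hψΩ hψc).mul_bdd (c := B) hψ.aestronglyMeasurable
      (Eventually.of_forall hB)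
  rw [← integrableOn_univ]
  refine h1.of_forall_sdiff_eq_zero MeasurableSet.univ fun x hx => ?_
  rw [image_eq_zero_of_notMem_tsupport hx.2, mul_zero]

/-- The weak derivative of a function vanishes almost everywhere on its zero set. -/
theorem HasWeakLineDerivOn.ae_eq_zero {Ω : Set E} (hΩ : IsOpen Ω) {v : E} {g D : E → ℝ}
    (h : HasWeakLineDerivOn μ Ω v g D) : ∀ᵐ x ∂μ, x ∈ Ω → g x = 0 → D x = 0 := by
  -- These functions tend uniformly to 0, whereas their derivatives, bounded by 1, tend pointwise to
  -- the indicator of {0}. In the limit of the chain rule, the function equal to `D` on {g = 0} and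
  -- to 0 elsewhere is a weak derivative of 0.
  set Φ : ℕ → ℝ → ℝ := fun n t => Real.arctan ((n + 1 : ℝ) * t) / (n + 1) with hΦdef
  have hder : ∀ n t, HasDerivAt (Φ n) (1 / (1 + ((n + 1 : ℝ) * t) ^ 2)) t := by
    intro n t
    have hn : (n + 1 : ℝ) ≠ 0 := by positivity
    have h1 := (((hasDerivAt_id t).const_mul (n + 1 : ℝ)).arctan).div_const (n + 1 : ℝ)
    rw [mul_one, mul_div_assoc, div_self hn, mul_one] at h1
    exact h1
  have hΦd : ∀ n, deriv (Φ n) = fun t => 1 / (1 + ((n + 1 : ℝ) * t) ^ 2) := fun n =>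
    funext fun t => (hder n t).deriv
  have hC : ∀ n, ContDiff ℝ 1 (Φ n) := fun n =>
    (Real.contDiff_arctan.comp (contDiff_const.mul contDiff_id)).div_const _
  have hle : ∀ n t, ‖deriv (Φ n) t‖ ≤ 1 := by
    intro n t
    rw [hΦd, Real.norm_of_nonneg (by positivity)]
    rw [div_le_one (by positivity)]
    nlinarith [sq_nonneg ((n + 1 : ℝ) * t)]
  have hLip : ∀ n, LipschitzWith 1 (Φ n) := fun n =>
    lipschitzWith_of_nnnorm_deriv_le ((hC n).differentiable one_ne_zero) fun t => hle n t
  have hw := fun n => h.comp_real (hC n) (hLip n) hΩ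
  set f : E → ℝ := fun x => if g x = 0 then D x else 0 with hf
  have hlim : ∀ x, Tendsto (fun n => deriv (Φ n) (g x) * D x) atTop (𝓝 (f x)) := by
    intro x
    by_cases hx : g x = 0
    · simp [hf, hx, hΦd]
    · simp only [hf, hx, if_false, hΦd]
      have h1 : Tendsto (fun n : ℕ => (n + 1 : ℝ)) atTop atTop :=
        tendsto_atTop_add_const_right _ _ tendsto_natCast_atTop_atTop
      have h2 : Tendsto (fun n : ℕ => 1 + ((n + 1 : ℝ) * g x) ^ 2) atTop atTop := by
        simp_rw [mul_pow]
        exact tendsto_atTop_add_const_left _ _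
          (((tendsto_pow_atTop two_ne_zero).comp h1).atTop_mul_const (by positivity))
      simpa using ((tendsto_const_nhds (x := (1 : ℝ))).div_atTop h2).mul_const (D x)
  have hfle : ∀ x, ‖f x‖ ≤ ‖D x‖ := by
    intro x
    by_cases hx : g x = 0 <;> simp [hf, hx]
  have hfl : LocallyIntegrableOn f Ω μ := by
    refine (locallyIntegrableOn_iff hΩ.isLocallyClosed).2 fun K hKΩ hK => ?_
    refine Integrable.mono (h.2.1.integrableOn_compact_subset hKΩ hK) ?_ (Eventually.of_forall hfle)
    exact aestronglyMeasurable_of_tendsto_ae atTop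
      (fun n => ((hw n).2.1.integrableOn_compact_subset hKΩ hK).aestronglyMeasurable)
      (Eventually.of_forall hlim)
  have key := hΩ.ae_eq_zero_of_integral_contDiff_smul_eq_zero hfl fun φ hφ hφc hφΩ => ?_
  · filter_upwards [key] with x hx hxΩ hgx
    simpa [hf, hgx] using hx hxΩ
  · have hfd : Continuous fun x => fderiv ℝ φ x v := by
      have := hφ.continuous_fderiv (by simp)
      fun_prop
    have hts : tsupport (fun x => fderiv ℝ φ x v) ⊆ tsupport φ := tsupport_fderiv_apply_subset ℝ v
    have hfdc : HasCompactSupport fun x => fderiv ℝ φ x v := hφc.fderiv_apply ℝ v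
    have hset : ∀ {q ψ : E → ℝ}, tsupport ψ ⊆ Ω → ∫ x in Ω, q x * ψ x ∂μ = ∫ x, q x * ψ x ∂μ :=
      fun hψ => setIntegral_eq_integral_of_forall_compl_eq_zero fun x hx => by
        rw [image_eq_zero_of_notMem_tsupport fun h => hx (hψ h), mul_zero]
    have l1 : Tendsto (fun n => ∫ x, (deriv (Φ n) (g x) * D x) * φ x ∂μ) atTop
        (𝓝 (∫ x, f x * φ x ∂μ)) := by
      refine tendsto_integral_of_dominated_convergence (fun x => ‖D x * φ x‖) (fun n => ?_) ?_ ?_ ?_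
      · exact (LocallyIntegrableOn.integrable_mul_of_tsupport (hw n).2.1 hφ.continuous hφc
          hφΩ).aestronglyMeasurable
      · exact (LocallyIntegrableOn.integrable_mul_of_tsupport h.2.1 hφ.continuous hφc hφΩ).norm
      · refine fun n => Eventually.of_forall fun x => ?_
        rw [mul_assoc, norm_mul]
        exact mul_le_of_le_one_left (norm_nonneg _) (hle n _)
      · exact Eventually.of_forall fun x => (hlim x).mul_const _
    have l2 : Tendsto (fun n => ∫ x, Φ n (g x) * fderiv ℝ φ x v ∂μ) atTop (𝓝 0) := by
      have hb : ∀ n x, ‖Φ n (g x) * fderiv ℝ φ x v‖ ≤ (2 / (n + 1 : ℝ)) * ‖fderiv ℝ φ x v‖ := by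
        intro n x
        rw [norm_mul]
        gcongr
        rw [hΦdef, norm_div, Real.norm_of_nonneg (by positivity : (0 : ℝ) ≤ n + 1)]
        gcongr
        rw [Real.norm_eq_abs, abs_le]
        have h1 := Real.neg_pi_div_two_lt_arctan ((n + 1 : ℝ) * g x)
        have h2 := Real.arctan_lt_pi_div_two ((n + 1 : ℝ) * g x)
        constructor <;> linarith [Real.pi_le_four]
      have hint : Integrable (fun x => fderiv ℝ φ x v) μ := hfd.integrable_of_hasCompactSupport hfdc
      refine squeeze_zero_norm (a := fun n : ℕ => (2 / (n + 1 : ℝ)) * ∫ x, ‖fderiv ℝ φ x v‖ ∂μ)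
        (fun n => ?_) ?_
      · rw [← integral_const_mul]
        exact norm_integral_le_of_norm_le (hint.norm.const_mul _) (Eventually.of_forall (hb n))
      · have := (tendsto_const_div_atTop_nhds_zero_nat (2 : ℝ)).comp (tendsto_add_atTop_nat 1)
        simpa using this.mul_const (∫ x, ‖fderiv ℝ φ x v‖ ∂μ)
    have heq : ∀ n, ∫ x, (deriv (Φ n) (g x) * D x) * φ x ∂μ =
        -∫ x, Φ n (g x) * fderiv ℝ φ x v ∂μ := by
      intro n
      have := (hw n).2.2 φ hφ hφc hφΩ
      rw [hset (hts.trans hφΩ), hset hφΩ] at this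
      rw [this, neg_neg]
    simp_rw [heq] at l1
    have := tendsto_nhds_unique l1 (by simpa using l2.neg)
    simpa [mul_comm] using this

end ChainRule

/-! ### The curl of a planar field that is a gradient where a function does not vanish -/

section Planar

/-- If a function is close in average to a nonzero constant and its derivative along the vertical
lines is small in average, then it vanishes almost nowhere on many vertical lines. -/
theorem frequently_ae_ne_zero {a₁ a₂ τ₁ τ₂ : ℝ} (ha : a₁ < a₂) (hτ : τ₁ < τ₂)
    {h k : ℝ → ℝ → ℝ} {h₀ : ℝ}
    (ih : IntegrableOn (fun p : ℝ × ℝ => h p.1 p.2) (Icc a₁ a₂ ×ˢ Icc τ₁ τ₂))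
    (ik : IntegrableOn (fun p : ℝ × ℝ => k p.1 p.2) (Icc a₁ a₂ ×ˢ Icc τ₁ τ₂))
    (hk : ∀ᵐ s ∂(volume.restrict (Icc a₁ a₂)), ∀ᵐ t ∂(volume.restrict (Icc τ₁ τ₂)),
      ∀ᵐ t' ∂(volume.restrict (Icc τ₁ τ₂)), h s t' - h s t = ∫ τ in t..t', k s τ)
    (hsmall : (∫ p in Icc a₁ a₂ ×ˢ Icc τ₁ τ₂, |h p.1 p.2 - h₀|) +
      (τ₂ - τ₁) * (∫ p in Icc a₁ a₂ ×ˢ Icc τ₁ τ₂, |k p.1 p.2|) < (a₂ - a₁) * (τ₂ - τ₁) * |h₀|) :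
    ∃ᵐ s ∂(volume.restrict (Icc a₁ a₂)), ∀ᵐ t ∂(volume.restrict (Icc τ₁ τ₂)), h s t ≠ 0 := by
  intro hbad
  refine absurd hsmall (not_lt.2 ?_)
  have ih' : IntegrableOn (fun p : ℝ × ℝ => |h p.1 p.2 - h₀|) (Icc a₁ a₂ ×ˢ Icc τ₁ τ₂) :=
    (ih.sub (integrableOn_const (by
      rw [Measure.volume_eq_prod, Measure.prod_prod]
      exact ENNReal.mul_ne_top (by simp) (by simp)))).abs
  rw [IntegrableOn, Measure.volume_eq_prod, ← Measure.prod_restrict] at ih' ik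
  have ik' := ik.abs
  rw [Measure.volume_eq_prod, ← Measure.prod_restrict, integral_prod _ ih', integral_prod _ ik',
    ← integral_const_mul]
  have jh := ih'.integral_prod_left
  have jk := ik'.integral_prod_left
  rw [← integral_add jh (jk.const_mul _)]
  have hconst : (a₂ - a₁) * (τ₂ - τ₁) * |h₀| =
      ∫ _ in Icc a₁ a₂, (τ₂ - τ₁) * |h₀| := by
    rw [setIntegral_const, smul_eq_mul, Real.volume_real_Icc_of_le ha.le, mul_assoc]
  rw [hconst]
  refine integral_mono_ae (integrable_const _) (jh.add (jk.const_mul _)) ?_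
  filter_upwards [hk, hbad, ih'.prod_right_ae, ik.prod_right_ae] with s hs hsb is1 is2
  -- On a bad line `h` vanishes on a set of positive measure, which contains a zero `t` from which
  -- almost all increments of `h` are integrals of `k`. Hence |h₀| ≤ |h s t' - h₀| + ∫ |k s| for
  -- almost every `t'`. Integrating over `t'` and then over `s` gives the negation of `hsmall`.
  obtain ⟨t, ht0, ht, htT⟩ := ((not_eventually.1 hsb).and_eventually
    (hs.and (ae_restrict_mem measurableSet_Icc))).exists
  rw [not_not] at ht0
  have hle : ∀ᵐ t' ∂(volume.restrict (Icc τ₁ τ₂)),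
      |h₀| - (∫ τ in Icc τ₁ τ₂, |k s τ|) ≤ |h s t' - h₀| := by
    filter_upwards [ht, ae_restrict_mem measurableSet_Icc] with t' ht' htT'
    rw [ht0, sub_zero] at ht'
    have h1 : |h s t'| ≤ ∫ τ in Icc τ₁ τ₂, |k s τ| := by
      rw [ht']
      rw [← Real.norm_eq_abs]
      calc ‖∫ τ in t..t', k s τ‖ ≤ ∫ τ in uIoc t t', ‖k s τ‖ :=
            intervalIntegral.norm_integral_le_integral_norm_uIoc
        _ ≤ ∫ τ in Icc τ₁ τ₂, ‖k s τ‖ := by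
            refine setIntegral_mono_set (is2.norm)
              (Eventually.of_forall fun _ => norm_nonneg _) ?_
            refine LE.le.eventuallyLE ?_
            exact uIoc_subset_uIcc.trans (uIcc_subset_Icc htT htT')
    have h2 : |h₀| ≤ |h s t'| + |h s t' - h₀| := by
      have := abs_sub_abs_le_abs_sub h₀ (h s t')
      rw [abs_sub_comm] at this
      linarith
    linarith
  have hint := integral_mono_ae (integrable_const _) is1 hle
  rw [setIntegral_const, smul_eq_mul, Real.volume_real_Icc_of_le hτ.le] at hint
  linarith

/-- One half of Green's formula: the inner integral is the increment of `T` between two opposite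
sides, where `T` equals the derivative `p` of `a`. The result is an alternating sum of `a` over the
corners, which is unchanged when the two variables are exchanged; the other half follows by applying
the lemma to the flipped functions. -/
theorem integral_integral_eq_of_increments {a p T q : ℝ → ℝ → ℝ} {s₁ s₂ t₁ t₂ : ℝ} (ht : t₁ ≤ t₂)
    (h₁ : ∀ᵐ t ∂(volume.restrict (Icc t₁ t₂)), T s₁ t = p s₁ t)
    (h₂ : ∀ᵐ t ∂(volume.restrict (Icc t₁ t₂)), T s₂ t = p s₂ t)
    (hq : ∀ᵐ t ∂(volume.restrict (Icc t₁ t₂)), T s₂ t - T s₁ t = ∫ σ in s₁..s₂, q σ t)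
    (i₁ : IntervalIntegrable (p s₁) volume t₁ t₂) (i₂ : IntervalIntegrable (p s₂) volume t₁ t₂)
    (ha₁ : a s₁ t₂ - a s₁ t₁ = ∫ τ in t₁..t₂, p s₁ τ)
    (ha₂ : a s₂ t₂ - a s₂ t₁ = ∫ τ in t₁..t₂, p s₂ τ) :
    ∫ t in t₁..t₂, ∫ σ in s₁..s₂, q σ t = a s₂ t₂ - a s₂ t₁ - (a s₁ t₂ - a s₁ t₁) := by
  rw [ha₁, ha₂, ← intervalIntegral.integral_sub i₂ i₁]
  refine intervalIntegral.integral_congr_ae ?_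
  rw [ae_restrict_iff' measurableSet_Icc] at h₁ h₂ hq
  filter_upwards [h₁, h₂, hq] with t e1 e2 e3 htm
  rw [uIoc_of_le ht] at htm
  have htm' : t ∈ Icc t₁ t₂ := ⟨htm.1.le, htm.2⟩
  rw [← e1 htm', ← e2 htm', e3 htm']

/-- Lebesgue measure on the unit interval. -/
abbrev unitMeasure : Measure ℝ := volume.restrict (Icc (0 : ℝ) 1)

/-- On the unit square, `D` is the derivative of `g` along the vertical lines. -/
def IsVerticalDeriv (g D : ℝ → ℝ → ℝ) : Prop :=
  Integrable (fun p : ℝ × ℝ => D p.1 p.2) (unitMeasure.prod unitMeasure) ∧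
    ∃ β : ℝ → ℝ, ∀ᵐ p : ℝ × ℝ ∂(unitMeasure.prod unitMeasure), g p.1 p.2 = β p.1 + ∫ τ in (0 : ℝ)..p.2, D p.1 τ

theorem intervalIntegrable_of_mem_Icc {f : ℝ → ℝ} (hf : Integrable f unitMeasure) {t t' : ℝ}
    (ht : t ∈ Icc (0 : ℝ) 1) (ht' : t' ∈ Icc (0 : ℝ) 1) : IntervalIntegrable f volume t t' := by
  rw [intervalIntegrable_iff]
  exact IntegrableOn.mono_set hf (uIoc_subset_uIcc.trans (uIcc_subset_Icc ht ht'))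

/-- Subtracting two heights eliminates `β`. The order of the quantifiers matters because the sides
of a rectangle are chosen one after the other: here the line comes first, in
`IsVerticalDeriv.ae_ae_ae_left` the two heights do. -/
theorem IsVerticalDeriv.ae_ae_ae_right {g D : ℝ → ℝ → ℝ} (h : IsVerticalDeriv g D) :
    ∀ᵐ s ∂unitMeasure, ∀ᵐ t ∂unitMeasure, ∀ᵐ t' ∂unitMeasure, g s t' - g s t = ∫ τ in t..t', D s τ := by
  obtain ⟨hD, β, hβ⟩ := h
  filter_upwards [hD.prod_right_ae, Measure.ae_ae_of_ae_prod hβ] with s hs1 hs2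
  filter_upwards [hs2, ae_restrict_mem measurableSet_Icc] with t ht htI
  filter_upwards [hs2, ae_restrict_mem measurableSet_Icc] with t' ht' htI'
  rw [ht, ht', add_sub_add_left_eq_sub]
  have h0 : (0 : ℝ) ∈ Icc (0 : ℝ) 1 := by simp
  exact intervalIntegral.integral_interval_sub_left (intervalIntegrable_of_mem_Icc hs1 h0 htI')
    (intervalIntegrable_of_mem_Icc hs1 h0 htI)

theorem IsVerticalDeriv.ae_ae_ae_left {g D : ℝ → ℝ → ℝ} (h : IsVerticalDeriv g D) :
    ∀ᵐ t ∂unitMeasure, ∀ᵐ t' ∂unitMeasure, ∀ᵐ s ∂unitMeasure, g s t' - g s t = ∫ τ in t..t', D s τ := by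
  obtain ⟨hD, β, hβ⟩ := h
  have hβ' := Measure.ae_ae_of_ae_prod
    ((Measure.measurePreserving_swap (μ := unitMeasure) (ν := unitMeasure)).quasiMeasurePreserving.ae hβ)
  filter_upwards [hβ', ae_restrict_mem measurableSet_Icc] with t ht htI
  filter_upwards [hβ', ae_restrict_mem measurableSet_Icc] with t' ht' htI'
  filter_upwards [ht, ht', hD.prod_right_ae] with s hs hs' hs1
  simp only [Prod.fst_swap, Prod.snd_swap] at hs hs'
  rw [hs, hs', add_sub_add_left_eq_sub]
  have h0 : (0 : ℝ) ∈ Icc (0 : ℝ) 1 := by simp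
  exact intervalIntegral.integral_interval_sub_left (intervalIntegrable_of_mem_Icc hs1 h0 htI')
    (intervalIntegrable_of_mem_Icc hs1 h0 htI)

/-- If the field `(T₁, T₂)` coincides with the gradient `(p₁, p₂)` of `a` where `h` does not vanish,
then the integral of its curl vanishes on rectangles whose sides lie in the set where `h` does not
vanish. -/
theorem exists_rectangle_integral_eq {a p₁ p₂ T₁ T₂ q₁ q₂ h : ℝ → ℝ → ℝ}
    (ha₂ : IsVerticalDeriv a p₂) (ha₁ : IsVerticalDeriv (flip a) (flip p₁))
    (hT₁ : IsVerticalDeriv T₁ q₁) (hT₂ : IsVerticalDeriv (flip T₂) (flip q₂))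
    (heq : ∀ᵐ p : ℝ × ℝ ∂(unitMeasure.prod unitMeasure), h p.1 p.2 ≠ 0 →
      T₁ p.1 p.2 = p₁ p.1 p.2 ∧ T₂ p.1 p.2 = p₂ p.1 p.2)
    {S T J₁ J₂ J₃ J₄ : Set ℝ} (hS : S ⊆ Icc 0 1) (hT : T ⊆ Icc 0 1)
    (hSc : S.OrdConnected) (hTc : T.OrdConnected)
    (hJ₁ : MeasurableSet J₁) (hJ₂ : MeasurableSet J₂) (hJ₃ : MeasurableSet J₃)
    (hJ₄ : MeasurableSet J₄)
    (hJS₁ : J₁ ⊆ S) (hJS₂ : J₂ ⊆ S) (hJT₃ : J₃ ⊆ T) (hJT₄ : J₄ ⊆ T)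
    (h₁₂ : ∀ s ∈ J₁, ∀ s' ∈ J₂, s ≤ s') (h₃₄ : ∀ t ∈ J₃, ∀ t' ∈ J₄, t ≤ t')
    (h₁ : ∃ᵐ s ∂(volume.restrict J₁), ∀ᵐ t ∂(volume.restrict T), h s t ≠ 0)
    (h₂ : ∃ᵐ s ∂(volume.restrict J₂), ∀ᵐ t ∂(volume.restrict T), h s t ≠ 0)
    (h₃ : ∃ᵐ t ∂(volume.restrict J₃), ∀ᵐ s ∂(volume.restrict S), h s t ≠ 0)
    (h₄ : ∃ᵐ t ∂(volume.restrict J₄), ∀ᵐ s ∂(volume.restrict S), h s t ≠ 0) :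
    ∃ s₁ ∈ J₁, ∃ s₂ ∈ J₂, ∃ t₁ ∈ J₃, ∃ t₂ ∈ J₄,
      ∫ t in t₁..t₂, ∫ σ in s₁..s₂, q₂ σ t = ∫ s in s₁..s₂, ∫ τ in t₁..t₂, q₁ s τ := by
  have heq₁ := Measure.ae_ae_of_ae_prod heq
  have heq₂ := Measure.ae_ae_of_ae_prod
    ((Measure.measurePreserving_swap (μ := unitMeasure) (ν := unitMeasure)).quasiMeasurePreserving.ae heq)
  have hAE : ∀ {J : Set ℝ}, J ⊆ Icc 0 1 → ∀ {P : ℝ → Prop}, (∀ᵐ s ∂unitMeasure, P s) →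
      ∀ᵐ s ∂(volume.restrict J), P s := fun hJ _ hP =>
    ae_restrict_of_ae_restrict_of_subset hJ hP
  -- The four sides are chosen successively, each time meeting a set that is not negligible with
  -- sets of full measure. Fixing one side turns a condition on pairs of sides into a full-measure
  -- condition on the next one.
  obtain ⟨s₁, hs₁, ⟨⟨⟨⟨⟨hs₁a, hs₁T⟩, hs₁v⟩, hs₁e⟩, hs₁i⟩, hs₁J⟩⟩ := (h₁.and_eventually
    ((((((hAE (hJS₁.trans hS) ha₁.ae_ae_ae_left).and (hAE (hJS₁.trans hS) hT₂.ae_ae_ae_left)).and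
      (hAE (hJS₁.trans hS) ha₂.ae_ae_ae_right)).and (hAE (hJS₁.trans hS) heq₁)).and
      (hAE (hJS₁.trans hS) ha₂.1.prod_right_ae)).and (ae_restrict_mem hJ₁))).exists
  obtain ⟨s₂, hs₂, ⟨⟨⟨⟨⟨hs₂a, hs₂T⟩, hs₂v⟩, hs₂e⟩, hs₂i⟩, hs₂J⟩⟩ := (h₂.and_eventually
    ((((((hAE (hJS₂.trans hS) hs₁a).and (hAE (hJS₂.trans hS) hs₁T)).and
      (hAE (hJS₂.trans hS) ha₂.ae_ae_ae_right)).and (hAE (hJS₂.trans hS) heq₁)).and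
      (hAE (hJS₂.trans hS) ha₂.1.prod_right_ae)).and (ae_restrict_mem hJ₂))).exists
  obtain ⟨t₁, ht₁, ⟨⟨⟨⟨⟨⟨ht₁a, ht₁v₁⟩, ht₁v₂⟩, ht₁T⟩, ht₁e⟩, ht₁i⟩, ht₁J⟩⟩ := (h₃.and_eventually
    (((((((hAE (hJT₃.trans hT) hs₂a).and (hAE (hJT₃.trans hT) hs₁v)).and
      (hAE (hJT₃.trans hT) hs₂v)).and (hAE (hJT₃.trans hT) hT₁.ae_ae_ae_left)).and
      (hAE (hJT₃.trans hT) heq₂)).and (hAE (hJT₃.trans hT) ha₁.1.prod_right_ae)).and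
      (ae_restrict_mem hJ₃))).exists
  obtain ⟨t₂, ht₂, ⟨⟨⟨⟨⟨⟨ht₂a, ht₂v₁⟩, ht₂v₂⟩, ht₂T⟩, ht₂e⟩, ht₂i⟩, ht₂J⟩⟩ := (h₄.and_eventually
    (((((((hAE (hJT₄.trans hT) hs₂a).and (hAE (hJT₄.trans hT) ht₁v₁)).and
      (hAE (hJT₄.trans hT) ht₁v₂)).and (hAE (hJT₄.trans hT) ht₁T)).and
      (hAE (hJT₄.trans hT) heq₂)).and (hAE (hJT₄.trans hT) ha₁.1.prod_right_ae)).and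
      (ae_restrict_mem hJ₄))).exists
  refine ⟨s₁, hs₁J, s₂, hs₂J, t₁, ht₁J, t₂, ht₂J, ?_⟩
  have hIS : Icc s₁ s₂ ⊆ S := hSc.out (hJS₁ hs₁J) (hJS₂ hs₂J)
  have hIT : Icc t₁ t₂ ⊆ T := hTc.out (hJT₃ ht₁J) (hJT₄ ht₂J)
  have hnu : ∀ {J : Set ℝ}, J ⊆ S → ∀ {P : ℝ → Prop}, (∀ᵐ s ∂(volume.restrict S), P s) →
      ∀ᵐ s ∂(volume.restrict J), P s := fun hJ _ hP =>
    ae_restrict_of_ae_restrict_of_subset hJ hP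
  have hmS : ∀ {s}, s ∈ S → s ∈ Icc (0 : ℝ) 1 := fun h => hS h
  have hmT : ∀ {s}, s ∈ T → s ∈ Icc (0 : ℝ) 1 := fun h => hT h
  refine (integral_integral_eq_of_increments (a := a) (p := p₂) (T := T₂) (q := q₂)
      (h₃₄ _ ht₁J _ ht₂J) ?_ ?_ ?_ ?_ ?_ ht₂v₁ ht₂v₂).trans (Eq.trans ?_
    (integral_integral_eq_of_increments (a := flip a) (p := flip p₁) (T := flip T₁) (q := flip q₁)
      (h₁₂ _ hs₁J _ hs₂J) ?_ ?_ ?_ ?_ ?_ ht₁a ht₂a).symm)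
  · filter_upwards [hAE (hIT.trans hT) hs₁e, ae_restrict_of_ae_restrict_of_subset hIT hs₁]
      with s e1 e2
    exact (e1 e2).2
  · filter_upwards [hAE (hIT.trans hT) hs₂e, ae_restrict_of_ae_restrict_of_subset hIT hs₂]
      with s e1 e2
    exact (e1 e2).2
  · exact hAE (hIT.trans hT) hs₂T
  · exact intervalIntegrable_of_mem_Icc hs₁i (hmT (hJT₃ ht₁J)) (hmT (hJT₄ ht₂J))
  · exact intervalIntegrable_of_mem_Icc hs₂i (hmT (hJT₃ ht₁J)) (hmT (hJT₄ ht₂J))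
  · simp only [flip]; ring
  · filter_upwards [hAE (hIS.trans hS) ht₁e, ae_restrict_of_ae_restrict_of_subset hIS ht₁]
      with s e1 e2
    exact (e1 e2).1
  · filter_upwards [hAE (hIS.trans hS) ht₂e, ae_restrict_of_ae_restrict_of_subset hIS ht₂]
      with s e1 e2
    exact (e1 e2).1
  · exact hAE (hIS.trans hS) ht₂T
  · exact intervalIntegrable_of_mem_Icc ht₁i (hmS (hJS₁ hs₁J)) (hmS (hJS₂ hs₂J))
  · exact intervalIntegrable_of_mem_Icc ht₂i (hmS (hJS₁ hs₁J)) (hmS (hJS₂ hs₂J))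

/-- Lebesgue's differentiation theorem. Balls of the product norm are squares of area 4ρ², hence the
threshold ε / 4 for the averages. -/
theorem ae_forall_eventually_integral_closedBall_le {f : ℝ × ℝ → ℝ} (hf : Integrable f) :
    ∀ᵐ z : ℝ × ℝ, ∀ ε > 0, ∀ᶠ ρ in 𝓝[>] (0 : ℝ),
      ∫ y in Metric.closedBall z ρ, |f y - f z| ≤ ε * ρ ^ 2 := by
  filter_upwards [IsUnifLocDoublingMeasure.ae_tendsto_average_norm_sub volume
    hf.locallyIntegrable 1] with z hz ε hε
  have h1 := hz (fun _ : ℝ => z) id (l := 𝓝[>] (0 : ℝ)) tendsto_id (by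
    filter_upwards [self_mem_nhdsWithin] with ρ hρ
    simpa using (mem_Ioi.1 hρ).le)
  filter_upwards [h1.eventually (gt_mem_nhds (show (0 : ℝ) < ε / 4 by positivity)),
    self_mem_nhdsWithin] with ρ h2 hρ
  have hρ' : 0 < ρ := hρ
  have hvol : volume.real (Metric.closedBall z ρ) = 4 * ρ ^ 2 := by
    rw [← closedBall_prod_same, measureReal_def, Measure.volume_eq_prod, Measure.prod_prod,
      Real.volume_closedBall, Real.volume_closedBall, ← ENNReal.ofReal_mul (by positivity),
      ENNReal.toReal_ofReal (by positivity)]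
    ring
  rw [id, setAverage_eq, hvol, smul_eq_mul, inv_mul_lt_iff₀ (by positivity)] at h2
  simp only [Real.norm_eq_abs] at h2
  linarith

theorem Metric.closedBall_real_prod (s t ρ : ℝ) :
    Metric.closedBall (s, t) ρ = Icc (s - ρ) (s + ρ) ×ˢ Icc (t - ρ) (t + ρ) := by
  rw [← closedBall_prod_same, Real.closedBall_eq_Icc, Real.closedBall_eq_Icc]

/-- `frequently_ae_ne_zero` is applied to one of the two strips of width ρ/2 along opposite sides of
the square of side 2ρ. The right-hand side of its smallness condition is then ρ²|h s₀ t₀|, while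
`hle`, `kle` and `hC` bound each of the two terms on the left by a quarter of it. Lines chosen in
the two strips are at distance at least ρ. -/
theorem eventually_frequently_ae_ne_zero {h k : ℝ → ℝ → ℝ} (hh : IsVerticalDeriv h k)
    (ih : Integrable (fun p : ℝ × ℝ => h p.1 p.2) (unitMeasure.prod unitMeasure)) {s₀ t₀ ρ : ℝ} (hρ : 0 < ρ)
    (hBs : Icc (s₀ - ρ) (s₀ + ρ) ⊆ Icc 0 1) (hBt : Icc (t₀ - ρ) (t₀ + ρ) ⊆ Icc 0 1)
    (h0 : h s₀ t₀ ≠ 0)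
    (hle : ∫ p in Icc (s₀ - ρ) (s₀ + ρ) ×ˢ Icc (t₀ - ρ) (t₀ + ρ), |h p.1 p.2 - h s₀ t₀| ≤
      |h s₀ t₀| / 4 * ρ ^ 2)
    (kle : ∫ p in Icc (s₀ - ρ) (s₀ + ρ) ×ˢ Icc (t₀ - ρ) (t₀ + ρ), |k p.1 p.2 - k s₀ t₀| ≤ ρ ^ 2)
    (hC : 2 * ρ * (1 + 4 * |k s₀ t₀|) ≤ |h s₀ t₀| / 4) {J : Set ℝ}
    (hJ : J = Icc (s₀ - ρ) (s₀ - ρ / 2) ∨ J = Icc (s₀ + ρ / 2) (s₀ + ρ)) :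
    ∃ᵐ s ∂(volume.restrict J), ∀ᵐ t ∂(volume.restrict (Icc (t₀ - ρ) (t₀ + ρ))), h s t ≠ 0 := by
  have habs : 0 < |h s₀ t₀| := abs_pos.2 h0
  obtain ⟨a₁, a₂, rfl, ha, hsub⟩ : ∃ a₁ a₂, J = Icc a₁ a₂ ∧ a₂ - a₁ = ρ / 2 ∧
      Icc a₁ a₂ ⊆ Icc (s₀ - ρ) (s₀ + ρ) := by
    rcases hJ with rfl | rfl
    · exact ⟨_, _, rfl, by ring, Icc_subset_Icc (by linarith) (by linarith)⟩
    · exact ⟨_, _, rfl, by ring, Icc_subset_Icc (by linarith) (by linarith)⟩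
  set B := Icc (s₀ - ρ) (s₀ + ρ) ×ˢ Icc (t₀ - ρ) (t₀ + ρ) with hB
  have hsubB : Icc a₁ a₂ ×ˢ Icc (t₀ - ρ) (t₀ + ρ) ⊆ B := prod_mono hsub subset_rfl
  rw [Measure.prod_restrict, ← Measure.volume_eq_prod] at ih
  have ik := hh.1
  rw [Measure.prod_restrict, ← Measure.volume_eq_prod] at ik
  have hBQ : B ⊆ Icc 0 1 ×ˢ Icc 0 1 := prod_mono hBs hBt
  have ihB : IntegrableOn (fun p : ℝ × ℝ => h p.1 p.2) B := IntegrableOn.mono_set ih hBQ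
  have ikB : IntegrableOn (fun p : ℝ × ℝ => k p.1 p.2) B := IntegrableOn.mono_set ik hBQ
  have hfin : volume B ≠ ⊤ := by
    rw [hB, Measure.volume_eq_prod, Measure.prod_prod]
    exact ENNReal.mul_ne_top (by simp) (by simp)
  have hvol : volume.real B = 4 * ρ ^ 2 := by
    rw [hB, measureReal_def, Measure.volume_eq_prod, Measure.prod_prod, Real.volume_Icc,
      Real.volume_Icc, ← ENNReal.ofReal_mul (by linarith), ENNReal.toReal_ofReal (by nlinarith)]
    ring
  have hconst : ∀ c : ℝ, IntegrableOn (fun _ : ℝ × ℝ => c) B := fun c => integrableOn_const hfin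
  have jk : IntegrableOn (fun p : ℝ × ℝ => |k p.1 p.2 - k s₀ t₀|) B := (ikB.sub (hconst _)).abs
  have hkB : ∫ p in B, |k p.1 p.2| ≤ (1 + 4 * |k s₀ t₀|) * ρ ^ 2 := by
    calc ∫ p in B, |k p.1 p.2| ≤ ∫ p in B, (|k p.1 p.2 - k s₀ t₀| + |k s₀ t₀|) := by
          refine integral_mono ikB.abs (jk.add (hconst _)) fun p => ?_
          have := abs_sub_abs_le_abs_sub (k p.1 p.2) (k s₀ t₀)
          simp only
          linarith
      _ = (∫ p in B, |k p.1 p.2 - k s₀ t₀|) + |k s₀ t₀| * (4 * ρ ^ 2) := by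
          rw [integral_add jk (hconst _), setIntegral_const, hvol, smul_eq_mul]
          ring
      _ ≤ _ := by linarith
  refine frequently_ae_ne_zero (k := k) (h₀ := h s₀ t₀) (by linarith) (by linarith)
    (ihB.mono_set hsubB) (ikB.mono_set hsubB) ?_ ?_
  · filter_upwards [ae_restrict_of_ae_restrict_of_subset (hsub.trans hBs) hh.ae_ae_ae_right]
      with s hs
    filter_upwards [ae_restrict_of_ae_restrict_of_subset hBt hs] with t ht
    exact ae_restrict_of_ae_restrict_of_subset hBt ht
  · have h1 : ∫ p in Icc a₁ a₂ ×ˢ Icc (t₀ - ρ) (t₀ + ρ), |h p.1 p.2 - h s₀ t₀| ≤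
        |h s₀ t₀| / 4 * ρ ^ 2 :=
      (setIntegral_mono_set (ihB.sub (hconst _)).abs (Eventually.of_forall fun _ => abs_nonneg _)
        (LE.le.eventuallyLE hsubB)).trans hle
    have h2 : ∫ p in Icc a₁ a₂ ×ˢ Icc (t₀ - ρ) (t₀ + ρ), |k p.1 p.2| ≤
        (1 + 4 * |k s₀ t₀|) * ρ ^ 2 :=
      (setIntegral_mono_set ikB.abs (Eventually.of_forall fun _ => abs_nonneg _)
        (LE.le.eventuallyLE hsubB)).trans hkB
    have e1 : t₀ + ρ - (t₀ - ρ) = 2 * ρ := by ring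
    rw [e1, ha]
    have h3 : 2 * ρ * (∫ p in Icc a₁ a₂ ×ˢ Icc (t₀ - ρ) (t₀ + ρ), |k p.1 p.2|) ≤
        |h s₀ t₀| / 4 * ρ ^ 2 := by
      calc _ ≤ 2 * ρ * ((1 + 4 * |k s₀ t₀|) * ρ ^ 2) := by gcongr
        _ = (2 * ρ * (1 + 4 * |k s₀ t₀|)) * ρ ^ 2 := by ring
        _ ≤ _ := by gcongr
    have h4 : 0 < |h s₀ t₀| * ρ ^ 2 := by positivity
    nlinarith

end Planar

section Planar

/-- If a weakly differentiable vector field `(T₁, T₂)` coincides with a gradient `(p₁, p₂)` where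
the weakly differentiable function `h` does not vanish, then its curl vanishes almost everywhere
there. -/
theorem ae_eq_of_isVerticalDeriv {a p₁ p₂ T₁ T₂ q₁ q₂ h k₁ k₂ : ℝ → ℝ → ℝ}
    (ha₂ : IsVerticalDeriv a p₂) (ha₁ : IsVerticalDeriv (flip a) (flip p₁))
    (hT₁ : IsVerticalDeriv T₁ q₁) (hT₂ : IsVerticalDeriv (flip T₂) (flip q₂))
    (hh₂ : IsVerticalDeriv h k₂) (hh₁ : IsVerticalDeriv (flip h) (flip k₁))
    (ih : Integrable (fun p : ℝ × ℝ => h p.1 p.2) (unitMeasure.prod unitMeasure))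
    (heq : ∀ᵐ p : ℝ × ℝ ∂(unitMeasure.prod unitMeasure), h p.1 p.2 ≠ 0 →
      T₁ p.1 p.2 = p₁ p.1 p.2 ∧ T₂ p.1 p.2 = p₂ p.1 p.2) :
    ∀ᵐ p : ℝ × ℝ ∂(unitMeasure.prod unitMeasure), h p.1 p.2 ≠ 0 → q₁ p.1 p.2 = q₂ p.1 p.2 := by
  set Q : Set (ℝ × ℝ) := Icc 0 1 ×ˢ Icc 0 1 with hQ
  have hprod : unitMeasure.prod unitMeasure = (volume : Measure (ℝ × ℝ)).restrict Q := by
    rw [Measure.prod_restrict, ← Measure.volume_eq_prod]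
  -- Discarding the boundary of the square costs a null set and leaves room for small squares around
  -- each remaining point.
  have hprod' : unitMeasure.prod unitMeasure =
      (volume : Measure (ℝ × ℝ)).restrict (Ioo 0 1 ×ˢ Ioo 0 1) := by
    rw [unitMeasure, ← Measure.restrict_congr_set (Ioo_ae_eq_Icc (a := (0 : ℝ)) (b := 1)),
      Measure.prod_restrict, ← Measure.volume_eq_prod]
  have hQm : MeasurableSet Q := measurableSet_Icc.prod measurableSet_Icc
  have swapInt : ∀ {f : ℝ → ℝ → ℝ},
      Integrable (fun p : ℝ × ℝ => flip f p.1 p.2) (unitMeasure.prod unitMeasure) →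
      Integrable (fun p : ℝ × ℝ => f p.1 p.2) (unitMeasure.prod unitMeasure) := fun hf => hf.swap
  have iq₁ := hT₁.1
  have iq₂ := swapInt hT₂.1
  have ik₂ := hh₂.1
  have ik₁ := swapInt hh₁.1
  have leb : ∀ {f : ℝ → ℝ → ℝ},
      Integrable (fun p : ℝ × ℝ => f p.1 p.2) (unitMeasure.prod unitMeasure) →
      ∀ᵐ z : ℝ × ℝ ∂(unitMeasure.prod unitMeasure), ∀ ε > 0, ∀ᶠ ρ in 𝓝[>] (0 : ℝ),
        ∫ p in Icc (z.1 - ρ) (z.1 + ρ) ×ˢ Icc (z.2 - ρ) (z.2 + ρ), |f p.1 p.2 - f z.1 z.2| ≤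
          ε * ρ ^ 2 := by
    intro f hf
    rw [hprod] at hf
    have h1 := ae_forall_eventually_integral_closedBall_le ((integrable_indicator_iff hQm).2 hf)
    rw [hprod']
    filter_upwards [ae_restrict_of_ae h1, ae_restrict_mem (measurableSet_Ioo.prod measurableSet_Ioo)]
      with z hz hzQ ε hε
    have hnhds : Ioo (0 : ℝ) 1 ×ˢ Ioo (0 : ℝ) 1 ∈ 𝓝 z :=
      (isOpen_Ioo.prod isOpen_Ioo).mem_nhds hzQ
    obtain ⟨r, hr, hrQ⟩ := Metric.nhds_basis_closedBall.mem_iff.1 hnhds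
    filter_upwards [hz ε hε, Ioc_mem_nhdsGT hr] with ρ h2 hρ
    have hsub : Metric.closedBall z ρ ⊆ Q := (Metric.closedBall_subset_closedBall hρ.2).trans
      (hrQ.trans (prod_mono Ioo_subset_Icc_self Ioo_subset_Icc_self))
    rw [← Metric.closedBall_real_prod]
    refine le_of_eq_of_le (setIntegral_congr_fun measurableSet_closedBall fun p hp => ?_) h2
    rw [indicator_of_mem (hsub hp), indicator_of_mem (prod_mono Ioo_subset_Icc_self
      Ioo_subset_Icc_self hzQ)]
  have hint : ∀ᵐ z : ℝ × ℝ ∂(unitMeasure.prod unitMeasure), ∀ᶠ ρ in 𝓝[>] (0 : ℝ),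
      Icc (z.1 - ρ) (z.1 + ρ) ⊆ Icc 0 1 ∧ Icc (z.2 - ρ) (z.2 + ρ) ⊆ Icc 0 1 := by
    rw [hprod']
    filter_upwards [ae_restrict_mem (measurableSet_Ioo.prod measurableSet_Ioo)] with z hzQ
    have h0 : ∀ {x : ℝ}, x ∈ Ioo (0 : ℝ) 1 → ∀ᶠ ρ in 𝓝[>] (0 : ℝ), Icc (x - ρ) (x + ρ) ⊆ Icc 0 1 := by
      intro x hx
      filter_upwards [Ioc_mem_nhdsGT (lt_min hx.1 (sub_pos.2 hx.2))] with ρ hρ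
      have h1 := hρ.2.trans (min_le_left _ _)
      have h2 := hρ.2.trans (min_le_right _ _)
      exact Icc_subset_Icc (by linarith) (by linarith)
    exact (h0 hzQ.1).and (h0 hzQ.2)
  filter_upwards [leb ih, leb ik₁, leb ik₂, leb (f := fun s t => q₁ s t - q₂ s t) (iq₁.sub iq₂), hint]
    with z lh lk₁ lk₂ lq hz h0
  obtain ⟨s₀, t₀⟩ := z
  simp only at lh lk₁ lk₂ lq hz h0 ⊢
  by_contra hne
  have hcurl : 0 < |q₁ s₀ t₀ - q₂ s₀ t₀| := abs_pos.2 (sub_ne_zero.2 hne)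
  have habs : 0 < |h s₀ t₀| := abs_pos.2 h0
  have hsmall : ∀ k : ℝ, ∀ᶠ ρ in 𝓝[>] (0 : ℝ), 2 * ρ * (1 + 4 * |k|) ≤ |h s₀ t₀| / 4 := by
    intro k
    have : Tendsto (fun ρ : ℝ => 2 * ρ * (1 + 4 * |k|)) (𝓝[>] 0) (𝓝 0) := by
      have : Tendsto (fun ρ : ℝ => 2 * ρ * (1 + 4 * |k|)) (𝓝 0) (𝓝 (2 * 0 * (1 + 4 * |k|))) := by
        apply Continuous.tendsto
        fun_prop
      simpa using this.mono_left nhdsWithin_le_nhds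
    exact this.eventually (ge_mem_nhds (by positivity))
  obtain ⟨ρ, ⟨⟨⟨⟨⟨⟨e₁, e₂⟩, e₃⟩, e₄⟩, e₅⟩, e₆, e₇⟩, hρ⟩, e₈⟩ := ((((((((lh _ (by positivity : 0 < |h s₀ t₀| / 4)).and
    (lk₁ 1 one_pos)).and (lk₂ 1 one_pos)).and (lq _ (half_pos hcurl))).and (hsmall (k₁ s₀ t₀))).and hz).and
    self_mem_nhdsWithin).and (hsmall (k₂ s₀ t₀))).exists
  have hρ' : 0 < ρ := hρ
  rw [one_mul] at e₂ e₃
  have vert := fun J hJ => eventually_frequently_ae_ne_zero hh₂ ih hρ' e₆ e₇ h0 e₁ e₃ e₈ (J := J) hJ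
  have swapI : ∀ {f : ℝ → ℝ → ℝ} (c : ℝ),
      ∫ p in Icc (t₀ - ρ) (t₀ + ρ) ×ˢ Icc (s₀ - ρ) (s₀ + ρ), |flip f p.1 p.2 - c| =
      ∫ p in Icc (s₀ - ρ) (s₀ + ρ) ×ˢ Icc (t₀ - ρ) (t₀ + ρ), |f p.1 p.2 - c| := fun {f} c => by
    rw [Measure.volume_eq_prod]
    exact setIntegral_prod_swap _ _ fun p : ℝ × ℝ => |f p.1 p.2 - c|
  have horiz := fun J hJ => eventually_frequently_ae_ne_zero hh₁ ih.swap hρ' e₇ e₆ h0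
    (by rw [swapI]; exact e₁) (by rw [swapI]; exact e₂) e₅ (J := J) hJ
  -- The rectangle has area at least ρ² and the curl has zero integral on it. At a Lebesgue point
  -- where the curl is c₀ ≠ 0, its L¹ distance to c₀ on the whole square is at most |c₀|ρ²/2, which
  -- is too small.
  obtain ⟨s₁, hs₁, s₂, hs₂, t₁, ht₁, t₂, ht₂, hrect⟩ := exists_rectangle_integral_eq ha₂ ha₁ hT₁ hT₂
    heq (S := Icc (s₀ - ρ) (s₀ + ρ)) (T := Icc (t₀ - ρ) (t₀ + ρ))
    (J₁ := Icc (s₀ - ρ) (s₀ - ρ / 2)) (J₂ := Icc (s₀ + ρ / 2) (s₀ + ρ))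
    (J₃ := Icc (t₀ - ρ) (t₀ - ρ / 2)) (J₄ := Icc (t₀ + ρ / 2) (t₀ + ρ)) e₆ e₇
    ordConnected_Icc ordConnected_Icc measurableSet_Icc measurableSet_Icc measurableSet_Icc
    measurableSet_Icc (Icc_subset_Icc_right (by linarith)) (Icc_subset_Icc_left (by linarith))
    (Icc_subset_Icc_right (by linarith)) (Icc_subset_Icc_left (by linarith))
    (fun s hs s' hs' => by linarith [hs.2, hs'.1]) (fun s hs s' hs' => by linarith [hs.2, hs'.1])
    (vert _ (Or.inl rfl)) (vert _ (Or.inr rfl)) (horiz _ (Or.inl rfl)) (horiz _ (Or.inr rfl))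
  have hs₁₂ : ρ ≤ s₂ - s₁ := by linarith [hs₁.2, hs₂.1]
  have ht₁₂ : ρ ≤ t₂ - t₁ := by linarith [ht₁.2, ht₂.1]
  set B := Icc (s₀ - ρ) (s₀ + ρ) ×ˢ Icc (t₀ - ρ) (t₀ + ρ) with hB
  set R := Ioc s₁ s₂ ×ˢ Ioc t₁ t₂ with hR
  have hRB : R ⊆ B := prod_mono
    (Ioc_subset_Icc_self.trans (Icc_subset_Icc hs₁.1 hs₂.2))
    (Ioc_subset_Icc_self.trans (Icc_subset_Icc ht₁.1 ht₂.2))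
  have hBQ : B ⊆ Q := prod_mono e₆ e₇
  rw [hprod] at iq₁ iq₂
  have jB : IntegrableOn (fun p : ℝ × ℝ => q₁ p.1 p.2 - q₂ p.1 p.2) B :=
    IntegrableOn.mono_set (iq₁.sub iq₂) hBQ
  have j₁ : IntegrableOn (fun p : ℝ × ℝ => q₁ p.1 p.2) R :=
    IntegrableOn.mono_set iq₁ (hRB.trans hBQ)
  have j₂ : IntegrableOn (fun p : ℝ × ℝ => q₂ p.1 p.2) R :=
    IntegrableOn.mono_set iq₂ (hRB.trans hBQ)
  have hfinB : volume B ≠ ⊤ := by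
    rw [hB, Measure.volume_eq_prod, Measure.prod_prod]
    exact ENNReal.mul_ne_top (by simp) (by simp)
  have hR0 : ∫ p in R, (q₁ p.1 p.2 - q₂ p.1 p.2) = 0 := by
    rw [integral_sub j₁ j₂, sub_eq_zero]
    have s1 : s₁ ≤ s₂ := by linarith
    have s2 : t₁ ≤ t₂ := by linarith
    rw [intervalIntegral.integral_of_le s1, intervalIntegral.integral_of_le s2] at hrect
    simp_rw [intervalIntegral.integral_of_le s1, intervalIntegral.integral_of_le s2] at hrect
    rw [IntegrableOn, hR, Measure.volume_eq_prod, ← Measure.prod_restrict] at j₁ j₂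
    rw [hR, Measure.volume_eq_prod, ← Measure.prod_restrict, integral_prod _ j₁,
      integral_prod_symm _ j₂]
    exact hrect.symm
  have hvolR : ρ ^ 2 ≤ volume.real R := by
    rw [hR, measureReal_def, Measure.volume_eq_prod, Measure.prod_prod, Real.volume_Ioc,
      Real.volume_Ioc, ← ENNReal.ofReal_mul (by linarith), ENNReal.toReal_ofReal (by nlinarith)]
    nlinarith
  set c₀ := q₁ s₀ t₀ - q₂ s₀ t₀ with hc₀
  have i1 : IntegrableOn (fun _ : ℝ × ℝ => c₀) R :=
    integrableOn_const (ne_top_of_le_ne_top hfinB (measure_mono hRB))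
  have j₃ : IntegrableOn (fun p : ℝ × ℝ => q₁ p.1 p.2 - q₂ p.1 p.2) R := j₁.sub j₂
  have hfinal : |c₀| * ρ ^ 2 ≤ |c₀| / 2 * ρ ^ 2 := by
    calc |c₀| * ρ ^ 2 ≤ |c₀| * volume.real R := by gcongr
      _ = |∫ p in R, (q₁ p.1 p.2 - q₂ p.1 p.2 - c₀)| := by
          rw [integral_sub j₃ i1, hR0, setIntegral_const, zero_sub, abs_neg, smul_eq_mul,
            abs_mul, abs_of_nonneg measureReal_nonneg, mul_comm]
      _ ≤ ∫ p in R, |q₁ p.1 p.2 - q₂ p.1 p.2 - c₀| := abs_integral_le_integral_abs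
      _ ≤ ∫ p in B, |q₁ p.1 p.2 - q₂ p.1 p.2 - c₀| :=
          setIntegral_mono_set (jB.sub (integrableOn_const hfinB)).abs
            (Eventually.of_forall fun _ => abs_nonneg _) (LE.le.eventuallyLE hRB)
      _ ≤ _ := e₄
  have : 0 < |c₀| * ρ ^ 2 := by positivity
  linarith

end Planar

/-! ### Equality of mixed weak derivatives on a measurable set -/

section Curl

variable {E : Type*} [NormedAddCommGroup E] [NormedSpace ℝ E] [MeasurableSpace E] [BorelSpace E]

theorem HasWeakLineDerivOn.const_mul {μ : Measure E} {Ω : Set E} {v : E} {g D : E → ℝ}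
    (h : HasWeakLineDerivOn μ Ω v g D) (c : ℝ) :
    HasWeakLineDerivOn μ Ω v (fun x => c * g x) (fun x => c * D x) := by
  refine ⟨h.1.smul c, h.2.1.smul c, fun φ hφ hc hΩ => ?_⟩
  simp_rw [mul_assoc c]
  rw [integral_const_mul, integral_const_mul, h.2.2 φ hφ hc hΩ, mul_neg]

variable [FiniteDimensional ℝ E] {μ : Measure E} [μ.IsAddHaarMeasure]

theorem quasiMeasurePreserving_add_smul (ν : Measure ℝ) [SFinite ν] (v : E) :
    Measure.QuasiMeasurePreserving (fun p : E × ℝ => p.1 + p.2 • v) (μ.prod ν) μ := by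
  refine ⟨by fun_prop, ?_⟩
  refine Measure.AbsolutelyContinuous.mk fun s hs h0 => ?_
  rw [Measure.map_apply (by fun_prop) hs]
  have := ae_prod_translate (μ := μ) ν (c := fun s : ℝ => s • v) (measurable_id.smul_const v)
    (P := fun x => x ∉ s) (measure_eq_zero_iff_ae_notMem.1 h0)
  exact measure_eq_zero_iff_ae_notMem.2 this

theorem ae_integrable_plane {D : E → ℝ} (hD : Integrable D μ) (v w : E) :
    ∀ᵐ x ∂μ, Integrable (fun p : ℝ × ℝ => D (x + p.1 • v + p.2 • w))
      (unitMeasure.prod unitMeasure) := by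
  have h := integrable_shear (μ := μ) (unitMeasure.prod unitMeasure)
    (c := fun p : ℝ × ℝ => p.1 • v + p.2 • w) (by fun_prop) hD
  filter_upwards [h.prod_left_ae] with x hx
  simpa only [add_assoc] using hx

/-- Reduction to the plane spanned by `v` and `w`: the points `x + s • v` are generic for almost
every `(x, s)`, so the theorem on lines in the direction `w` applies to them. The values at `t = 0`
serve as the function `β`. -/
theorem HasWeakLineDerivOn.ae_isVerticalDeriv {Ω : Set E} {v w : E} {g D : E → ℝ}
    (h : HasWeakLineDerivOn μ Ω w g D) {U U' C : Set E} (hU' : IsOpen U') (hC : IsCompact C)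
    (hCΩ : C ⊆ Ω) (hUU' : ∀ x ∈ U, ∀ s ∈ Icc (0 : ℝ) 1, x + s • v ∈ U')
    (hUC : ∀ x ∈ U', ∀ σ ∈ Icc (0 : ℝ) 1, x + σ • w ∈ C) :
    ∀ᵐ x ∂μ, x ∈ U →
      IsVerticalDeriv (fun s t => g (x + s • v + t • w)) (fun s t => D (x + s • v + t • w)) := by
  have iD : Integrable (C.indicator D) μ :=
    (integrable_indicator_iff hC.measurableSet).2 (h.2.1.integrableOn_compact_subset hCΩ hC)
  have h1 := h.ae_prod_eq hU' hC hCΩ hUC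
  have h2 := (MeasureTheory.QuasiMeasurePreserving.prodMap
    (quasiMeasurePreserving_add_smul (μ := μ) unitMeasure v)
    (Measure.QuasiMeasurePreserving.id unitMeasure)).ae h1
  have h3 := ((measurePreserving_prodAssoc μ unitMeasure unitMeasure).symm
    MeasurableEquiv.prodAssoc).quasiMeasurePreserving.ae h2
  filter_upwards [Measure.ae_ae_of_ae_prod h3, ae_integrable_plane iD v w] with x hx hi hxU
  have hmem : ∀ᵐ p : ℝ × ℝ ∂(unitMeasure.prod unitMeasure),
      p.1 ∈ Icc (0 : ℝ) 1 ∧ p.2 ∈ Icc (0 : ℝ) 1 := by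
    rw [Measure.prod_restrict]
    filter_upwards [ae_restrict_mem (measurableSet_Icc.prod measurableSet_Icc)] with p hp using hp
  refine ⟨?_, fun s => g (x + s • v), ?_⟩
  · refine hi.congr ?_
    filter_upwards [hmem] with p hp
    exact indicator_of_mem (hUC _ (hUU' x hxU _ hp.1) _ hp.2) D
  · filter_upwards [hx, hmem] with p hp hpm
    exact hp (hUU' x hxU _ hpm.1)

/-- The mixed weak derivatives of the components of a function agree where these components
coincide with the weak derivatives of another function. -/
theorem HasWeakLineDerivOn.ae_mixed_eq_near {Ω : Set E} {x₀ v w : E} {r : ℝ} (hr : 0 < r)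
    (hΩ : Metric.closedBall x₀ (3 * r) ⊆ Ω) (hv' : 3 * ‖v‖ ≤ r) (hw' : 3 * ‖w‖ ≤ r)
    {g pv pw Tv Tw q₁ q₂ h k₁ k₂ : E → ℝ}
    (hgv : HasWeakLineDerivOn μ Ω v g pv) (hgw : HasWeakLineDerivOn μ Ω w g pw)
    (hT₁ : HasWeakLineDerivOn μ Ω w Tv q₁) (hT₂ : HasWeakLineDerivOn μ Ω v Tw q₂)
    (hh₁ : HasWeakLineDerivOn μ Ω v h k₁) (hh₂ : HasWeakLineDerivOn μ Ω w h k₂)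
    (heq : ∀ᵐ x ∂μ, x ∈ Ω → h x ≠ 0 → Tv x = pv x ∧ Tw x = pw x) :
    ∃ t ∈ 𝓝 x₀, ∀ᵐ x ∂μ, x ∈ t → h x ≠ 0 → q₁ x = q₂ x := by
  have hv : ‖v‖ ≤ r := by linarith [norm_nonneg v]
  have hw : ‖w‖ ≤ r := by linarith [norm_nonneg w]
  set C := Metric.closedBall x₀ (3 * r)
  have hC : IsCompact C := isCompact_closedBall _ _
  have hb : ∀ z : E, ‖z‖ ≤ r → ∀ ρ, ∀ x ∈ Metric.ball x₀ ρ, ∀ s ∈ Icc (0 : ℝ) 1,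
      x + s • z ∈ Metric.ball x₀ (ρ + r) := by
    intro z hz ρ x hx s hs
    rw [Metric.mem_ball, dist_eq_norm] at hx ⊢
    have h1 : ‖s • z‖ ≤ r := by
      rw [norm_smul, Real.norm_of_nonneg hs.1]
      nlinarith [hs.2, norm_nonneg z]
    calc ‖x + s • z - x₀‖ = ‖(x - x₀) + s • z‖ := by congr 1; abel
      _ ≤ ‖x - x₀‖ + ‖s • z‖ := norm_add_le _ _
      _ < ρ + r := by linarith
  have hbC : ∀ z : E, ‖z‖ ≤ r → ∀ x ∈ Metric.ball x₀ (r + r), ∀ s ∈ Icc (0 : ℝ) 1,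
      x + s • z ∈ C := fun z hz x hx s hs => by
    have := Metric.ball_subset_closedBall (hb z hz _ x hx s hs)
    rwa [show r + r + r = 3 * r by ring] at this
  have key : ∀ {z z' : E} {f D : E → ℝ}, ‖z‖ ≤ r → ‖z'‖ ≤ r → HasWeakLineDerivOn μ Ω z' f D →
      ∀ᵐ x ∂μ, x ∈ Metric.ball x₀ r → IsVerticalDeriv (fun s t => f (x + s • z + t • z'))
        (fun s t => D (x + s • z + t • z')) := fun hz hz' hf =>
    hf.ae_isVerticalDeriv Metric.isOpen_ball hC hΩ (hb _ hz r) (hbC _ hz')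
  have keyflip : ∀ {f D : E → ℝ}, HasWeakLineDerivOn μ Ω v f D →
      ∀ᵐ x ∂μ, x ∈ Metric.ball x₀ r →
        IsVerticalDeriv (flip fun s t => f (x + s • v + t • w))
          (flip fun s t => D (x + s • v + t • w)) := fun hf => by
    filter_upwards [key hw hv hf] with x hx hxb
    have := hx hxb
    simp only [add_right_comm x _ (_ • v)] at this
    exact this
  have ih : Integrable (C.indicator h) μ :=
    (integrable_indicator_iff hC.measurableSet).2 (hh₁.1.integrableOn_compact_subset hΩ hC)
  have hmem : ∀ᵐ p : ℝ × ℝ ∂(unitMeasure.prod unitMeasure),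
      p.1 ∈ Icc (0 : ℝ) 1 ∧ p.2 ∈ Icc (0 : ℝ) 1 := by
    rw [Measure.prod_restrict]
    filter_upwards [ae_restrict_mem (measurableSet_Icc.prod measurableSet_Icc)] with p hp using hp
  have hinC : ∀ x ∈ Metric.ball x₀ r, ∀ p : ℝ × ℝ, p.1 ∈ Icc (0 : ℝ) 1 ∧ p.2 ∈ Icc (0 : ℝ) 1 →
      x + p.1 • v + p.2 • w ∈ C := fun x hx p hp =>
    hbC w hw _ (hb v hv r x hx _ hp.1) _ hp.2
  have hae : ∀ᵐ x ∂μ, ∀ᵐ p : ℝ × ℝ ∂(unitMeasure.prod unitMeasure), x ∈ Metric.ball x₀ r →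
      h (x + p.1 • v + p.2 • w) ≠ 0 → q₁ (x + p.1 • v + p.2 • w) = q₂ (x + p.1 • v + p.2 • w) := by
    have heq' := Measure.ae_ae_of_ae_prod (ae_prod_translate (μ := μ)
      (unitMeasure.prod unitMeasure) (c := fun p : ℝ × ℝ => p.1 • v + p.2 • w) (by fun_prop) heq)
    filter_upwards [key hv hw hgw, keyflip hgv, key hv hw hT₁, keyflip hT₂, key hv hw hh₂,
      keyflip hh₁, ae_integrable_plane ih v w, heq'] with x x1 x2 x3 x4 x5 x6 x7 x8
    by_cases hx : x ∈ Metric.ball x₀ r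
    swap
    · exact Eventually.of_forall fun p hp => absurd hp hx
    have := ae_eq_of_isVerticalDeriv (x1 hx) (x2 hx) (x3 hx) (x4 hx) (x5 hx) (x6 hx)
      (x7.congr (by
        filter_upwards [hmem] with p hp
        exact indicator_of_mem (hinC x hx p hp) h))
      (by
        filter_upwards [x8, hmem] with p hp hpm
        rw [← add_assoc] at hp
        exact hp (hΩ (hinC x hx p hpm)))
    exact this.mono fun p hp _ => hp
  -- So far the equality holds at x + sv + tw for almost every x and almost every (s, t). Measurable
  -- representatives make the exceptional set measurable, which permits exchanging the quantifiers.
  -- A single good (s, t) is then fixed, and translation by sv + tw carries the conclusion to almost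
  -- every point near x₀.
  obtain ⟨h', hh', ehh⟩ := ih.aestronglyMeasurable
  obtain ⟨d', hd', edd⟩ : AEStronglyMeasurable (C.indicator fun x => q₁ x - q₂ x) μ :=
    (((integrable_indicator_iff hC.measurableSet).2
      ((hT₁.2.1.sub hT₂.2.1).integrableOn_compact_subset hΩ hC)).aestronglyMeasurable)
  have hNm : MeasurableSet {x | h' x ≠ 0 ∧ d' x ≠ 0} :=
    (hh'.measurable (measurableSet_singleton 0).compl).inter
      (hd'.measurable (measurableSet_singleton 0).compl)
  set B : Set E := {x | h' x ≠ 0 ∧ d' x ≠ 0} with hB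
  have hrep := Measure.ae_ae_of_ae_prod (ae_prod_translate (μ := μ)
      (unitMeasure.prod unitMeasure) (c := fun p : ℝ × ℝ => p.1 • v + p.2 • w) (by fun_prop)
      (ehh.and edd))
  have hBae : ∀ᵐ x ∂μ, ∀ᵐ p : ℝ × ℝ ∂(unitMeasure.prod unitMeasure),
      ¬ (x ∈ Metric.ball x₀ r ∧ x + (p.1 • v + p.2 • w) ∈ B) := by
    filter_upwards [hae, hrep] with x h1 h2
    filter_upwards [h1, h2, hmem] with p p1 p2 hp hbad
    have hpC := hinC x hbad.1 p hp
    rw [add_assoc] at hpC p1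
    obtain ⟨b1, b2⟩ := hbad.2
    rw [← p2.1, indicator_of_mem hpC] at b1
    rw [← p2.2, indicator_of_mem hpC] at b2
    exact b2 (sub_eq_zero.2 (p1 hbad.1 b1))
  have hms : MeasurableSet {z : E × ℝ × ℝ | ¬ (z.1 ∈ Metric.ball x₀ r ∧
      z.1 + (z.2.1 • v + z.2.2 • w) ∈ B)} := by
    refine ((Metric.isOpen_ball.measurableSet.preimage measurable_fst).inter
      (hNm.preimage ?_)).compl
    fun_prop
  have hswap := (Measure.ae_ae_comm hms).1 hBae
  have hprob : IsProbabilityMeasure unitMeasure := ⟨by simp⟩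
  obtain ⟨p, hp, hpm⟩ := (hswap.and hmem).exists
  -- The factors 3 in `hv'` and `hw'` bound this norm by 2r/3, so `x₀` still lies in the translated
  -- ball.
  have hc : ‖p.1 • v + p.2 • w‖ < r := by
    refine (norm_add_le _ _).trans_lt ?_
    rw [norm_smul, norm_smul, Real.norm_of_nonneg hpm.1.1, Real.norm_of_nonneg hpm.2.1]
    nlinarith [hpm.1.2, hpm.2.2, norm_nonneg v, norm_nonneg w]
  set c := p.1 • v + p.2 • w
  refine ⟨{y | y - c ∈ Metric.ball x₀ r}, ?_, ?_⟩
  · refine (Metric.isOpen_ball.preimage (by fun_prop : Continuous fun y => y - c)).mem_nhds ?_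
    simpa [Metric.mem_ball, dist_eq_norm] using hc
  · have h1 : ∀ᵐ y ∂μ, ¬ (y - c ∈ Metric.ball x₀ r ∧ y - c + c ∈ B) :=
      (measurePreserving_sub_right μ c).quasiMeasurePreserving.ae hp
    filter_upwards [h1, ehh, edd] with y y1 y2 y3 hy hhy
    have hyC : y ∈ C := by
      have := hinC _ hy p hpm
      rwa [add_assoc, sub_add_cancel] at this
    rw [indicator_of_mem hyC] at y2 y3
    by_contra hne
    refine y1 ⟨hy, ?_⟩
    rw [sub_add_cancel]
    exact ⟨fun h0 => hhy (y2.trans h0), fun h0 => hne (sub_eq_zero.1 (y3.trans h0))⟩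

/-- The mixed weak derivatives of the components of a function agree where these components
coincide with the weak derivatives of another function. -/
theorem HasWeakLineDerivOn.ae_mixed_eq {Ω : Set E} (hΩ : IsOpen Ω) {v w : E}
    {g pv pw Tv Tw q₁ q₂ h k₁ k₂ : E → ℝ}
    (hgv : HasWeakLineDerivOn μ Ω v g pv) (hgw : HasWeakLineDerivOn μ Ω w g pw)
    (hT₁ : HasWeakLineDerivOn μ Ω w Tv q₁) (hT₂ : HasWeakLineDerivOn μ Ω v Tw q₂)
    (hh₁ : HasWeakLineDerivOn μ Ω v h k₁) (hh₂ : HasWeakLineDerivOn μ Ω w h k₂)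
    (heq : ∀ᵐ x ∂μ, x ∈ Ω → h x ≠ 0 → Tv x = pv x ∧ Tw x = pw x) :
    ∀ᵐ x ∂μ, x ∈ Ω → h x ≠ 0 → q₁ x = q₂ x := by
  have hloc : ∀ x₀ ∈ Ω, ∃ t ∈ 𝓝 x₀, ∀ᵐ x ∂μ, x ∈ t → h x ≠ 0 → q₁ x = q₂ x := by
    intro x₀ hx₀
    obtain ⟨ε, hε, hεΩ⟩ := Metric.nhds_basis_closedBall.mem_iff.1 (hΩ.mem_nhds hx₀)
    have hpos : 0 < 9 * (‖v‖ + ‖w‖ + 1) := by positivity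
    -- Both directions are shrunk by `c` to satisfy the smallness conditions with radius ε/3. The
    -- fields `Tv` and `Tw` are multiplied by `c` too, so that they still coincide with the
    -- derivatives of `g`; the mixed derivatives thereby gain a common factor c², cancelled at the
    -- end.
    set c := ε / (9 * (‖v‖ + ‖w‖ + 1)) with hc
    have hc0 : 0 < c := by positivity
    have hcε : c * (9 * (‖v‖ + ‖w‖ + 1)) = ε := div_mul_cancel₀ _ hpos.ne'
    have hbd : ∀ z : E, ‖z‖ ≤ ‖v‖ + ‖w‖ → 3 * ‖c • z‖ ≤ ε / 3 := fun z hz => by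
      rw [norm_smul, Real.norm_of_nonneg hc0.le]
      nlinarith
    obtain ⟨t, ht, hae⟩ := HasWeakLineDerivOn.ae_mixed_eq_near (μ := μ) (Ω := Ω) (x₀ := x₀)
      (v := c • v) (w := c • w) (r := ε / 3) (by positivity)
      (by rwa [mul_div_cancel₀ ε (by norm_num : (3 : ℝ) ≠ 0)])
      (hbd v (by linarith [norm_nonneg w])) (hbd w (by linarith [norm_nonneg v]))
      (hgv.const_smul c) (hgw.const_smul c) ((hT₁.const_mul c).const_smul c)
      ((hT₂.const_mul c).const_smul c) (hh₁.const_smul c) (hh₂.const_smul c)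
      (heq.mono fun x hx h1 h2 => by rw [(hx h1 h2).1, (hx h1 h2).2]; exact ⟨rfl, rfl⟩)
    refine ⟨t, ht, hae.mono fun x hx h1 h2 => ?_⟩
    have := hx h1 h2
    rwa [mul_right_inj' hc0.ne', mul_right_inj' hc0.ne'] at this
  have hnull : μ ({x | h x ≠ 0 ∧ q₁ x ≠ q₂ x} ∩ Ω) = 0 := by
    refine measure_null_of_locally_null _ fun x hx => ?_
    obtain ⟨t, ht, hae⟩ := hloc x hx.2
    refine ⟨_, inter_mem_nhdsWithin _ ht, ?_⟩
    refine measure_mono_null (t := {x | ¬ (x ∈ t → h x ≠ 0 → q₁ x = q₂ x)}) ?_ hae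
    rintro y ⟨⟨⟨h1, h2⟩, -⟩, h3⟩ hy
    exact h2 (hy h3 h1)
  filter_upwards [measure_eq_zero_iff_ae_notMem.1 hnull] with x hx hxΩ h1
  by_contra h2
  exact hx ⟨⟨h1, h2⟩, hxΩ⟩

end Curl

/-! ### Weak differentials in open subsets of ℝᵐ -/

section WeakFDeriv

variable {m : ℕ} {Ω : Set (EuclideanSpace ℝ (Fin m))}

local notation "E" => EuclideanSpace ℝ (Fin m)

theorem HasWeakFDerivOn.lineDeriv {g : E → ℝ} {G : E → E →L[ℝ] ℝ} (h : HasWeakFDerivOn Ω g G)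
    (hΩ : IsOpen Ω) (v : E) : HasWeakLineDerivOn volume Ω v g (fun z => G z v) := by
  refine ⟨h.1, ?_, fun φ hφ hc hs => h.2.2 φ hφ hc hs v⟩
  have h2 := h.2.1
  rw [locallyIntegrableOn_iff hΩ.isLocallyClosed] at h2 ⊢
  intro k hk hkc
  exact (ContinuousLinearMap.apply ℝ ℝ v).integrable_comp (h2 k hk hkc)

theorem HasWeakFDerivOn.congr_ae {g : E → ℝ} {G G' : E → E →L[ℝ] ℝ} (h : HasWeakFDerivOn Ω g G)
    (hΩ : IsOpen Ω) (hG : ∀ᵐ z ∂(volume.restrict Ω), G z = G' z) : HasWeakFDerivOn Ω g G' := by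
  refine ⟨h.1, ?_, fun φ hφ hc hs v => ?_⟩
  · have h2 := h.2.1
    rw [locallyIntegrableOn_iff hΩ.isLocallyClosed] at h2 ⊢
    intro k hk hkc
    exact (h2 k hk hkc).congr (ae_restrict_of_ae_restrict_of_subset hk hG)
  · rw [h.2.2 φ hφ hc hs v]
    congr 1
    refine integral_congr_ae (hG.mono fun z hz => ?_)
    simp only [hz]

theorem HasWeakFDerivOn.aestronglyMeasurable {g : E → ℝ} {G : E → E →L[ℝ] ℝ}
    (h : HasWeakFDerivOn Ω g G) :
    AEStronglyMeasurable g (volume.restrict Ω) ∧ AEStronglyMeasurable G (volume.restrict Ω) :=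
  ⟨h.1.aestronglyMeasurable, h.2.1.aestronglyMeasurable⟩

theorem HasWeakLineDerivOn.sub {v : E} {g₁ g₂ D₁ D₂ : E → ℝ}
    (h₁ : HasWeakLineDerivOn volume Ω v g₁ D₁) (h₂ : HasWeakLineDerivOn volume Ω v g₂ D₂) :
    HasWeakLineDerivOn volume Ω v (fun x => g₁ x - g₂ x) (fun x => D₁ x - D₂ x) := by
  refine ⟨h₁.1.sub h₂.1, h₁.2.1.sub h₂.2.1, fun φ hφ hc hs => ?_⟩
  have hd : ContDiff ℝ ∞ fun z => fderiv ℝ φ z v :=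
    (hφ.fderiv_right (m := ∞) (by simp)).clm_apply contDiff_const
  have hdc : HasCompactSupport fun z => fderiv ℝ φ z v := hc.fderiv_apply (𝕜 := ℝ) v
  have hds : tsupport (fun z => fderiv ℝ φ z v) ⊆ Ω :=
    (tsupport_fderiv_apply_subset ℝ v).trans hs
  have i1 := fun {f : E → ℝ} (hf : LocallyIntegrableOn f Ω) =>
    (_root_.LocallyIntegrableOn.integrable_mul_of_tsupport hf hd.continuous hdc hds).integrableOn (s := Ω)
  have i2 := fun {f : E → ℝ} (hf : LocallyIntegrableOn f Ω) =>
    (_root_.LocallyIntegrableOn.integrable_mul_of_tsupport hf hφ.continuous hc hs).integrableOn (s := Ω)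
  simp_rw [sub_mul]
  rw [integral_sub (i1 h₁.1) (i1 h₂.1), integral_sub (i2 h₁.2.1) (i2 h₂.2.1),
    h₁.2.2 φ hφ hc hs, h₂.2.2 φ hφ hc hs]
  ring

/-- Weak derivatives coincide almost everywhere where the functions do. -/
theorem HasWeakLineDerivOn.ae_eq_of_eq {v : E} {g₁ g₂ D₁ D₂ : E → ℝ} (hΩ : IsOpen Ω)
    (h₁ : HasWeakLineDerivOn volume Ω v g₁ D₁) (h₂ : HasWeakLineDerivOn volume Ω v g₂ D₂) :
    ∀ᵐ x, x ∈ Ω → g₁ x = g₂ x → D₁ x = D₂ x := by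
  filter_upwards [(h₁.sub h₂).ae_eq_zero hΩ] with x hx hxΩ h
  exact sub_eq_zero.1 (hx hxΩ (sub_eq_zero.2 h))

/-- The chain rule, on the set where a weakly differentiable function is given by the
composition. -/
theorem HasWeakFDerivOn.ae_chain {ι : Type*} [Fintype ι] (hΩ : IsOpen Ω) {Φ : (ι → ℝ) → ℝ}
    (hΦ : ContDiff ℝ 1 Φ) {L : NNReal} (hL : LipschitzWith L Φ)
    {g : ι → E → ℝ} {G : ι → E → E →L[ℝ] ℝ} (hg : ∀ i, HasWeakFDerivOn Ω (g i) (G i))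
    {f : E → ℝ} {F : E → E →L[ℝ] ℝ} (hf : HasWeakFDerivOn Ω f F) :
    ∀ᵐ z ∂(volume.restrict Ω), f z = Φ (fun i => g i z) →
      ∀ v, F z v = fderiv ℝ Φ (fun i => g i z) fun i => G i z v := by
  have h1 : ∀ j : Fin m, ∀ᵐ z, z ∈ Ω → f z = Φ (fun i => g i z) →
      F z (EuclideanSpace.basisFun (Fin m) ℝ j) = fderiv ℝ Φ (fun i => g i z)
        fun i => G i z (EuclideanSpace.basisFun (Fin m) ℝ j) := fun j =>
    -- The coincidence set need not be open. It is the zero set of the difference of two weakly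
    -- differentiable functions, on which the derivative of the difference vanishes almost
    -- everywhere.
    (hf.lineDeriv hΩ _).ae_eq_of_eq hΩ
      (HasWeakLineDerivOn.comp hΦ hL hΩ fun i => (hg i).lineDeriv hΩ _)
  rw [ae_restrict_iff' hΩ.measurableSet]
  filter_upwards [ae_all_iff.2 h1] with z hz hzΩ he v
  have : F z = (fderiv ℝ Φ (fun i => g i z)).comp (ContinuousLinearMap.pi fun i => G i z) := by
    refine ContinuousLinearMap.coe_injective
      ((EuclideanSpace.basisFun (Fin m) ℝ).toBasis.ext fun j => ?_)
    rw [OrthonormalBasis.coe_toBasis]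
    exact hz j hzΩ he
  rw [this]
  rfl

/-- The weak derivative of a function is `l` almost everywhere where it coincides with the linear
form `l`. -/
theorem HasWeakFDerivOn.ae_eq_of_eq_clm (hΩ : IsOpen Ω) {f : E → ℝ} {F : E → E →L[ℝ] ℝ}
    (hf : HasWeakFDerivOn Ω f F) (l : E →L[ℝ] ℝ) :
    ∀ᵐ z ∂(volume.restrict Ω), f z = l z → F z = l := by
  have hl : ∀ v, HasWeakLineDerivOn volume Ω v (fun z => l z) (fun _ => l v) := fun v => by
    refine HasWeakLineDerivOn.of_ae_sub_eq hΩ (l.continuous.locallyIntegrable.locallyIntegrableOn _)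
      (continuous_const.locallyIntegrable.locallyIntegrableOn _) fun K _ _ => ⟨1, one_pos, ?_⟩
    intro s _
    refine Eventually.of_forall fun x _ => ?_
    simp
  have h1 : ∀ j : Fin m, ∀ᵐ z, z ∈ Ω → f z = l z →
      F z (EuclideanSpace.basisFun (Fin m) ℝ j) = l (EuclideanSpace.basisFun (Fin m) ℝ j) :=
    fun j => (hf.lineDeriv hΩ _).ae_eq_of_eq hΩ (hl _)
  rw [ae_restrict_iff' hΩ.measurableSet]
  filter_upwards [ae_all_iff.2 h1] with z hz hzΩ he
  refine ContinuousLinearMap.coe_injective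
    ((EuclideanSpace.basisFun (Fin m) ℝ).toBasis.ext fun j => ?_)
  simpa using hz j hzΩ he

end WeakFDeriv

/-! ### Almost everywhere on a manifold -/

section ManifoldAE

variable {m : ℕ} {M : Type*} [TopologicalSpace M] [ChartedSpace (EuclideanSpace ℝ (Fin m)) M]

theorem eventually_manifoldAE {P : M → Prop} : (∀ᶠ x in manifoldAE m M, P x) ↔
    ∀ x₀ : M, ∀ᵐ z ∂((volume : Measure (EuclideanSpace ℝ (Fin m))).restrict
      (extChartAt (𝓡 m) x₀).target), P ((extChartAt (𝓡 m) x₀).symm z) := by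
  simp [manifoldAE, eventually_iSup, eventually_map]

theorem eventually_manifoldAE_countable {ι : Type*} [Countable ι] {P : ι → M → Prop} :
    (∀ᶠ x in manifoldAE m M, ∀ i, P i x) ↔ ∀ i, ∀ᶠ x in manifoldAE m M, P i x := by
  simp only [eventually_manifoldAE, ae_all_iff]
  exact forall_comm

end ManifoldAE

/-! ### Cutoffs and compactly supported coordinate functions -/

section Cutoff

variable {F H Y : Type*} [NormedAddCommGroup F] [NormedSpace ℝ F] [FiniteDimensional ℝ F]
  [TopologicalSpace H] {I : ModelWithCorners ℝ F H} [I.Boundaryless]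
  [TopologicalSpace Y] [ChartedSpace H Y]

variable (I) in
/-- The function on a manifold that is given by `β` in the chart around `y` and vanishes outside
of its domain. -/
def chartExtend (y : Y) (β : F → ℝ) (p : Y) : ℝ :=
  open Classical in if p ∈ (extChartAt I y).source then β (extChartAt I y p) else 0

theorem chartExtend_of_mem {y p : Y} {β : F → ℝ} (hp : p ∈ (extChartAt I y).source) :
    chartExtend I y β p = β (extChartAt I y p) := if_pos hp

theorem chartExtend_eq_zero {y p : Y} {β : F → ℝ}
    (hp : p ∉ (extChartAt I y).symm '' tsupport β) : chartExtend I y β p = 0 := by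
  unfold chartExtend
  split_ifs with h
  · by_contra hne
    exact hp ⟨_, subset_tsupport β hne, (extChartAt I y).left_inv h⟩
  · rfl

variable [T2Space Y]

theorem isCompact_image_tsupport {y : Y} {β : F → ℝ} (hc : HasCompactSupport β)
    (hs : tsupport β ⊆ (extChartAt I y).target) :
    IsCompact ((extChartAt I y).symm '' tsupport β) :=
  hc.isCompact.image_of_continuousOn ((continuousOn_extChartAt_symm y).mono hs)

/-- In a Hausdorff manifold the compact image of the support is closed, so the extension by zero
acquires no further support. -/
theorem tsupport_chartExtend_subset {y : Y} {β : F → ℝ} (hc : HasCompactSupport β)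
    (hs : tsupport β ⊆ (extChartAt I y).target) :
    tsupport (chartExtend I y β) ⊆ (extChartAt I y).symm '' tsupport β :=
  closure_minimal (fun _ hp => by_contra fun h => hp (chartExtend_eq_zero h))
    (isCompact_image_tsupport hc hs).isClosed

theorem hasCompactSupport_chartExtend {y : Y} {β : F → ℝ} (hc : HasCompactSupport β)
    (hs : tsupport β ⊆ (extChartAt I y).target) : HasCompactSupport (chartExtend I y β) :=
  HasCompactSupport.intro (isCompact_image_tsupport hc hs) fun _ h => chartExtend_eq_zero h

theorem contMDiff_chartExtend {r : ℕ∞ω} [IsManifold I r Y] {y : Y} {β : F → ℝ}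
    (hβ : ContDiff ℝ r β) (hc : HasCompactSupport β)
    (hs : tsupport β ⊆ (extChartAt I y).target) : ContMDiff I 𝓘(ℝ, ℝ) r (chartExtend I y β) := by
  refine contMDiff_of_tsupport fun p hp => ?_
  obtain ⟨w, hw, rfl⟩ := tsupport_chartExtend_subset hc hs hp
  have hp' := (extChartAt I y).map_target (hs hw)
  have h1 : ContMDiffAt I 𝓘(ℝ, ℝ) r (fun p => β (extChartAt I y p)) ((extChartAt I y).symm w) :=
    hβ.contMDiff.contMDiffAt.comp _
      (contMDiffAt_extChartAt' (by rwa [← extChartAt_source I]))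
  refine h1.congr_of_eventuallyEq ?_
  filter_upwards [(isOpen_extChartAt_source y).mem_nhds hp'] with q hq
  exact chartExtend_of_mem hq

variable (I) in
theorem exists_chart_bump (y : Y) {O : Set Y} (hO : O ∈ 𝓝 y) : ∃ β : F → ℝ, ContDiff ℝ ∞ β ∧
    HasCompactSupport β ∧ tsupport β ⊆ (extChartAt I y).target ∩ (extChartAt I y).symm ⁻¹' O ∧
      ∃ r > 0, ∀ w ∈ Metric.ball (extChartAt I y y) r, β w = 1 := by
  have hmem : (extChartAt I y).target ∩ (extChartAt I y).symm ⁻¹' O ∈ 𝓝 (extChartAt I y y) := by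
    refine inter_mem ((isOpen_extChartAt_target y).mem_nhds (mem_extChartAt_target y)) ?_
    refine (continuousAt_extChartAt_symm y).preimage_mem_nhds ?_
    rwa [extChartAt_to_inv]
  obtain ⟨ε, hε, hb⟩ := Metric.nhds_basis_closedBall.mem_iff.1 hmem
  let b : ContDiffBump (extChartAt I y y) := ⟨ε / 2, ε, by positivity, by linarith⟩
  refine ⟨b, b.contDiff, b.hasCompactSupport, ?_, ε / 2, by positivity, fun w hw => ?_⟩
  · rw [b.tsupport_eq]
    exact hb
  · exact b.one_of_mem_closedBall (Metric.ball_subset_closedBall hw)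

variable (I) in
theorem exists_contMDiff_cutoff {r : ℕ∞} [IsManifold I r Y] (y : Y) {O : Set Y} (hO : O ∈ 𝓝 y) :
    ∃ ρ : Y → ℝ, ContMDiff I 𝓘(ℝ, ℝ) r ρ ∧ HasCompactSupport ρ ∧ tsupport ρ ⊆ O ∧
      ∀ᶠ p in 𝓝 y, ρ p = 1 := by
  obtain ⟨β, hβ, hc, hs, ε, hε, h1⟩ := exists_chart_bump I y hO
  have hs' := hs.trans inter_subset_left
  refine ⟨chartExtend I y β, contMDiff_chartExtend (hβ.of_le (by exact_mod_cast le_top)) hc hs',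
    hasCompactSupport_chartExtend hc hs', ?_, ?_⟩
  · refine (tsupport_chartExtend_subset hc hs').trans ?_
    rintro _ ⟨w, hw, rfl⟩
    exact (hs hw).2
  · filter_upwards [extChartAt_source_mem_nhds (I := I) y,
      (continuousAt_extChartAt (I := I) y).preimage_mem_nhds (Metric.ball_mem_nhds _ hε)] with p hp hq
    rw [chartExtend_of_mem hp, h1 _ hq]

theorem ContMDiffOn.cutoff_mul {r : ℕ∞ω} {ρ f : Y → ℝ} {O : Set Y} (hO : IsOpen O)
    (hf : ContMDiffOn I 𝓘(ℝ, ℝ) r f O) (hρ : ContMDiff I 𝓘(ℝ, ℝ) r ρ) (hs : tsupport ρ ⊆ O) :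
    ContMDiff I 𝓘(ℝ, ℝ) r (fun p => ρ p * f p) := by
  refine contMDiff_of_tsupport fun p hp => ?_
  have hpO := hs (tsupport_mul_subset_left hp)
  exact hρ.contMDiffAt.mul (hf.contMDiffAt (hO.mem_nhds hpO))

end Cutoff

section Coordinates

variable {F H Y : Type*} [NormedAddCommGroup F] [NormedSpace ℝ F] [FiniteDimensional ℝ F]
  [TopologicalSpace H] {I : ModelWithCorners ℝ F H} [I.Boundaryless]
  [TopologicalSpace Y] [ChartedSpace H Y]

theorem contMDiffAt_extChartAt_symm {r : ℕ∞ω} [IsManifold I r Y] {y : Y} {w : F}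
    (hw : w ∈ (extChartAt I y).target) : ContMDiffAt 𝓘(ℝ, F) I r (extChartAt I y).symm w :=
  (contMDiffOn_extChartAt_symm y).contMDiffAt ((isOpen_extChartAt_target y).mem_nhds hw)

theorem isInvertible_mfderiv_extChartAt_symm [IsManifold I 1 Y] {y : Y} {w : F} (hw : w ∈ (extChartAt I y).target) :
    (mfderiv 𝓘(ℝ, F) I (extChartAt I y).symm w).IsInvertible := by
  have := isInvertible_mfderivWithin_extChartAt_symm (I := I) hw
  rwa [I.range_eq_univ, mfderivWithin_univ] at this

variable (F) in
/-- Linear coordinates on `F`. -/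
def coordEquiv : F ≃L[ℝ] (Fin (Module.finrank ℝ F) → ℝ) := (Module.finBasis ℝ F).equivFunL

variable (I) [T2Space Y]

/-- A bump function in the chart around `y`. -/
def coordBump (y : Y) : F → ℝ := (exists_chart_bump I y univ_mem).choose

theorem contDiff_coordBump (y : Y) : ContDiff ℝ ∞ (coordBump I y) :=
  (exists_chart_bump I y univ_mem).choose_spec.1

theorem hasCompactSupport_coordBump (y : Y) : HasCompactSupport (coordBump I y) :=
  (exists_chart_bump I y univ_mem).choose_spec.2.1

theorem tsupport_coordBump_subset (y : Y) : tsupport (coordBump I y) ⊆ (extChartAt I y).target :=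
  (exists_chart_bump I y univ_mem).choose_spec.2.2.1.trans inter_subset_left

/-- A neighbourhood of `y` on which the bump function is equal to `1`. -/
def coordNhd (y : Y) : Set Y := (extChartAt I y).source ∩ extChartAt I y ⁻¹'
  Metric.ball (extChartAt I y y) (exists_chart_bump I y univ_mem).choose_spec.2.2.2.choose

theorem isOpen_coordNhd (y : Y) : IsOpen (coordNhd I y) :=
  (continuousOn_extChartAt y).isOpen_inter_preimage (isOpen_extChartAt_source y) Metric.isOpen_ball

theorem mem_coordNhd (y : Y) : y ∈ coordNhd I y :=
  ⟨mem_extChartAt_source y, Metric.mem_ball_self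
    (exists_chart_bump I y univ_mem).choose_spec.2.2.2.choose_spec.1⟩

variable {I}

theorem coordBump_eventuallyEq_one {y p : Y} (hp : p ∈ coordNhd I y) :
    ∀ᶠ w in 𝓝 (extChartAt I y p), coordBump I y w = 1 := by
  filter_upwards [Metric.isOpen_ball.mem_nhds hp.2] with w hw
  exact (exists_chart_bump I y univ_mem).choose_spec.2.2.2.choose_spec.2 w hw

variable (I) in
/-- The cutoff function at `y`. -/
def coordCutoff (y : Y) : Y → ℝ := chartExtend I y (coordBump I y)

variable (I) in
/-- The coordinates of the chart around `y`, multiplied by the cutoff function. -/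
def coordFun (y : Y) (i : Fin (Module.finrank ℝ F)) : Y → ℝ :=
  chartExtend I y fun w => coordBump I y w * coordEquiv F w i

theorem coordFun_of_mem {y p : Y} (hp : p ∈ coordNhd I y) (i : Fin (Module.finrank ℝ F)) :
    coordFun I y i p = coordEquiv F (extChartAt I y p) i := by
  rw [coordFun, chartExtend_of_mem hp.1, (coordBump_eventuallyEq_one hp).self_of_nhds, one_mul]

theorem coordCutoff_of_mem {y p : Y} (hp : p ∈ coordNhd I y) : coordCutoff I y p = 1 := by
  rw [coordCutoff, chartExtend_of_mem hp.1, (coordBump_eventuallyEq_one hp).self_of_nhds]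

theorem contMDiff_coordCutoff {r : ℕ∞ω} (hr : r ≤ ∞) [IsManifold I r Y] (y : Y) :
    ContMDiff I 𝓘(ℝ, ℝ) r (coordCutoff I y) :=
  contMDiff_chartExtend ((contDiff_coordBump I y).of_le hr) (hasCompactSupport_coordBump I y)
    (tsupport_coordBump_subset I y)

theorem hasCompactSupport_coordCutoff (y : Y) : HasCompactSupport (coordCutoff I y) :=
  hasCompactSupport_chartExtend (hasCompactSupport_coordBump I y) (tsupport_coordBump_subset I y)

theorem contMDiff_coordFun {r : ℕ∞ω} (hr : r ≤ ∞) [IsManifold I r Y] (y : Y)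
    (i : Fin (Module.finrank ℝ F)) : ContMDiff I 𝓘(ℝ, ℝ) r (coordFun I y i) := by
  have h : ContDiff ℝ r fun w : F => coordEquiv F w i :=
    (contDiff_apply ℝ ℝ i).comp (coordEquiv F).contDiff
  exact contMDiff_chartExtend (((contDiff_coordBump I y).of_le hr).mul h)
    (hasCompactSupport_coordBump I y).mul_right
    ((tsupport_mul_subset_left).trans (tsupport_coordBump_subset I y))

theorem hasCompactSupport_coordFun (y : Y) (i : Fin (Module.finrank ℝ F)) :
    HasCompactSupport (coordFun I y i) :=
  hasCompactSupport_chartExtend (hasCompactSupport_coordBump I y).mul_right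
    ((tsupport_mul_subset_left).trans (tsupport_coordBump_subset I y))

/-- The cutoff vanishes outside the chart, so equality of cutoffs forces `q` into the chart and
gives the bump the value 1 there. The cut-off coordinates of `q` are then its true coordinates. -/
theorem eq_of_coordFun_eq {y p q : Y} (hp : p ∈ coordNhd I y)
    (h0 : coordCutoff I y p = coordCutoff I y q) (h : ∀ i, coordFun I y i p = coordFun I y i q) :
    p = q := by
  rw [coordCutoff_of_mem hp] at h0
  have hq : q ∈ (extChartAt I y).source := by
    by_contra hq
    rw [coordCutoff, chartExtend, if_neg hq] at h0
    exact one_ne_zero h0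
  refine (extChartAt I y).injOn hp.1 hq ((coordEquiv F).injective (funext fun i => ?_))
  rw [coordCutoff, chartExtend_of_mem hq] at h0
  rw [← coordFun_of_mem hp, h i, coordFun, chartExtend_of_mem hq, ← h0, one_mul]

variable (I) in
-- Countability allows the almost-everywhere statements attached to the individual charts to hold
-- simultaneously.
theorem exists_countable_coordNhd_cover (Y : Type*) [TopologicalSpace Y] [ChartedSpace H Y]
    [T2Space Y] [SecondCountableTopology Y] :
    ∃ S : Set Y, S.Countable ∧ ∀ p : Y, ∃ y ∈ S, p ∈ coordNhd I y := by
  obtain ⟨S, hS, h⟩ := TopologicalSpace.countable_cover_nhds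
    (f := fun y : Y => coordNhd I y) fun y => (isOpen_coordNhd I y).mem_nhds (mem_coordNhd I y)
  refine ⟨S, hS, fun p => ?_⟩
  have : p ∈ ⋃ y ∈ S, coordNhd I y := h ▸ mem_univ p
  simpa using this

variable [IsManifold I 1 Y]

theorem mfderiv_extChartAt_symm_apply {f : Y → ℝ} {y p : Y} (hp : p ∈ (extChartAt I y).source)
    (hf : MDifferentiableAt I 𝓘(ℝ, ℝ) f p) (w : F) :
    mfderiv I 𝓘(ℝ, ℝ) f p (mfderiv 𝓘(ℝ, F) I (extChartAt I y).symm (extChartAt I y p) w) =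
      fderiv ℝ (f ∘ (extChartAt I y).symm) (extChartAt I y p) w := by
  have h1 : MDifferentiableAt 𝓘(ℝ, F) I (extChartAt I y).symm (extChartAt I y p) :=
    (contMDiffAt_extChartAt_symm ((extChartAt I y).map_source hp)).mdifferentiableAt one_ne_zero
  have h2 : HasMFDerivAt I 𝓘(ℝ, ℝ) f ((extChartAt I y).symm (extChartAt I y p))
      (mfderiv I 𝓘(ℝ, ℝ) f p) := by
    rw [(extChartAt I y).left_inv hp]
    exact hf.hasMFDerivAt
  have := (h2.comp _ h1.hasMFDerivAt).mfderiv
  rw [mfderiv_eq_fderiv] at this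
  rw [this]
  rfl

/-- The functions `coordFun` separate tangent vectors. -/
theorem mfderiv_coordFun_symm {y p : Y} (hp : p ∈ coordNhd I y) (i : Fin (Module.finrank ℝ F))
    (w : F) :
    mfderiv I 𝓘(ℝ, ℝ) (coordFun I y i) p
      (mfderiv 𝓘(ℝ, F) I (extChartAt I y).symm (extChartAt I y p) w) = coordEquiv F w i := by
  rw [mfderiv_extChartAt_symm_apply hp.1
    ((contMDiff_coordFun (by simp) y i).mdifferentiable one_ne_zero _)]
  have h1 : (coordFun I y i ∘ (extChartAt I y).symm) =ᶠ[𝓝 (extChartAt I y p)]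
      fun w => ((ContinuousLinearMap.proj i : (Fin (Module.finrank ℝ F) → ℝ) →L[ℝ] ℝ) ∘L
        (coordEquiv F : F →L[ℝ] (Fin (Module.finrank ℝ F) → ℝ))) w := by
    filter_upwards [coordBump_eventuallyEq_one hp,
      (isOpen_extChartAt_target y).mem_nhds ((extChartAt I y).map_source hp.1)] with w hw hwt
    rw [Function.comp_apply, coordFun, chartExtend_of_mem ((extChartAt I y).map_target hwt),
      (extChartAt I y).right_inv hwt, hw, one_mul]
    rfl
  rw [h1.fderiv_eq, ContinuousLinearMap.fderiv]
  rfl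

/-- Inverts `mfderiv_coordFun_symm`. Identities between tangent vectors can therefore be tested with
finitely many compactly supported functions. -/
theorem eq_symm_coord_of_mem {y p : Y} (hp : p ∈ coordNhd I y) (ζ : TangentSpace I p) :
    ζ = mfderiv 𝓘(ℝ, F) I (extChartAt I y).symm (extChartAt I y p)
      ((coordEquiv F).symm fun i => mfderiv I 𝓘(ℝ, ℝ) (coordFun I y i) p ζ) := by
  obtain ⟨w, hw⟩ : ∃ w : F, mfderiv 𝓘(ℝ, F) I (extChartAt I y).symm (extChartAt I y p) w = ζ :=
    (isInvertible_mfderiv_extChartAt_symm ((extChartAt I y).map_source hp.1)).bijective.2 ζ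
  have : (fun i => mfderiv I 𝓘(ℝ, ℝ) (coordFun I y i) p ζ) = coordEquiv F w := by
    funext i
    rw [← mfderiv_coordFun_symm hp i w]
    congr 1
    exact hw.symm
  rw [this, ContinuousLinearEquiv.symm_apply_apply]
  exact hw.symm

end Coordinates

/-! ### Weak tangent maps of colocally weakly differentiable maps -/

section Colocal

variable {m : ℕ} {M : Type*} [TopologicalSpace M] [ChartedSpace (EuclideanSpace ℝ (Fin m)) M]
  [IsManifold (𝓡 m) 1 M]
  {F H Y : Type*} [NormedAddCommGroup F] [NormedSpace ℝ F] [FiniteDimensional ℝ F]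
  [TopologicalSpace H] {I : ModelWithCorners ℝ F H} [I.Boundaryless]
  [TopologicalSpace Y] [ChartedSpace H Y] [T2Space Y] [IsManifold I 1 Y]

/-- Multiplying the chart expression of `f` by the bump makes it compactly supported, hence globally
Lipschitz as the weak chain rule demands. It alters neither `f` nor its differential over `coordNhd
I y`, where the bump is locally 1. -/
theorem exists_coordinate_expression {f : Y → ℝ} (hf : ContMDiff I 𝓘(ℝ, ℝ) 1 f) (y : Y) :
    ∃ Φ : (Fin (Module.finrank ℝ F) → ℝ) → ℝ, ContDiff ℝ 1 Φ ∧ (∃ L, LipschitzWith L Φ) ∧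
      ∀ p ∈ coordNhd I y, f p = Φ (fun i => coordFun I y i p) ∧ ∀ a,
        fderiv ℝ Φ (fun i => coordFun I y i p) a = mfderiv I 𝓘(ℝ, ℝ) f p
          (mfderiv 𝓘(ℝ, F) I (extChartAt I y).symm (extChartAt I y p) ((coordEquiv F).symm a)) := by
  set Θ : F → ℝ := fun w => coordBump I y w * (f ∘ (extChartAt I y).symm) w with hΘ
  have hΘd : ContDiff ℝ 1 Θ := by
    rw [← contMDiff_iff_contDiff]
    exact ContMDiffOn.cutoff_mul (isOpen_extChartAt_target y)
      (hf.comp_contMDiffOn (contMDiffOn_extChartAt_symm y))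
      ((contDiff_coordBump I y).of_le (by simp)).contMDiff (tsupport_coordBump_subset I y)
  have hΘc : HasCompactSupport Θ := (hasCompactSupport_coordBump I y).mul_right
  obtain ⟨L, hL⟩ := hΘd.lipschitzWith_of_hasCompactSupport hΘc one_ne_zero
  refine ⟨Θ ∘ (coordEquiv F).symm, hΘd.comp (coordEquiv F).symm.contDiff,
    ⟨_, hL.comp (coordEquiv F).symm.lipschitz⟩, fun p hp => ?_⟩
  have hc : (coordEquiv F).symm (fun i => coordFun I y i p) = extChartAt I y p := by
    rw [ContinuousLinearEquiv.symm_apply_eq]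
    exact funext fun i => coordFun_of_mem hp i
  refine ⟨?_, fun a => ?_⟩
  · rw [Function.comp_apply, hc, hΘ]
    simp only [Function.comp_apply]
    rw [(coordBump_eventuallyEq_one hp).self_of_nhds, one_mul, (extChartAt I y).left_inv hp.1]
  · rw [mfderiv_extChartAt_symm_apply hp.1 (hf.mdifferentiable one_ne_zero _),
      fderiv_comp _ (by exact (hΘd.differentiable one_ne_zero) _)
        (coordEquiv F).symm.differentiableAt, ContinuousLinearEquiv.fderiv]
    have h1 : Θ =ᶠ[𝓝 (extChartAt I y p)] f ∘ (extChartAt I y).symm := by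
      filter_upwards [coordBump_eventuallyEq_one hp] with w hw
      rw [hΘ]
      simp only [hw, one_mul]
    rw [← h1.fderiv_eq, hc]
    rfl

variable (I) in
/-- `Du` is a weak tangent map of `u`: the chain rule holds almost everywhere for the weakly
differentiable functions of the form `f ∘ u`. -/
def IsWeakTangentMap (u : M → Y) (Du : ∀ x : M, TangentSpace (𝓡 m) x →L[ℝ] TangentSpace I (u x)) :
    Prop :=
  ∀ f : Y → ℝ, ContMDiff I 𝓘(ℝ, ℝ) 1 f → ∀ G : ∀ x : M, TangentSpace (𝓡 m) x →L[ℝ] ℝ,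
    HasWeakMFDeriv (fun x => f (u x)) G →
      ∀ᶠ x in manifoldAE m M, G x = (mfderiv I 𝓘(ℝ, ℝ) f (u x)).comp (Du x)

/-- `Du x` is assembled from the weak derivatives of the coordinate functions of the chart selected
by `u x`. For a given `f`, the function `f ∘ u` is the corresponding composition only on the
preimage of `coordNhd`, a measurable set; `HasWeakFDerivOn.ae_chain` handles this for the countably
many charts. No compact support of `f` is needed once `f ∘ u` is weakly differentiable. -/
theorem ColocallyWeaklyDifferentiable.exists_isWeakTangentMap [SecondCountableTopology Y]
    {u : M → Y} (hu : ColocallyWeaklyDifferentiable m I u) :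
    ∃ Du : ∀ x : M, TangentSpace (𝓡 m) x →L[ℝ] TangentSpace I (u x), IsWeakTangentMap I u Du := by
  obtain ⟨S, hS, hcov⟩ := exists_countable_coordNhd_cover I Y
  choose c hcS hc using hcov
  choose G hG using fun (y : Y) (i : Fin (Module.finrank ℝ F)) =>
    hu.2 (coordFun I y i) (contMDiff_coordFun (by simp) y i) (hasCompactSupport_coordFun y i)
  have hinst : Countable S := hS.to_subtype
  let Du : ∀ x : M, TangentSpace (𝓡 m) x →L[ℝ] TangentSpace I (u x) := fun x =>
    (mfderiv 𝓘(ℝ, F) I (extChartAt I (c (u x))).symm (extChartAt I (c (u x)) (u x))).comp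
      (((coordEquiv F).symm : (Fin (Module.finrank ℝ F) → ℝ) →L[ℝ] F).comp
        (ContinuousLinearMap.pi fun i => G (c (u x)) i x))
  refine ⟨Du, fun f hf G' hG' => eventually_manifoldAE.2 fun x₀ => ?_⟩
  choose Φ hΦ hL hΦc using fun y : Y => exists_coordinate_expression (I := I) hf y
  choose L hL using hL
  have hae := ae_all_iff.2 fun y : S => HasWeakFDerivOn.ae_chain (isOpen_extChartAt_target x₀)
    (hΦ y) (hL y) (fun i => hG y i x₀) (hG' x₀)
  filter_upwards [hae, ae_restrict_mem (isOpen_extChartAt_target x₀).measurableSet] with z hz hzt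
  set x := (extChartAt (𝓡 m) x₀).symm z with hx
  have hy := hz ⟨c (u x), hcS _⟩
  obtain ⟨h1, h2⟩ := hΦc (c (u x)) (u x) (hc (u x))
  refine ContinuousLinearMap.ext fun e => ?_
  obtain ⟨v, rfl⟩ := (isInvertible_mfderiv_extChartAt_symm (I := 𝓡 m) hzt).bijective.2 e
  exact (hy h1 v).trans (h2 _)

end Colocal

/-! ### Charts of the tangent bundle and of T*M ⊗ TN -/

section TangentCharts

variable {F H Y : Type*} [NormedAddCommGroup F] [NormedSpace ℝ F]
  [TopologicalSpace H] {I : ModelWithCorners ℝ F H}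
  [TopologicalSpace Y] [ChartedSpace H Y] [IsManifold I 1 Y]

theorem extChartAt_tangentBundle_source (p : TangentBundle I Y) :
    (extChartAt I.tangent p).source = {q | q.1 ∈ (extChartAt I p.1).source} := by
  ext q
  rw [extChartAt_source, mem_ofPred_eq, extChartAt_source]
  exact TangentBundle.mem_chart_source_iff q p

theorem extChartAt_tangentBundle_target (p : TangentBundle I Y) :
    (extChartAt I.tangent p).target = (extChartAt I p.1).target ×ˢ univ := by
  ext z
  rw [extChartAt_target, mem_inter_iff, mem_preimage, TangentBundle.mem_chart_target_iff,
    mem_prod, extChartAt_target]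
  simp only [mem_inter_iff, mem_preimage, mem_univ, and_true]
  rw [show I.tangent = I.prod 𝓘(ℝ, F) from rfl, modelWithCorners_prod_coe, Set.range_prodMap]
  simp [and_comm]

theorem extChartAt_tangentBundle_apply (p q : TangentBundle I Y) :
    extChartAt I.tangent p q =
      (extChartAt I p.1 q.1, tangentCoordChange I q.1 p.1 q.1 q.2) := by
  rw [extChartAt_coe, Function.comp_apply]
  rfl

theorem tangentCoordChange_tangentCoordChange_self {x z : Y} (hz : z ∈ (extChartAt I x).source)
    (v : F) : tangentCoordChange I z x z (tangentCoordChange I x z z v) = v := by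
  rw [tangentCoordChange_comp ⟨⟨hz, mem_extChartAt_source z⟩, hz⟩, tangentCoordChange_self hz]

theorem extChartAt_tangentBundle_symm_apply (p : TangentBundle I Y) {z : F} (v : F)
    (hz : z ∈ (extChartAt I p.1).target) : (extChartAt I.tangent p).symm (z, v) =
      ⟨(extChartAt I p.1).symm z, tangentCoordChange I p.1 ((extChartAt I p.1).symm z)
        ((extChartAt I p.1).symm z) v⟩ := by
  have h1 := (extChartAt I p.1).map_target hz
  refine (((extChartAt I.tangent p).eq_symm_apply ?_ ?_).2 ?_).symm
  · rw [extChartAt_tangentBundle_source]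
    exact h1
  · rw [extChartAt_tangentBundle_target]
    exact ⟨hz, mem_univ _⟩
  · rw [extChartAt_tangentBundle_apply]
    simp only
    rw [(extChartAt I p.1).right_inv hz, tangentCoordChange_tangentCoordChange_self h1]

variable [I.Boundaryless]

/-- Tangent vectors at a point are recorded in its preferred chart, so the derivative of an inverse
chart is a change of coordinates towards that preferred chart. Computations thus reduce to
derivatives of transition maps. -/
theorem mfderiv_extChartAt_symm_eq_tangentCoordChange {y : Y} {z : F}
    (hz : z ∈ (extChartAt I y).target) : mfderiv 𝓘(ℝ, F) I (extChartAt I y).symm z =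
      tangentCoordChange I y ((extChartAt I y).symm z) ((extChartAt I y).symm z) := by
  have h1 := (extChartAt I y).map_target hz
  rw [extChartAt_source] at h1
  have h2 := TangentBundle.symmL_trivializationAt (I := I) h1
  rw [TangentBundle.symmL_trivializationAt_eq_core h1, (extChartAt I y).right_inv hz,
    I.range_eq_univ, mfderivWithin_univ] at h2
  exact h2.symm

theorem tangentCoordChange_eq_fderiv (x y z : Y) : tangentCoordChange I x y z =
    fderiv ℝ (extChartAt I y ∘ (extChartAt I x).symm) (extChartAt I x z) := by
  rw [tangentCoordChange_def, I.range_eq_univ, fderivWithin_univ]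

end TangentCharts

section HomCharts

variable {m n : ℕ}
  {M : Type*} [TopologicalSpace M] [ChartedSpace (EuclideanSpace ℝ (Fin m)) M]
  [IsManifold (𝓡 m) 2 M]
  {N : Type*} [TopologicalSpace N] [ChartedSpace (EuclideanSpace ℝ (Fin n)) N]
  [IsManifold (𝓡 n) 2 N]

/-- The trivialization of the pullback restricts on fibres to that of `TM`, so the inverses agree.
-/
theorem srcTangent_symmL {p₀ p : M × N}
    (hx : p.1 ∈ (chartAt (EuclideanSpace ℝ (Fin m)) p₀.1).source) :
    ((trivializationAt (EuclideanSpace ℝ (Fin m)) (SrcTangent m n M N) p₀).symmL ℝ p :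
      EuclideanSpace ℝ (Fin m) →L[ℝ] TangentSpace (𝓡 m) p.1) =
    (trivializationAt (EuclideanSpace ℝ (Fin m)) (TangentSpace (𝓡 m)) p₀.1).symmL ℝ p.1 := by
  ext1 v
  set a : TangentSpace (𝓡 m) p.1 :=
    (trivializationAt (EuclideanSpace ℝ (Fin m)) (SrcTangent m n M N) p₀).symmL ℝ p v with ha
  have h1 : (trivializationAt (EuclideanSpace ℝ (Fin m))
      (TangentSpace (𝓡 m)) p₀.1).continuousLinearMapAt ℝ p.1 a = v :=
    Trivialization.continuousLinearMapAt_symmL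
      (trivializationAt (EuclideanSpace ℝ (Fin m)) (SrcTangent m n M N) p₀) (b := p) hx v
  rw [← h1]
  exact (Trivialization.symmL_continuousLinearMapAt
    (trivializationAt (EuclideanSpace ℝ (Fin m)) (TangentSpace (𝓡 m)) p₀.1) (b := p.1) hx a).symm

/-- The coordinate of `L` is `L` composed with a change of coordinates on each side: from the chart
of `q₀` to the preferred one on the source, in the opposite sense on the target. -/
theorem extChartAt_hom_apply (q₀ : HomBundle m n M N) {x : M} {y : N}
    (L : TangentSpace (𝓡 m) x →L[ℝ] TangentSpace (𝓡 n) y)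
    (hx : x ∈ (extChartAt (𝓡 m) q₀.1.1).source) (hy : y ∈ (extChartAt (𝓡 n) q₀.1.2).source) :
    extChartAt (homModel m n) q₀ (homPoint x y L) =
      ((extChartAt (𝓡 m) q₀.1.1 x, extChartAt (𝓡 n) q₀.1.2 y),
        ((tangentCoordChange (𝓡 n) y q₀.1.2 y).comp L).comp
          (tangentCoordChange (𝓡 m) q₀.1.1 x x)) := by
  rw [extChartAt_source] at hx hy
  rw [extChartAt_coe, Function.comp_apply, hom_chart]
  refine Prod.ext rfl ?_
  have h1 := srcTangent_symmL (n := n) (N := N) (p₀ := q₀.1) (p := (x, y)) hx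
  rw [TangentBundle.symmL_trivializationAt_eq_core hx] at h1
  have h2 := TangentBundle.continuousLinearMapAt_trivializationAt_eq_core (I := 𝓡 n) hy
  refine ContinuousLinearMap.ext fun v => ?_
  exact (congrArg (fun T : TangentSpace (𝓡 n) y →L[ℝ] EuclideanSpace ℝ (Fin n) =>
    T (L (((trivializationAt (EuclideanSpace ℝ (Fin m)) (SrcTangent m n M N) q₀.1).symmL ℝ (x, y) :
      EuclideanSpace ℝ (Fin m) →L[ℝ] TangentSpace (𝓡 m) x) v))) h2).trans
    (congrArg (fun S : EuclideanSpace ℝ (Fin m) →L[ℝ] TangentSpace (𝓡 m) x =>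
      tangentCoordChange (𝓡 n) y q₀.1.2 y (L (S v))) h1)

theorem extChartAt_hom_source (q₀ : HomBundle m n M N) :
    (extChartAt (homModel m n) q₀).source = {q | q.1.1 ∈ (extChartAt (𝓡 m) q₀.1.1).source ∧
      q.1.2 ∈ (extChartAt (𝓡 n) q₀.1.2).source} := by
  rw [extChartAt_source, FiberBundle.chartedSpace_chartAt]
  ext q
  simp only [mem_ofPred_eq, extChartAt_source, OpenPartialHomeomorph.trans_source, mem_inter_iff,
    mem_preimage, hom_trivializationAt_source]
  constructor
  · intro h
    exact h.1
  · intro h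
    refine ⟨h, ?_⟩
    rw [OpenPartialHomeomorph.prod_source, mem_prod]
    exact ⟨h, mem_univ _⟩

theorem extChartAt_hom_target (q₀ : HomBundle m n M N) : (extChartAt (homModel m n) q₀).target =
    ((extChartAt (𝓡 m) q₀.1.1).target ×ˢ (extChartAt (𝓡 n) q₀.1.2).target) ×ˢ univ := by
  rw [extChartAt_target, FiberBundle.chartedSpace_chartAt]
  ext q
  simp
  intro h1 h2
  exact ⟨(chartAt (EuclideanSpace ℝ (Fin m)) q₀.1.1).map_target h1,
    (chartAt (EuclideanSpace ℝ (Fin n)) q₀.1.2).map_target h2⟩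

theorem extChartAt_hom_symm_apply (q₀ : HomBundle m n M N) {z : EuclideanSpace ℝ (Fin m)}
    {y : EuclideanSpace ℝ (Fin n)} (L : EuclideanSpace ℝ (Fin m) →L[ℝ] EuclideanSpace ℝ (Fin n))
    (hz : z ∈ (extChartAt (𝓡 m) q₀.1.1).target) (hy : y ∈ (extChartAt (𝓡 n) q₀.1.2).target) :
    (extChartAt (homModel m n) q₀).symm ((z, y), L) =
      homPoint ((extChartAt (𝓡 m) q₀.1.1).symm z) ((extChartAt (𝓡 n) q₀.1.2).symm y)
        (((tangentCoordChange (𝓡 n) q₀.1.2 ((extChartAt (𝓡 n) q₀.1.2).symm y)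
            ((extChartAt (𝓡 n) q₀.1.2).symm y)).comp L).comp
          (tangentCoordChange (𝓡 m) ((extChartAt (𝓡 m) q₀.1.1).symm z) q₀.1.1
            ((extChartAt (𝓡 m) q₀.1.1).symm z))) := by
  have h1 := (extChartAt (𝓡 m) q₀.1.1).map_target hz
  have h2 := (extChartAt (𝓡 n) q₀.1.2).map_target hy
  refine (((extChartAt (homModel m n) q₀).eq_symm_apply ?_ ?_).2 ?_).symm
  · rw [extChartAt_hom_source]
    exact ⟨h1, h2⟩
  · rw [extChartAt_hom_target]
    exact ⟨⟨hz, hy⟩, mem_univ _⟩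
  · refine (extChartAt_hom_apply q₀ _ h1 h2).trans (Prod.ext
      (Prod.ext ((extChartAt (𝓡 m) q₀.1.1).right_inv hz) ((extChartAt (𝓡 n) q₀.1.2).right_inv hy))
      (ContinuousLinearMap.ext fun v => ?_))
    exact ((tangentCoordChange_tangentCoordChange_self h2 _).trans
      (congrArg L (tangentCoordChange_tangentCoordChange_self h1 v)))

theorem continuous_homBundle_proj : Continuous fun q : HomBundle m n M N => q.1 :=
  FiberBundle.continuous_proj _ _

/-- Points over the same base point share a chart and are separated in it; otherwise the projection
separates them. -/
instance [T2Space M] [T2Space N] : T2Space (HomBundle m n M N) := by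
  refine ⟨fun p q hpq => ?_⟩
  by_cases h : p.1 = q.1
  · have hp := mem_extChartAt_source (I := homModel m n) p
    have hq : q ∈ (extChartAt (homModel m n) p).source := by
      rw [extChartAt_hom_source, mem_ofPred_eq, ← h]
      exact ⟨mem_extChartAt_source _, mem_extChartAt_source _⟩
    obtain ⟨U, V, hU, hV, hpU, hqV, hd⟩ := t2_separation fun he =>
      hpq ((extChartAt (homModel m n) p).injOn hp hq he)
    refine ⟨_, _, (continuousOn_extChartAt p).isOpen_inter_preimage (isOpen_extChartAt_source p) hU,
      (continuousOn_extChartAt p).isOpen_inter_preimage (isOpen_extChartAt_source p) hV, ⟨hp, hpU⟩,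
      ⟨hq, hqV⟩, ?_⟩
    exact (hd.preimage _).mono inter_subset_right inter_subset_right
  · exact separated_by_continuous continuous_homBundle_proj h

instance [SecondCountableTopology M] [SecondCountableTopology N] :
    SecondCountableTopology (HomBundle m n M N) := by
  obtain ⟨S, hS, h⟩ := TopologicalSpace.countable_cover_nhds
    (f := fun p : M × N => (extChartAt (𝓡 m) p.1).source ×ˢ (extChartAt (𝓡 n) p.2).source)
    fun p => prod_mem_nhds (extChartAt_source_mem_nhds p.1) (extChartAt_source_mem_nhds p.2)
  have hinst : SecondCountableTopology (ModelProd (ModelProd (EuclideanSpace ℝ (Fin m))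
    (EuclideanSpace ℝ (Fin n))) (EuclideanSpace ℝ (Fin m) →L[ℝ] EuclideanSpace ℝ (Fin n))) :=
    inferInstanceAs (SecondCountableTopology ((EuclideanSpace ℝ (Fin m) ×
      EuclideanSpace ℝ (Fin n)) × (EuclideanSpace ℝ (Fin m) →L[ℝ] EuclideanSpace ℝ (Fin n))))
  refine ChartedSpace.secondCountable_of_countable_cover (H := ModelProd (ModelProd
    (EuclideanSpace ℝ (Fin m)) (EuclideanSpace ℝ (Fin n))) (EuclideanSpace ℝ (Fin m) →L[ℝ]
      EuclideanSpace ℝ (Fin n)))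
    (s := (fun p : M × N => (homPoint p.1 p.2 0 : HomBundle m n M N)) '' S) ?_ (hS.image _)
  refine eq_univ_of_forall fun q => ?_
  have : q.1 ∈ ⋃ p ∈ S, (extChartAt (𝓡 m) p.1).source ×ˢ (extChartAt (𝓡 n) p.2).source :=
    h ▸ mem_univ _
  obtain ⟨p, hp, hq⟩ := mem_iUnion₂.1 this
  refine mem_iUnion₂.2 ⟨_, mem_image_of_mem _ hp, ?_⟩
  rw [← extChartAt_source (homModel m n), extChartAt_hom_source]
  exact hq

end HomCharts

/-! ### Measurability of weak tangent maps -/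

section Measurability

theorem NullMeasurableSet.inter_of_restrict {α : Type*} [MeasurableSpace α] {μ : Measure α}
    {Ω s : Set α} (hΩ : MeasurableSet Ω) (hs : NullMeasurableSet s (μ.restrict Ω)) :
    NullMeasurableSet (Ω ∩ s) μ := by
  obtain ⟨t, -, ht, he⟩ := hs.exists_measurable_superset_ae_eq
  refine NullMeasurableSet.congr (hΩ.inter ht).nullMeasurableSet ?_
  have h := (ae_restrict_iff' hΩ).1 he.mem_iff
  refine eventuallyEq_set.2 (h.mono fun x hx => ?_)
  exact and_congr_right fun hxΩ => hx hxΩ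

/-- A map is measurable if, on each set of a countable cover, it is the composition of a
measurable map with a continuous one. -/
theorem nullMeasurableSet_preimage_of_cover {α X Z ι : Type*} [MeasurableSpace α] {μ : Measure α}
    [TopologicalSpace X] [TopologicalSpace Z] [TopologicalSpace.PseudoMetrizableSpace Z]
    [Countable ι] {Ω : Set α} (hΩ : MeasurableSet Ω) {g : α → X} {A : ι → Set α}
    (hA : ∀ k, NullMeasurableSet (Ω ∩ A k) μ) (hcov : ∀ z ∈ Ω, ∃ k, z ∈ A k)
    {h : ι → α → Z} (hh : ∀ k, AEStronglyMeasurable (h k) (μ.restrict Ω)) {O : ι → Set Z}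
    (hO : ∀ k, IsOpen (O k)) {Θ : ι → Z → X} (hΘ : ∀ k, ContinuousOn (Θ k) (O k))
    (heq : ∀ k, ∀ᵐ z ∂(μ.restrict Ω), z ∈ A k → h k z ∈ O k ∧ g z = Θ k (h k z))
    {U : Set X} (hU : IsOpen U) : NullMeasurableSet {z | z ∈ Ω ∧ g z ∈ U} μ := by
  borelize Z
  have h1 : NullMeasurableSet (⋃ k, (Ω ∩ A k) ∩ (Ω ∩ h k ⁻¹' (O k ∩ Θ k ⁻¹' U))) μ :=
    NullMeasurableSet.iUnion fun k => (hA k).inter (NullMeasurableSet.inter_of_restrict hΩ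
      ((hh k).aemeasurable.nullMeasurableSet_preimage
        ((hΘ k).isOpen_inter_preimage (hO k) hU).measurableSet))
  refine h1.congr (eventuallyEq_set.2 ?_)
  filter_upwards [(ae_restrict_iff' hΩ).1 (ae_all_iff.2 heq)] with z hz
  simp only [mem_iUnion, mem_inter_iff, mem_preimage]
  constructor
  · rintro ⟨k, ⟨hzΩ, hzA⟩, -, -, hzU⟩
    refine ⟨hzΩ, ?_⟩
    rwa [(hz hzΩ k hzA).2]
  · rintro ⟨hzΩ, hzU⟩
    obtain ⟨k, hk⟩ := hcov z hzΩ
    obtain ⟨h2, h3⟩ := hz hzΩ k hk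
    exact ⟨k, ⟨hzΩ, hk⟩, hzΩ, h2, by rwa [← h3]⟩

end Measurability

section Tangent

variable {F H Y : Type*} [NormedAddCommGroup F] [NormedSpace ℝ F] [FiniteDimensional ℝ F]
  [TopologicalSpace H] {I : ModelWithCorners ℝ F H} [I.Boundaryless]
  [TopologicalSpace Y] [ChartedSpace H Y] [T2Space Y] [IsManifold I 1 Y]

theorem coordEquiv_symm_coordFun {y p : Y} (hp : p ∈ coordNhd I y) :
    (coordEquiv F).symm (fun i => coordFun I y i p) = extChartAt I y p := by
  rw [ContinuousLinearEquiv.symm_apply_eq]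
  exact funext fun i => coordFun_of_mem hp i

/-- Writes the vector-valued map with prescribed coordinate forms as a finite sum, whose
measurability in a parameter follows from that of the forms. -/
theorem sum_smulRight_coordEquiv_symm {E : Type*} [NormedAddCommGroup E] [NormedSpace ℝ E]
    (g : Fin (Module.finrank ℝ F) → E →L[ℝ] ℝ) (v : E) :
    (∑ i, (g i).smulRight ((coordEquiv F).symm (Pi.single i 1))) v =
      (coordEquiv F).symm fun i => g i v := by
  rw [ContinuousLinearEquiv.eq_symm_apply, sum_apply, map_sum]
  funext j
  rw [Finset.sum_apply]
  simp only [ContinuousLinearMap.smulRight_apply, map_smul,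
    ContinuousLinearEquiv.apply_symm_apply, Pi.smul_apply, smul_eq_mul]
  rw [Finset.sum_eq_single j (fun i _ hij => by rw [Pi.single_eq_of_ne hij.symm, mul_zero])
    (by simp), Pi.single_eq_same, mul_one]

theorem tangentCoordChange_eq_of_mem_coordNhd {y p : Y} (hp : p ∈ coordNhd I y)
    (ζ : TangentSpace I p) : tangentCoordChange I p y p ζ =
      (coordEquiv F).symm fun i => mfderiv I 𝓘(ℝ, ℝ) (coordFun I y i) p ζ := by
  have h := eq_symm_coord_of_mem hp ζ
  set w : F := (coordEquiv F).symm fun i => mfderiv I 𝓘(ℝ, ℝ) (coordFun I y i) p ζ with hw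
  have h1 := (extChartAt I y).map_source hp.1
  have h2 : ζ = tangentCoordChange I y p p w := by
    refine h.trans ?_
    have := mfderiv_extChartAt_symm_eq_tangentCoordChange h1
    rw [(extChartAt I y).left_inv hp.1] at this
    exact congrArg (fun T : F →L[ℝ] F => T w) this
  rw [h2]
  exact (tangentCoordChange_comp ⟨⟨hp.1, mem_extChartAt_source p⟩, hp.1⟩).trans
    (tangentCoordChange_self hp.1)

variable {m : ℕ} {M : Type*} [TopologicalSpace M] [ChartedSpace (EuclideanSpace ℝ (Fin m)) M]
  [IsManifold (𝓡 m) 1 M] [SecondCountableTopology Y]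

/-- The components of a weak tangent map in local charts are measurable. -/
theorem IsWeakTangentMap.aestronglyMeasurable_coord {u : M → Y}
    (hu : ColocallyWeaklyDifferentiable m I u)
    {Du : ∀ x : M, TangentSpace (𝓡 m) x →L[ℝ] TangentSpace I (u x)} (hDu : IsWeakTangentMap I u Du)
    (x₀ : M) (y : Y) :
    AEStronglyMeasurable (fun z => (coordEquiv F).symm
        fun i => coordFun I y i (u ((extChartAt (𝓡 m) x₀).symm z)))
      (volume.restrict (extChartAt (𝓡 m) x₀).target) ∧
    ∃ T : EuclideanSpace ℝ (Fin m) → EuclideanSpace ℝ (Fin m) →L[ℝ] F,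
      AEStronglyMeasurable T (volume.restrict (extChartAt (𝓡 m) x₀).target) ∧
      ∀ᵐ z ∂(volume.restrict (extChartAt (𝓡 m) x₀).target),
        u ((extChartAt (𝓡 m) x₀).symm z) ∈ coordNhd I y → ∀ v,
          T z v = tangentCoordChange I (u ((extChartAt (𝓡 m) x₀).symm z)) y
            (u ((extChartAt (𝓡 m) x₀).symm z)) (Du ((extChartAt (𝓡 m) x₀).symm z)
              (mfderiv 𝓘(ℝ, EuclideanSpace ℝ (Fin m)) (𝓡 m) (extChartAt (𝓡 m) x₀).symm z v)) := by
  choose G hG using fun i : Fin (Module.finrank ℝ F) =>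
    hu.2 (coordFun I y i) (contMDiff_coordFun (by simp) y i) (hasCompactSupport_coordFun y i)
  refine ⟨?_, fun z => ∑ i, ((G i ((extChartAt (𝓡 m) x₀).symm z)).comp
      (mfderiv 𝓘(ℝ, EuclideanSpace ℝ (Fin m)) (𝓡 m) (extChartAt (𝓡 m) x₀).symm z)).smulRight
        ((coordEquiv F).symm (Pi.single i 1)), ?_, ?_⟩
  · refine (coordEquiv F).symm.continuous.comp_aestronglyMeasurable ?_
    exact (aemeasurable_pi_lambda _ fun i =>
      (hG i x₀).aestronglyMeasurable.1.aemeasurable).aestronglyMeasurable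
  · refine Finset.aestronglyMeasurable_fun_sum _ fun i _ => ?_
    exact ((ContinuousLinearMap.smulRightL ℝ (EuclideanSpace ℝ (Fin m)) F).flip
      ((coordEquiv F).symm (Pi.single i 1))).continuous.comp_aestronglyMeasurable
        (hG i x₀).aestronglyMeasurable.2
  · have hae := ae_all_iff.2 fun i => eventually_manifoldAE.1
      (hDu (coordFun I y i) (contMDiff_coordFun (by simp) y i) (G i) (hG i)) x₀
    filter_upwards [hae] with z hz hzy v
    rw [tangentCoordChange_eq_of_mem_coordNhd hzy]
    refine (sum_smulRight_coordEquiv_symm (E := EuclideanSpace ℝ (Fin m)) _ v).trans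
      (congrArg (coordEquiv F).symm (funext fun i => ?_))
    exact congrArg (fun T : TangentSpace (𝓡 m) ((extChartAt (𝓡 m) x₀).symm z) →L[ℝ] ℝ =>
      T (mfderiv 𝓘(ℝ, EuclideanSpace ℝ (Fin m)) (𝓡 m) (extChartAt (𝓡 m) x₀).symm z v)) (hz i)

/-- Over each set of a countable cover, the tangent vector is almost everywhere the image of
measurable coordinates under an inverse chart of the tangent bundle, continuous on its open target.
-/
theorem IsWeakTangentMap.nullMeasurableSet_tangent {u : M → Y}
    (hu : ColocallyWeaklyDifferentiable m I u)
    {Du : ∀ x : M, TangentSpace (𝓡 m) x →L[ℝ] TangentSpace I (u x)} (hDu : IsWeakTangentMap I u Du)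
    (x₀ : M) (v : EuclideanSpace ℝ (Fin m)) {U : Set (TangentBundle I Y)} (hU : IsOpen U) :
    NullMeasurableSet {z | z ∈ (extChartAt (𝓡 m) x₀).target ∧
      (⟨u ((extChartAt (𝓡 m) x₀).symm z), Du ((extChartAt (𝓡 m) x₀).symm z)
        (mfderiv 𝓘(ℝ, EuclideanSpace ℝ (Fin m)) (𝓡 m) (extChartAt (𝓡 m) x₀).symm z v)⟩ :
          TangentBundle I Y) ∈ U} volume := by
  obtain ⟨S, hS, hcov⟩ := exists_countable_coordNhd_cover I Y
  have hinst : Countable S := hS.to_subtype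
  choose ha T hT hTeq using fun y : S => hDu.aestronglyMeasurable_coord hu x₀ (y : Y)
  refine nullMeasurableSet_preimage_of_cover (isOpen_extChartAt_target x₀).measurableSet
    (A := fun y : S => {z | u ((extChartAt (𝓡 m) x₀).symm z) ∈ coordNhd I (y : Y)})
    (fun y => hu.1 x₀ _ (isOpen_coordNhd I _))
    (fun z _ => let ⟨y, hy, h⟩ := hcov (u ((extChartAt (𝓡 m) x₀).symm z)); ⟨⟨y, hy⟩, h⟩)
    (h := fun y z => ((coordEquiv F).symm
        fun i => coordFun I (y : Y) i (u ((extChartAt (𝓡 m) x₀).symm z)), T y z v))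
    (fun y => (ha y).prodMk ((ContinuousLinearMap.apply ℝ F v).continuous.comp_aestronglyMeasurable
      (hT y)))
    (O := fun y => (extChartAt I.tangent (⟨(y : Y), 0⟩ : TangentBundle I Y)).target)
    (fun y => isOpen_extChartAt_target _)
    (Θ := fun y => (extChartAt I.tangent (⟨(y : Y), 0⟩ : TangentBundle I Y)).symm)
    (fun y => continuousOn_extChartAt_symm _) (fun y => ?_) hU
  filter_upwards [hTeq y] with z hz hzy
  have hs : (⟨u ((extChartAt (𝓡 m) x₀).symm z), Du ((extChartAt (𝓡 m) x₀).symm z)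
      (mfderiv 𝓘(ℝ, EuclideanSpace ℝ (Fin m)) (𝓡 m) (extChartAt (𝓡 m) x₀).symm z v)⟩ :
        TangentBundle I Y) ∈ (extChartAt I.tangent (⟨(y : Y), 0⟩ : TangentBundle I Y)).source := by
    rw [extChartAt_tangentBundle_source]
    exact hzy.1
  have he := extChartAt_tangentBundle_apply (I := I) (⟨(y : Y), 0⟩ : TangentBundle I Y)
    ⟨u ((extChartAt (𝓡 m) x₀).symm z), Du ((extChartAt (𝓡 m) x₀).symm z)
      (mfderiv 𝓘(ℝ, EuclideanSpace ℝ (Fin m)) (𝓡 m) (extChartAt (𝓡 m) x₀).symm z v)⟩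
  simp only at he
  rw [← hz hzy v, ← coordEquiv_symm_coordFun hzy] at he
  rw [← he]
  exact ⟨PartialEquiv.map_source _ hs, (PartialEquiv.left_inv _ hs).symm⟩

end Tangent

/-! ### Existence of the colocal weak derivative -/

section ColocalDerivative

variable {m n : ℕ}
  {M : Type*} [TopologicalSpace M] [ChartedSpace (EuclideanSpace ℝ (Fin m)) M]
  [IsManifold (𝓡 m) 2 M]
  {N : Type*} [TopologicalSpace N] [ChartedSpace (EuclideanSpace ℝ (Fin n)) N]
  [IsManifold (𝓡 n) 2 N] [T2Space N] [SecondCountableTopology N]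

theorem extChartAt_homPoint_eq (x₀ : M) (y : N) {z : EuclideanSpace ℝ (Fin m)}
    (hz : z ∈ (extChartAt (𝓡 m) x₀).target) {p : N} (hp : p ∈ coordNhd (𝓡 n) y)
    (L : TangentSpace (𝓡 m) ((extChartAt (𝓡 m) x₀).symm z) →L[ℝ] TangentSpace (𝓡 n) p)
    (T : EuclideanSpace ℝ (Fin m) →L[ℝ] EuclideanSpace ℝ (Fin n))
    (hT : ∀ v, T v = tangentCoordChange (𝓡 n) p y p (L
      (mfderiv 𝓘(ℝ, EuclideanSpace ℝ (Fin m)) (𝓡 m) (extChartAt (𝓡 m) x₀).symm z v))) :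
    extChartAt (homModel m n) (homPoint x₀ y 0 : HomBundle m n M N)
      (homPoint ((extChartAt (𝓡 m) x₀).symm z) p L) =
        ((z, (coordEquiv (EuclideanSpace ℝ (Fin n))).symm fun i => coordFun (𝓡 n) y i p), T) := by
  rw [coordEquiv_symm_coordFun hp]
  have h := extChartAt_hom_apply (homPoint x₀ y 0 : HomBundle m n M N) L
    ((extChartAt (𝓡 m) x₀).map_target hz) hp.1
  refine h.trans ?_
  have h2 : (((tangentCoordChange (𝓡 n) p y p).comp L).comp
      (tangentCoordChange (𝓡 m) x₀ ((extChartAt (𝓡 m) x₀).symm z)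
        ((extChartAt (𝓡 m) x₀).symm z))) = T := by
    refine ContinuousLinearMap.ext fun v => ?_
    rw [hT v, mfderiv_extChartAt_symm_eq_tangentCoordChange hz]
    rfl
  have h3 := (extChartAt (𝓡 m) x₀).right_inv hz
  exact Prod.ext (Prod.ext h3 rfl) h2

/-- A weak tangent map identifies weak derivatives but does not produce them: their existence for
compactly supported `f` comes from `hu`, and changing them on a null set gives the required form. -/
theorem IsWeakTangentMap.isColocalWeakDeriv {u : M → N}
    (hu : ColocallyWeaklyDifferentiable m (𝓡 n) u)
    {Du : ∀ x : M, TangentSpace (𝓡 m) x →L[ℝ] TangentSpace (𝓡 n) (u x)}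
    (hDu : IsWeakTangentMap (𝓡 n) u Du) : IsColocalWeakDeriv u Du := by
  refine ⟨fun x₀ U hU => ?_, fun f hf hc x₀ => ?_⟩
  · obtain ⟨S, hS, hcov⟩ := exists_countable_coordNhd_cover (𝓡 n) N
    have hinst : Countable S := hS.to_subtype
    choose ha T hT hTeq using fun y : S => hDu.aestronglyMeasurable_coord hu x₀ (y : N)
    refine nullMeasurableSet_preimage_of_cover (isOpen_extChartAt_target x₀).measurableSet
      (A := fun y : S => {z | u ((extChartAt (𝓡 m) x₀).symm z) ∈ coordNhd (𝓡 n) (y : N)})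
      (fun y => hu.1 x₀ _ (isOpen_coordNhd (𝓡 n) _))
      (fun z _ => let ⟨y, hy, h⟩ := hcov (u ((extChartAt (𝓡 m) x₀).symm z)); ⟨⟨y, hy⟩, h⟩)
      (h := fun y z => ((z, (coordEquiv (EuclideanSpace ℝ (Fin n))).symm
          fun i => coordFun (𝓡 n) (y : N) i (u ((extChartAt (𝓡 m) x₀).symm z))), T y z))
      (fun y => (aestronglyMeasurable_id.prodMk (ha y)).prodMk (hT y))
      (O := fun y => (extChartAt (homModel m n)
        (homPoint x₀ (y : N) 0 : HomBundle m n M N)).target)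
      (fun y => isOpen_extChartAt_target _)
      (Θ := fun y => (extChartAt (homModel m n)
        (homPoint x₀ (y : N) 0 : HomBundle m n M N)).symm)
      (fun y => continuousOn_extChartAt_symm _) (fun y => ?_) hU
    filter_upwards [hTeq y, ae_restrict_mem (isOpen_extChartAt_target x₀).measurableSet]
      with z hz hzt hzy
    set x := (extChartAt (𝓡 m) x₀).symm z with hx
    have hxs : x ∈ (extChartAt (𝓡 m) x₀).source := (extChartAt (𝓡 m) x₀).map_target hzt
    have hs : homPoint x (u x) (Du x) ∈ (extChartAt (homModel m n)
        (homPoint x₀ (y : N) 0 : HomBundle m n M N)).source := by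
      rw [extChartAt_hom_source]
      exact ⟨hxs, hzy.1⟩
    have he : extChartAt (homModel m n) (homPoint x₀ (y : N) 0 : HomBundle m n M N)
        (homPoint x (u x) (Du x)) = ((z, (coordEquiv (EuclideanSpace ℝ (Fin n))).symm
          fun i => coordFun (𝓡 n) (y : N) i (u x)), T y z) := by
      exact extChartAt_homPoint_eq x₀ (y : N) hzt hzy (Du x) (T y z) (hz hzy)
    rw [← he]
    exact ⟨PartialEquiv.map_source _ hs, (PartialEquiv.left_inv _ hs).symm⟩
  · obtain ⟨G, hG⟩ := hu.2 f hf hc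
    refine (hG x₀).congr_ae (isOpen_extChartAt_target x₀) ?_
    filter_upwards [eventually_manifoldAE.1 (hDu f hf G hG) x₀] with z hz
    rw [hz]

theorem exists_isColocalWeakDeriv {u : M → N} (hu : ColocallyWeaklyDifferentiable m (𝓡 n) u) :
    ∃ Du : ∀ x : M, TangentSpace (𝓡 m) x →L[ℝ] TangentSpace (𝓡 n) (u x),
      IsColocalWeakDeriv u Du :=
  let ⟨Du, hDu⟩ := hu.exists_isWeakTangentMap
  ⟨Du, hDu.isColocalWeakDeriv hu⟩

end ColocalDerivative

/-! ### Second-order charts, the projection and the vertical lift -/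

section ChartDerivatives

variable {F H X F' H' Y : Type*} [NormedAddCommGroup F] [NormedSpace ℝ F]
  [TopologicalSpace H] {I : ModelWithCorners ℝ F H} [I.Boundaryless]
  [TopologicalSpace X] [ChartedSpace H X]
  [NormedAddCommGroup F'] [NormedSpace ℝ F']
  [TopologicalSpace H'] {I' : ModelWithCorners ℝ F' H'}
  [TopologicalSpace Y] [ChartedSpace H' Y]

theorem mfderiv_apply_eq_of_eventuallyEq {f : X → Y} {x : X} (hf : MDifferentiableAt I I' f x)
    {Ψ : F → F'} (h : writtenInExtChartAt I I' x f =ᶠ[𝓝 (extChartAt I x x)] Ψ) (v : F) :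
    (mfderiv I I' f x v : F') = fderiv ℝ Ψ (extChartAt I x x) v := by
  rw [hf.mfderiv, I.range_eq_univ, fderivWithin_univ, h.fderiv_eq]
  rfl

end ChartDerivatives

section SecondOrderCharts

variable {m : ℕ}
  {M : Type*} [TopologicalSpace M] [ChartedSpace (EuclideanSpace ℝ (Fin m)) M]
  [IsManifold (𝓡 m) 2 M]

/-- The change of coordinates between the charts around `x₀` and `x`. -/
def chartChange (x₀ x : M) : EuclideanSpace ℝ (Fin m) → EuclideanSpace ℝ (Fin m) :=
  extChartAt (𝓡 m) x ∘ (extChartAt (𝓡 m) x₀).symm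

theorem contDiffAt_chartChange {x₀ x : M} {z : EuclideanSpace ℝ (Fin m)}
    (hz : z ∈ (extChartAt (𝓡 m) x₀).target)
    (hx : (extChartAt (𝓡 m) x₀).symm z ∈ (extChartAt (𝓡 m) x).source) :
    ContDiffAt ℝ 2 (chartChange x₀ x) z := by
  have h := contDiffWithinAt_ext_coord_change (I := 𝓡 m) (n := 2) x x₀ (y := z)
    (by rw [PartialEquiv.trans_source, PartialEquiv.symm_source]; exact ⟨hz, hx⟩)
  rwa [ModelWithCorners.range_eq_univ, contDiffWithinAt_univ] at h

theorem contDiffAt_fderiv_chartChange {x₀ x : M} {z : EuclideanSpace ℝ (Fin m)}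
    (hz : z ∈ (extChartAt (𝓡 m) x₀).target)
    (hx : (extChartAt (𝓡 m) x₀).symm z ∈ (extChartAt (𝓡 m) x).source) :
    ContDiffAt ℝ 1 (fderiv ℝ (chartChange x₀ x)) z :=
  (contDiffAt_chartChange hz hx).fderiv_right (m := 1) (by rw [one_add_one_eq_two])

theorem tangentCoordChange_eq_fderiv_chartChange (x₀ x z : M) : tangentCoordChange (𝓡 m) x₀ x z =
    fderiv ℝ (chartChange x₀ x) (extChartAt (𝓡 m) x₀ z) :=
  tangentCoordChange_eq_fderiv x₀ x z

theorem eventually_symm_mem_source {x₀ x : M} {z : EuclideanSpace ℝ (Fin m)}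
    (hz : z ∈ (extChartAt (𝓡 m) x₀).target)
    (hx : (extChartAt (𝓡 m) x₀).symm z ∈ (extChartAt (𝓡 m) x).source) :
    ∀ᶠ w in 𝓝 z, w ∈ (extChartAt (𝓡 m) x₀).target ∧
      (extChartAt (𝓡 m) x₀).symm w ∈ (extChartAt (𝓡 m) x).source := by
  have h1 := (isOpen_extChartAt_target (I := 𝓡 m) x₀).mem_nhds hz
  exact inter_mem h1 (((continuousOn_extChartAt_symm x₀).continuousAt h1).preimage_mem_nhds
    ((isOpen_extChartAt_source x).mem_nhds hx))

theorem hasFDerivAt_tangent_chartChange {x₀ x : M} {z : EuclideanSpace ℝ (Fin m)}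
    (hz : z ∈ (extChartAt (𝓡 m) x₀).target)
    (hx : (extChartAt (𝓡 m) x₀).symm z ∈ (extChartAt (𝓡 m) x).source)
    (e μ ν : EuclideanSpace ℝ (Fin m)) :
    fderiv ℝ (fun p : EuclideanSpace ℝ (Fin m) × EuclideanSpace ℝ (Fin m) =>
      (chartChange x₀ x p.1, fderiv ℝ (chartChange x₀ x) p.1 p.2)) (z, e) (μ, ν) =
      (fderiv ℝ (chartChange x₀ x) z μ, fderiv ℝ (fderiv ℝ (chartChange x₀ x)) z μ e +
        fderiv ℝ (chartChange x₀ x) z ν) := by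
  have h1 := ((contDiffAt_chartChange hz hx).differentiableAt two_ne_zero).hasFDerivAt
  have h2 := ((contDiffAt_fderiv_chartChange hz hx).differentiableAt one_ne_zero).hasFDerivAt
  have h3 := (h1.comp (z, e) (hasFDerivAt_fst (𝕜 := ℝ) (p := (z, e)))).prodMk
    ((h2.comp (z, e) (hasFDerivAt_fst (𝕜 := ℝ) (p := (z, e)))).clm_apply
      (hasFDerivAt_snd (𝕜 := ℝ) (p := (z, e))))
  have h4 := h3.fderiv
  refine (congrArg (fun T : EuclideanSpace ℝ (Fin m) × EuclideanSpace ℝ (Fin m) →L[ℝ]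
    EuclideanSpace ℝ (Fin m) × EuclideanSpace ℝ (Fin m) => T (μ, ν)) h4).trans ?_
  simp [add_comm]

/-- A vector given by components in the chart around `x₀` acquires, in the preferred chart of its
base point, a second derivative of the transition map in its vertical component. The formula is
needed because `SecondMeasurable` tests with constant components in the chart around `x₀`. -/
theorem extChartAt_second_symm_apply (x₀ : M) {z : EuclideanSpace ℝ (Fin m)}
    (hz : z ∈ (extChartAt (𝓡 m) x₀).target) (e μ ν : EuclideanSpace ℝ (Fin m)) :
    (extChartAt (𝓡 m).tangent.tangent (⟨⟨x₀, 0⟩, 0⟩ : SecondTangent m M)).symm ((z, e), (μ, ν)) =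
      ⟨⟨(extChartAt (𝓡 m) x₀).symm z,
          fderiv ℝ (chartChange x₀ ((extChartAt (𝓡 m) x₀).symm z)) z e⟩,
        secondVec ⟨(extChartAt (𝓡 m) x₀).symm z, _⟩
          (fderiv ℝ (chartChange x₀ ((extChartAt (𝓡 m) x₀).symm z)) z μ)
          (fderiv ℝ (fderiv ℝ (chartChange x₀ ((extChartAt (𝓡 m) x₀).symm z))) z μ e +
            fderiv ℝ (chartChange x₀ ((extChartAt (𝓡 m) x₀).symm z)) z ν)⟩ := by
  set x := (extChartAt (𝓡 m) x₀).symm z with hx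
  have hxs : x ∈ (extChartAt (𝓡 m) x₀).source := (extChartAt (𝓡 m) x₀).map_target hz
  have hrz : extChartAt (𝓡 m) x₀ x = z := (extChartAt (𝓡 m) x₀).right_inv hz
  set p₀ : TangentBundle (𝓡 m) M := ⟨x₀, 0⟩ with hp₀
  have hzt : (z, e) ∈ (extChartAt (𝓡 m).tangent p₀).target := by
    rw [extChartAt_tangentBundle_target]
    exact ⟨hz, mem_univ _⟩
  rw [extChartAt_tangentBundle_symm_apply (I := (𝓡 m).tangent)
    (⟨p₀, 0⟩ : SecondTangent m M) (μ, ν) hzt]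
  have hP : (extChartAt (𝓡 m).tangent p₀).symm (z, e) =
      ⟨x, fderiv ℝ (chartChange x₀ x) z e⟩ := by
    rw [extChartAt_tangentBundle_symm_apply p₀ e hz]
    simp only [hp₀]
    rw [← hx, tangentCoordChange_eq_fderiv_chartChange, hrz]
  simp only
  rw [hP]
  set P : TangentBundle (𝓡 m) M := ⟨x, fderiv ℝ (chartChange x₀ x) z e⟩ with hPdef
  congr 1
  rw [tangentCoordChange_eq_fderiv, ← hP, (extChartAt (𝓡 m).tangent p₀).right_inv hzt, hP]
  have hev : (extChartAt (𝓡 m).tangent P ∘ (extChartAt (𝓡 m).tangent p₀).symm) =ᶠ[𝓝 (z, e)]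
      fun p => (chartChange x₀ x p.1, fderiv ℝ (chartChange x₀ x) p.1 p.2) := by
    have h1 := eventually_symm_mem_source (x := x) hz (mem_extChartAt_source x)
    filter_upwards [(continuous_fst.tendsto (z, e)).eventually h1] with p hp
    obtain ⟨h2, h3⟩ := hp
    rw [Function.comp_apply, ← Prod.mk.eta (p := p),
      extChartAt_tangentBundle_symm_apply p₀ p.2 h2, extChartAt_tangentBundle_apply]
    simp only [hp₀, hPdef]
    rw [tangentCoordChange_comp ⟨⟨(extChartAt (𝓡 m) x₀).map_target h2,
      mem_extChartAt_source _⟩, h3⟩, tangentCoordChange_eq_fderiv_chartChange,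
      (extChartAt (𝓡 m) x₀).right_inv h2]
    rfl
  rw [hev.fderiv_eq]
  exact hasFDerivAt_tangent_chartChange hz (mem_extChartAt_source x) e μ ν

theorem tangentProj_eq (p : TangentBundle (𝓡 m) M) (ζ : TangentSpace (𝓡 m).tangent p) :
    tangentProj p ζ = secondHor ζ := by
  have hd : MDifferentiableAt (𝓡 m).tangent (𝓡 m) (fun q : TangentBundle (𝓡 m) M => q.proj) p :=
    (contMDiff_proj (TangentSpace (𝓡 m) : M → Type) (n := 1) p).mdifferentiableAt one_ne_zero
  refine (mfderiv_apply_eq_of_eventuallyEq (Ψ := Prod.fst) hd ?_ ζ).trans ?_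
  · filter_upwards [(isOpen_extChartAt_target p).mem_nhds (mem_extChartAt_target p)] with w hw
    rw [extChartAt_tangentBundle_target] at hw
    rw [writtenInExtChartAt, Function.comp_apply, Function.comp_apply, ← Prod.mk.eta (p := w),
      extChartAt_tangentBundle_symm_apply p w.2 hw.1]
    exact (extChartAt (𝓡 m) p.1).right_inv hw.1
  · rw [fderiv_fst]
    rfl

theorem vertLift_eq (x : M) (e ν : TangentSpace (𝓡 m) x) :
    vertLift x e ν = secondVec ⟨x, e⟩ 0 ν := by
  have heq : (fun w : EuclideanSpace ℝ (Fin m) => (⟨x, w⟩ : TangentBundle (𝓡 m) M)) =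
      fun w => (extChartAt (𝓡 m).tangent (⟨x, e⟩ : TangentBundle (𝓡 m) M)).symm
        (extChartAt (𝓡 m) x x, w) := by
    funext w
    have h := extChartAt_tangentBundle_symm_apply (⟨x, e⟩ : TangentBundle (𝓡 m) M) w
      (mem_extChartAt_target (I := 𝓡 m) x)
    simp only at h
    rw [h, (extChartAt (𝓡 m) x).left_inv (mem_extChartAt_source x),
      tangentCoordChange_self (mem_extChartAt_source x)]
  have hmem : ∀ w : EuclideanSpace ℝ (Fin m), (extChartAt (𝓡 m) x x, w) ∈
      (extChartAt (𝓡 m).tangent (⟨x, e⟩ : TangentBundle (𝓡 m) M)).target := fun w => by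
    rw [extChartAt_tangentBundle_target (⟨x, e⟩ : TangentBundle (𝓡 m) M)]
    exact mk_mem_prod (mem_extChartAt_target (I := 𝓡 m) x) (mem_univ _)
  have hd : MDifferentiableAt 𝓘(ℝ, EuclideanSpace ℝ (Fin m)) (𝓡 m).tangent
      (fun w : EuclideanSpace ℝ (Fin m) => (⟨x, w⟩ : TangentBundle (𝓡 m) M)) e := by
    have h1 := contMDiffAt_extChartAt_symm (I := (𝓡 m).tangent) (r := 1) (hmem e)
    have h2 : ContMDiffAt 𝓘(ℝ, EuclideanSpace ℝ (Fin m))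
        𝓘(ℝ, EuclideanSpace ℝ (Fin m) × EuclideanSpace ℝ (Fin m)) 1
        (fun w : EuclideanSpace ℝ (Fin m) => (extChartAt (𝓡 m) x x, w)) e :=
      (contDiff_const.prodMk contDiff_id).contMDiff.contMDiffAt
    have h3 := (ContMDiffAt.comp (f := fun w : EuclideanSpace ℝ (Fin m) =>
      (extChartAt (𝓡 m) x x, w)) e h1 h2).mdifferentiableAt one_ne_zero
    rw [heq]
    exact h3
  refine (mfderiv_apply_eq_of_eventuallyEq
    (Ψ := fun w : EuclideanSpace ℝ (Fin m) => (extChartAt (𝓡 m) x x, w)) hd ?_ ν).trans ?_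
  · refine Eventually.of_forall fun w => ?_
    exact (congrArg (extChartAt (𝓡 m).tangent (⟨x, e⟩ : TangentBundle (𝓡 m) M))
      (congrFun heq w)).trans
        ((extChartAt (𝓡 m).tangent (⟨x, e⟩ : TangentBundle (𝓡 m) M)).right_inv (hmem w))
  · have h : ∀ w : EuclideanSpace ℝ (Fin m),
        fderiv ℝ (fun w : EuclideanSpace ℝ (Fin m) => (extChartAt (𝓡 m) x x, w)) w =
          (0 : EuclideanSpace ℝ (Fin m) →L[ℝ] EuclideanSpace ℝ (Fin m)).prod
            (ContinuousLinearMap.id ℝ (EuclideanSpace ℝ (Fin m))) := fun w =>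
      ((hasFDerivAt_const _ w).prodMk (hasFDerivAt_id w)).fderiv
    exact congrArg (fun T : EuclideanSpace ℝ (Fin m) →L[ℝ]
      EuclideanSpace ℝ (Fin m) × EuclideanSpace ℝ (Fin m) => T ν) (h e)

end SecondOrderCharts

/-! ### Evaluation on constant vectors and the double morphism of a tangent map -/

section HomEval

variable {m n : ℕ}
  {M : Type*} [TopologicalSpace M] [ChartedSpace (EuclideanSpace ℝ (Fin m)) M]
  [IsManifold (𝓡 m) 2 M]
  {N : Type*} [TopologicalSpace N] [ChartedSpace (EuclideanSpace ℝ (Fin n)) N]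
  [IsManifold (𝓡 n) 2 N]

/-- The evaluation of the elements of `T*M ⊗ TN` on the tangent vectors with components `e` in the
chart around `x₀`. -/
def homEval (x₀ : M) (p : HomBundle m n M N × EuclideanSpace ℝ (Fin m)) : TangentBundle (𝓡 n) N :=
  ⟨p.1.1.2, p.1.2 (tangentCoordChange (𝓡 m) x₀ p.1.1.1 p.1.1.1 p.2)⟩

/-- The expression of `homEval x₀` in the charts around a point over `x`. -/
def homEvalChart (n : ℕ) (x₀ x : M)
    (P : ((EuclideanSpace ℝ (Fin m) × EuclideanSpace ℝ (Fin n)) ×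
      (EuclideanSpace ℝ (Fin m) →L[ℝ] EuclideanSpace ℝ (Fin n))) × EuclideanSpace ℝ (Fin m)) :
    EuclideanSpace ℝ (Fin n) × EuclideanSpace ℝ (Fin n) :=
  (P.1.1.2, P.1.2 (fderiv ℝ (chartChange x₀ x) (chartChange x x₀ P.1.1.1) P.2))

theorem extChartAt_homEval {x₀ : M} (q : HomBundle m n M N) {p : HomBundle m n M N}
    (hp : p ∈ (extChartAt (homModel m n) q).source) (hp₀ : p.1.1 ∈ (extChartAt (𝓡 m) x₀).source)
    (w : TangentSpace (𝓡 n) q.1.2) (e : EuclideanSpace ℝ (Fin m)) :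
    extChartAt (𝓡 n).tangent (⟨q.1.2, w⟩ : TangentBundle (𝓡 n) N) (homEval x₀ (p, e)) =
      homEvalChart n x₀ q.1.1 (extChartAt (homModel m n) q p, e) := by
  obtain ⟨⟨x, y⟩, L⟩ := p
  rw [extChartAt_hom_source] at hp
  obtain ⟨hx, hy⟩ := hp
  simp only at hx hy hp₀
  have h : extChartAt (homModel m n) q ⟨(x, y), L⟩ = _ := extChartAt_hom_apply q L hx hy
  rw [h, extChartAt_tangentBundle_apply, homEvalChart, homEval]
  have h2 : tangentCoordChange (𝓡 m) q.1.1 x x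
      (fderiv ℝ (chartChange x₀ q.1.1) (chartChange q.1.1 x₀ (extChartAt (𝓡 m) q.1.1 x)) e) =
        tangentCoordChange (𝓡 m) x₀ x x e := by
    have h3 : chartChange q.1.1 x₀ (extChartAt (𝓡 m) q.1.1 x) = extChartAt (𝓡 m) x₀ x := by
      rw [chartChange, Function.comp_apply, (extChartAt (𝓡 m) q.1.1).left_inv hx]
    rw [h3, ← tangentCoordChange_eq_fderiv_chartChange]
    exact tangentCoordChange_comp ⟨⟨hp₀, hx⟩, mem_extChartAt_source x⟩
  exact Prod.ext rfl (congrArg (fun v => tangentCoordChange (𝓡 n) y q.1.2 y (L v)) h2.symm)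

/-- Transition maps are `C²`, so their differentials are `C¹`. The vector on which the homomorphism
is evaluated varies with the base point in the preferred chart, whence the second-derivative term.
-/
theorem hasFDerivAt_homEvalChart {x₀ x : M} (hx : x ∈ (extChartAt (𝓡 m) x₀).source)
    (y : EuclideanSpace ℝ (Fin n)) (L : EuclideanSpace ℝ (Fin m) →L[ℝ] EuclideanSpace ℝ (Fin n))
    (e : EuclideanSpace ℝ (Fin m)) :
    ContDiffAt ℝ 1 (homEvalChart n x₀ x) (((extChartAt (𝓡 m) x x, y), L), e) ∧
    ∀ (μ : EuclideanSpace ℝ (Fin m)) (l : EuclideanSpace ℝ (Fin n))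
      (A : EuclideanSpace ℝ (Fin m) →L[ℝ] EuclideanSpace ℝ (Fin n)) (ν : EuclideanSpace ℝ (Fin m)),
      fderiv ℝ (homEvalChart n x₀ x) (((extChartAt (𝓡 m) x x, y), L), e) (((μ, l), A), ν) =
        (l, A (tangentCoordChange (𝓡 m) x₀ x x e) +
          L (fderiv ℝ (fderiv ℝ (chartChange x₀ x)) (extChartAt (𝓡 m) x₀ x)
            (tangentCoordChange (𝓡 m) x x₀ x μ) e + tangentCoordChange (𝓡 m) x₀ x x ν)) := by
  have hχ : chartChange x x₀ (extChartAt (𝓡 m) x x) = extChartAt (𝓡 m) x₀ x := by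
    rw [chartChange, Function.comp_apply, extChartAt_to_inv]
  have hz : extChartAt (𝓡 m) x₀ x ∈ (extChartAt (𝓡 m) x₀).target :=
    (extChartAt (𝓡 m) x₀).map_source hx
  have hxx : (extChartAt (𝓡 m) x₀).symm (extChartAt (𝓡 m) x₀ x) ∈ (extChartAt (𝓡 m) x).source := by
    rw [(extChartAt (𝓡 m) x₀).left_inv hx]
    exact mem_extChartAt_source x
  have c1 : ContDiffAt ℝ 1 (chartChange x x₀) (extChartAt (𝓡 m) x x) :=
    (contDiffAt_chartChange (mem_extChartAt_target x)
      (by rw [extChartAt_to_inv]; exact hx)).of_le one_le_two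
  have c2 : ContDiffAt ℝ 1 (fderiv ℝ (chartChange x₀ x))
      (chartChange x x₀ (extChartAt (𝓡 m) x x)) := by
    rw [hχ]
    exact contDiffAt_fderiv_chartChange hz hxx
  set P₀ : ((EuclideanSpace ℝ (Fin m) × EuclideanSpace ℝ (Fin n)) ×
      (EuclideanSpace ℝ (Fin m) →L[ℝ] EuclideanSpace ℝ (Fin n))) × EuclideanSpace ℝ (Fin m) :=
    (((extChartAt (𝓡 m) x x, y), L), e) with hP₀
  constructor
  · have c3 : ContDiffAt ℝ 1 (fun P : ((EuclideanSpace ℝ (Fin m) × EuclideanSpace ℝ (Fin n)) ×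
      (EuclideanSpace ℝ (Fin m) →L[ℝ] EuclideanSpace ℝ (Fin n))) × EuclideanSpace ℝ (Fin m) =>
        fderiv ℝ (chartChange x₀ x) (chartChange x x₀ P.1.1.1)) P₀ :=
      ContDiffAt.comp (f := fun P : ((EuclideanSpace ℝ (Fin m) × EuclideanSpace ℝ (Fin n)) ×
        (EuclideanSpace ℝ (Fin m) →L[ℝ] EuclideanSpace ℝ (Fin n))) × EuclideanSpace ℝ (Fin m) =>
        P.1.1.1) P₀ (c2.comp (extChartAt (𝓡 m) x x) c1) (by fun_prop)
    unfold homEvalChart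
    fun_prop
  · intro μ l A ν
    have d1 := (c1.differentiableAt one_ne_zero).hasFDerivAt
    have d2 := (c2.differentiableAt one_ne_zero).hasFDerivAt
    have f1 : HasFDerivAt (fun P : ((EuclideanSpace ℝ (Fin m) × EuclideanSpace ℝ (Fin n)) ×
      (EuclideanSpace ℝ (Fin m) →L[ℝ] EuclideanSpace ℝ (Fin n))) × EuclideanSpace ℝ (Fin m) => P.1)
        (ContinuousLinearMap.fst ℝ _ _) P₀ := hasFDerivAt_fst
    have f11 := (hasFDerivAt_fst (𝕜 := ℝ) (p := P₀.1)).comp P₀ f1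
    have f12 := (hasFDerivAt_snd (𝕜 := ℝ) (p := P₀.1)).comp P₀ f1
    have f111 := (hasFDerivAt_fst (𝕜 := ℝ) (p := P₀.1.1)).comp P₀ f11
    have f112 := (hasFDerivAt_snd (𝕜 := ℝ) (p := P₀.1.1)).comp P₀ f11
    have f2 : HasFDerivAt (fun P : ((EuclideanSpace ℝ (Fin m) × EuclideanSpace ℝ (Fin n)) ×
      (EuclideanSpace ℝ (Fin m) →L[ℝ] EuclideanSpace ℝ (Fin n))) × EuclideanSpace ℝ (Fin m) => P.2)
        (ContinuousLinearMap.snd ℝ _ _) P₀ := hasFDerivAt_snd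
    have d3 := (d2.comp (extChartAt (𝓡 m) x x) d1).comp P₀ f111
    have d4 := f112.prodMk (f12.clm_apply (d3.clm_apply f2))
    have d5 : fderiv ℝ (homEvalChart n x₀ x) P₀ = _ := HasFDerivAt.fderiv d4
    rw [d5, tangentCoordChange_eq_fderiv_chartChange, tangentCoordChange_eq_fderiv_chartChange]
    refine Prod.ext rfl ?_
    change L (fderiv ℝ (chartChange x₀ x) (chartChange x x₀ (extChartAt (𝓡 m) x x)) ν +
        fderiv ℝ (fderiv ℝ (chartChange x₀ x)) (chartChange x x₀ (extChartAt (𝓡 m) x x))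
          (fderiv ℝ (chartChange x x₀) (extChartAt (𝓡 m) x x) μ) e) +
        A (fderiv ℝ (chartChange x₀ x) (chartChange x x₀ (extChartAt (𝓡 m) x x)) e) = _
    rw [hχ, add_comm, add_comm (fderiv ℝ (chartChange x₀ x) (extChartAt (𝓡 m) x₀ x) ν)]

theorem eventually_mem_hom_chart {x₀ : M} {q : HomBundle m n M N}
    (hq : q.1.1 ∈ (extChartAt (𝓡 m) x₀).source) :
    ∀ᶠ p in 𝓝 q, p ∈ (extChartAt (homModel m n) q).source ∧
      p.1.1 ∈ (extChartAt (𝓡 m) x₀).source :=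
  inter_mem (extChartAt_source_mem_nhds q) ((continuous_fst.comp continuous_homBundle_proj).tendsto q
    ((isOpen_extChartAt_source x₀).mem_nhds hq))

theorem contMDiffAt_homEval {x₀ : M} {q : HomBundle m n M N}
    (hq : q.1.1 ∈ (extChartAt (𝓡 m) x₀).source) (e : EuclideanSpace ℝ (Fin m)) :
    ContMDiffAt ((homModel m n).prod 𝓘(ℝ, EuclideanSpace ℝ (Fin m))) (𝓡 n).tangent 1
      (homEval x₀ : HomBundle m n M N × EuclideanSpace ℝ (Fin m) → TangentBundle (𝓡 n) N)
      (q, e) := by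
  set p₀ : TangentBundle (𝓡 n) N := ⟨q.1.2, 0⟩ with hp₀
  have hev : (homEval x₀ : HomBundle m n M N × EuclideanSpace ℝ (Fin m) → TangentBundle (𝓡 n) N)
      =ᶠ[𝓝 (q, e)] fun p => (extChartAt (𝓡 n).tangent p₀).symm
        (homEvalChart n x₀ q.1.1 (extChartAt (homModel m n) q p.1, p.2)) := by
    filter_upwards [(continuous_fst.tendsto (q, e)).eventually (eventually_mem_hom_chart hq)]
      with p hp
    rw [← extChartAt_homEval q hp.1 hp.2 0 p.2]
    refine ((extChartAt (𝓡 n).tangent p₀).left_inv ?_).symm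
    rw [extChartAt_tangentBundle_source]
    have := hp.1
    rw [extChartAt_hom_source] at this
    exact this.2
  have h1 : ContMDiffAt ((homModel m n).prod 𝓘(ℝ, EuclideanSpace ℝ (Fin m)))
      (𝓘(ℝ, ((EuclideanSpace ℝ (Fin m) × EuclideanSpace ℝ (Fin n)) ×
      (EuclideanSpace ℝ (Fin m) →L[ℝ] EuclideanSpace ℝ (Fin n))) × EuclideanSpace ℝ (Fin m))) 1
      (fun p : HomBundle m n M N × EuclideanSpace ℝ (Fin m) =>
        (extChartAt (homModel m n) q p.1, p.2)) (q, e) :=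
    ContMDiffAt.prodMk_space ((contMDiffAt_extChartAt (I := homModel m n) (n := 1) (x := q)).comp
      (q, e) contMDiffAt_fst) contMDiffAt_snd
  have hq' : extChartAt (homModel m n) q q = ((extChartAt (𝓡 m) q.1.1 q.1.1,
      extChartAt (𝓡 n) q.1.2 q.1.2), (extChartAt (homModel m n) q q).2) := rfl
  have h2 := (hasFDerivAt_homEvalChart (n := n) hq (extChartAt (𝓡 n) q.1.2 q.1.2)
    (extChartAt (homModel m n) q q).2 e).1
  rw [← hq'] at h2
  have h3 : homEvalChart n x₀ q.1.1 (extChartAt (homModel m n) q q, e) ∈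
      (extChartAt (𝓡 n).tangent p₀).target := by
    rw [extChartAt_tangentBundle_target]
    exact mk_mem_prod (mem_extChartAt_target (I := 𝓡 n) q.1.2) (mem_univ _)
  have h4 := contMDiffAt_extChartAt_symm (I := (𝓡 n).tangent) (r := 1) h3
  have h5 := ContMDiffAt.comp (f := fun p : HomBundle m n M N × EuclideanSpace ℝ (Fin m) =>
    (extChartAt (homModel m n) q p.1, p.2)) (q, e) h2.contMDiffAt h1
  exact (ContMDiffAt.comp (q, e) h4 h5).congr_of_eventuallyEq hev

end HomEval

section HomMor

variable {m n : ℕ}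
  {M : Type*} [TopologicalSpace M] [ChartedSpace (EuclideanSpace ℝ (Fin m)) M]
  [IsManifold (𝓡 m) 2 M]
  {N : Type*} [TopologicalSpace N] [ChartedSpace (EuclideanSpace ℝ (Fin n)) N]
  [IsManifold (𝓡 n) 2 N]

theorem extChartAt_homPoint_self (x : M) (y : N)
    (L : TangentSpace (𝓡 m) x →L[ℝ] TangentSpace (𝓡 n) y) :
    extChartAt (homModel m n) (homPoint x y L) (homPoint x y L) =
      ((extChartAt (𝓡 m) x x, extChartAt (𝓡 n) y y), L) := by
  refine (extChartAt_hom_apply (homPoint x y L) L (mem_extChartAt_source x)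
    (mem_extChartAt_source y)).trans (Prod.ext rfl (ContinuousLinearMap.ext fun v => ?_))
  exact (tangentCoordChange_self (I := 𝓡 n) (mem_extChartAt_source y)).trans
    (congrArg L (tangentCoordChange_self (I := 𝓡 m) (mem_extChartAt_source x)))

/-- The result is the double morphism attached to `ζ`, evaluated on the vector of `T²M` whose
components in the chart around `x₀` are `e`, those of `homSrc ζ`, and `ν`. The identification of
tangent vectors with morphisms is thus itself a tangent map, hence continuous in `ζ`. -/
theorem tangentMap_homEval {x₀ x : M} (hx : x ∈ (extChartAt (𝓡 m) x₀).source) (y : N)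
    (L : TangentSpace (𝓡 m) x →L[ℝ] TangentSpace (𝓡 n) y) (e ν : EuclideanSpace ℝ (Fin m))
    (ζ : TangentSpace (homModel m n) (homPoint x y L)) :
    tangentMap ((homModel m n).prod 𝓘(ℝ, EuclideanSpace ℝ (Fin m))) (𝓡 n).tangent (homEval x₀)
      ⟨(homPoint x y L, e), (ζ, ν)⟩ =
      (⟨⟨y, L (tangentCoordChange (𝓡 m) x₀ x x e)⟩, secondVec ⟨y, _⟩ (homTgt ζ)
        (homVer ζ (tangentCoordChange (𝓡 m) x₀ x x e) +
          L (fderiv ℝ (fderiv ℝ (chartChange x₀ x)) (extChartAt (𝓡 m) x₀ x)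
            (tangentCoordChange (𝓡 m) x x₀ x (homSrc ζ)) e +
              tangentCoordChange (𝓡 m) x₀ x x ν))⟩ : SecondTangent n N) := by
  have hd := (contMDiffAt_homEval (q := homPoint x y L) hx e).mdifferentiableAt one_ne_zero
  have hev : writtenInExtChartAt ((homModel m n).prod 𝓘(ℝ, EuclideanSpace ℝ (Fin m)))
      (𝓡 n).tangent ((homPoint x y L), e) (homEval x₀) =ᶠ[𝓝 (extChartAt ((homModel m n).prod
        𝓘(ℝ, EuclideanSpace ℝ (Fin m))) ((homPoint x y L), e) ((homPoint x y L), e))] homEvalChart n x₀ x := by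
    have h1 : ∀ᶠ P in 𝓝 (extChartAt (homModel m n) (homPoint x y L) (homPoint x y L)), P ∈ (extChartAt (homModel m n) (homPoint x y L)).target ∧
        ((extChartAt (homModel m n) (homPoint x y L)).symm P).1.1 ∈ (extChartAt (𝓡 m) x₀).source := by
      refine Filter.Eventually.and (extChartAt_target_mem_nhds (I := homModel m n)
        (homPoint x y L)) ?_
      refine (continuousAt_extChartAt_symm (I := homModel m n)
        (homPoint x y L)).tendsto.eventually
          (p := fun p : HomBundle m n M N => p.1.1 ∈ (extChartAt (𝓡 m) x₀).source) ?_
      rw [extChartAt_to_inv]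
      exact ((eventually_mem_hom_chart (q := homPoint x y L) hx).mono fun p hp => hp.2)
    have h2 : Tendsto Prod.fst (𝓝 (extChartAt ((homModel m n).prod
        𝓘(ℝ, EuclideanSpace ℝ (Fin m))) ((homPoint x y L), e) ((homPoint x y L), e))) (𝓝 (extChartAt (homModel m n) (homPoint x y L) (homPoint x y L))) :=
      continuous_fst.tendsto _
    filter_upwards [h2.eventually h1] with P hP
    have h3 : (extChartAt ((homModel m n).prod 𝓘(ℝ, EuclideanSpace ℝ (Fin m))) ((homPoint x y L), e)).symm P =
        ((extChartAt (homModel m n) (homPoint x y L)).symm P.1, P.2) := by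
      rw [extChartAt_prod]
      rfl
    rw [writtenInExtChartAt, Function.comp_apply, Function.comp_apply, h3]
    refine (extChartAt_homEval (homPoint x y L) ((extChartAt (homModel m n) (homPoint x y L)).map_target hP.1) hP.2 _ P.2).trans ?_
    rw [(extChartAt (homModel m n) (homPoint x y L)).right_inv hP.1]
    rfl
  have h4 := mfderiv_apply_eq_of_eventuallyEq hd hev (ζ, ν)
  have h5 : extChartAt ((homModel m n).prod 𝓘(ℝ, EuclideanSpace ℝ (Fin m))) ((homPoint x y L), e) ((homPoint x y L), e) =
      (((extChartAt (𝓡 m) x x, extChartAt (𝓡 n) y y), L), e) :=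
    Prod.ext (extChartAt_homPoint_self x y L) rfl
  rw [h5] at h4
  have h6 := (hasFDerivAt_homEvalChart hx (extChartAt (𝓡 n) y y) L e).2 (homSrc ζ) (homTgt ζ)
    (homVer ζ) ν
  exact congrArg (fun w => (⟨⟨y, L (tangentCoordChange (𝓡 m) x₀ x x e)⟩, w⟩ : SecondTangent n N))
    (h4.trans h6)

/-- The element of `Mor(T²M, T²N)` represented by `W`. -/
def homMor (x : M) (y : N) (L : TangentSpace (𝓡 m) x →L[ℝ] TangentSpace (𝓡 n) y)
    (W : TangentSpace (𝓡 m) x →L[ℝ] TangentSpace (homModel m n) (homPoint x y L)) :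
    DoubleMor (m := m) (n := n) x y :=
  let W' : EuclideanSpace ℝ (Fin m) →L[ℝ] (EuclideanSpace ℝ (Fin m) × EuclideanSpace ℝ (Fin n)) ×
    (EuclideanSpace ℝ (Fin m) →L[ℝ] EuclideanSpace ℝ (Fin n)) := W
  let l : EuclideanSpace ℝ (Fin m) →L[ℝ] EuclideanSpace ℝ (Fin n) :=
    ((ContinuousLinearMap.snd ℝ _ _).comp (ContinuousLinearMap.fst ℝ _ _)).comp W'
  let A : EuclideanSpace ℝ (Fin m) →L[ℝ] EuclideanSpace ℝ (Fin m) →L[ℝ] EuclideanSpace ℝ (Fin n) :=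
    (ContinuousLinearMap.snd ℝ _ _).comp W'
  let L' : EuclideanSpace ℝ (Fin m) →L[ℝ] EuclideanSpace ℝ (Fin n) := L
  let T : EuclideanSpace ℝ (Fin m) → EuclideanSpace ℝ (Fin m) × EuclideanSpace ℝ (Fin m) →L[ℝ]
      EuclideanSpace ℝ (Fin n) × EuclideanSpace ℝ (Fin n) := fun e =>
    (l.comp (ContinuousLinearMap.fst ℝ _ _)).prod
      ((A.flip e).comp (ContinuousLinearMap.fst ℝ _ _) + L'.comp (ContinuousLinearMap.snd ℝ _ _))
  { fst := L
    snd := l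
    toFun := T
    proj_toFun := fun e ζ => by
      rw [tangentProj_eq, tangentProj_eq]
      rfl
    ver_add := fun e e' μ ν ν' => by
      have h : ∀ μ e e' ν ν' : EuclideanSpace ℝ (Fin m), A μ (e + e') + L' (ν + ν') =
          (A μ e + L' ν) + (A μ e' + L' ν') := fun μ e e' ν ν' => by
        rw [map_add, map_add]
        abel
      exact h μ e e' ν ν'
    ver_smul := fun c e μ ν => by
      have h : ∀ μ e ν : EuclideanSpace ℝ (Fin m),
          A μ (c • e) + L' (c • ν) = c • (A μ e + L' ν) := fun μ e ν => by
        rw [map_smul, map_smul, smul_add]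
      exact h μ e ν }

theorem homMor_toFun (x : M) (y : N) (L : TangentSpace (𝓡 m) x →L[ℝ] TangentSpace (𝓡 n) y)
    (W : TangentSpace (𝓡 m) x →L[ℝ] TangentSpace (homModel m n) (homPoint x y L))
    (e μ ν : TangentSpace (𝓡 m) x) :
    (homMor x y L W).toFun e (secondVec ⟨x, e⟩ μ ν) =
      secondVec ⟨y, L e⟩ (homTgt (W μ)) (homVer (W μ) e + L ν) := rfl

theorem homMor_representedBy (x : M) (y : N)
    (L : TangentSpace (𝓡 m) x →L[ℝ] TangentSpace (𝓡 n) y)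
    (W : TangentSpace (𝓡 m) x →L[ℝ] TangentSpace (homModel m n) (homPoint x y L))
    (hW : ∀ μ, homSrc (W μ) = μ) : RepresentedBy (homMor x y L W) W :=
  ⟨hW, fun _ _ _ => rfl⟩

end HomMor

/-! ### Nested cutoffs -/

section CutoffCover

variable {F H Y : Type*} [NormedAddCommGroup F] [NormedSpace ℝ F] [FiniteDimensional ℝ F]
  [TopologicalSpace H] (I : ModelWithCorners ℝ F H) [I.Boundaryless]
  [TopologicalSpace Y] [ChartedSpace H Y] [T2Space Y] [IsManifold I 1 Y]

/-- `ρ` extends by zero functions defined only over `O`; the condition `χ p ≠ 0` marks points near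
which this changes nothing. Composed with `Tu`, that condition defines the nonvanishing set of a
weakly differentiable function, the kind of set on which `HasWeakLineDerivOn.ae_mixed_eq` works. -/
theorem exists_cutoff_pair {O : Set Y} (hO : IsOpen O) {y : Y} (hy : y ∈ O) :
    ∃ ρ χ : Y → ℝ, ContMDiff I 𝓘(ℝ, ℝ) 1 ρ ∧ HasCompactSupport ρ ∧ tsupport ρ ⊆ O ∧
      ContMDiff I 𝓘(ℝ, ℝ) 1 χ ∧ HasCompactSupport χ ∧ {p | χ p ≠ 0} ∈ 𝓝 y ∧
      ∀ p, χ p ≠ 0 → ∀ᶠ q in 𝓝 p, ρ q = 1 := by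
  have hinst : IsManifold I ((1 : ℕ∞) : ℕ∞ω) Y := by simpa using ‹IsManifold I 1 Y›
  obtain ⟨ρ, h1, h2, h3, h4⟩ := exists_contMDiff_cutoff I (r := 1) y (hO.mem_nhds hy)
  -- The second cutoff is supported in the open set of points near which the first one is
  -- identically 1.
  obtain ⟨χ, k1, k2, k3, k4⟩ := exists_contMDiff_cutoff I (r := 1) y
    (O := {p | ∀ᶠ q in 𝓝 p, ρ q = 1}) (isOpen_setOfPred_eventually_nhds.mem_nhds h4)
  refine ⟨ρ, χ, by simpa using h1, h2, h3, by simpa using k1, k2, ?_, fun p hp => ?_⟩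
  · filter_upwards [k4] with p hp
    show χ p ≠ 0
    rw [hp]
    exact one_ne_zero
  · exact k3 (subset_tsupport χ hp)

theorem exists_countable_cutoff_pairs [SecondCountableTopology Y] {O : Set Y} (hO : IsOpen O) :
    ∃ (t : Set Y) (ρ χ : t → Y → ℝ), t.Countable ∧
      (∀ y, ContMDiff I 𝓘(ℝ, ℝ) 1 (ρ y) ∧ HasCompactSupport (ρ y) ∧ tsupport (ρ y) ⊆ O ∧
        ContMDiff I 𝓘(ℝ, ℝ) 1 (χ y) ∧ HasCompactSupport (χ y) ∧
        ∀ p, χ y p ≠ 0 → ∀ᶠ q in 𝓝 p, ρ y q = 1) ∧ ∀ p ∈ O, ∃ y, χ y p ≠ 0 := by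
  have h := fun y : O => exists_cutoff_pair I hO y.2
  choose ρ χ h1 h2 h3 h4 h5 h6 h7 using h
  obtain ⟨t, htO, ht, hcov⟩ := TopologicalSpace.countable_cover_nhdsWithin (s := O)
    (f := fun y => {p | ∃ hy : y ∈ O, χ ⟨y, hy⟩ p ≠ 0}) fun y hy => mem_nhdsWithin_of_mem_nhds <| by
      filter_upwards [h6 ⟨y, hy⟩] with p hp
      exact ⟨hy, hp⟩
  refine ⟨t, fun y => ρ ⟨y, htO y.2⟩, fun y => χ ⟨y, htO y.2⟩, ht,
    fun y => ⟨h1 _, h2 _, h3 _, h4 _, h5 _, h7 _⟩, fun p hp => ?_⟩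
  obtain ⟨y, hy, hyO, hyp⟩ := mem_iUnion₂.1 (hcov hp)
  exact ⟨⟨y, hy⟩, hyp⟩

end CutoffCover

/-! ### The components along M and N of the weak tangent map of Tu -/

section SecondDerivative

variable {m n : ℕ}
  {M : Type*} [TopologicalSpace M] [ChartedSpace (EuclideanSpace ℝ (Fin m)) M]
  [IsManifold (𝓡 m) 2 M]
  {N : Type*} [TopologicalSpace N] [ChartedSpace (EuclideanSpace ℝ (Fin n)) N]
  [IsManifold (𝓡 n) 2 N]

theorem contMDiff_hom_fst : ContMDiff (homModel m n) (𝓡 m) 1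
    (fun p : HomBundle m n M N => p.1.1) :=
  contMDiff_fst.comp (contMDiff_proj _)

theorem contMDiff_hom_snd : ContMDiff (homModel m n) (𝓡 n) 1
    (fun p : HomBundle m n M N => p.1.2) :=
  contMDiff_snd.comp (contMDiff_proj _)

theorem mfderiv_hom_fst {x : M} {y : N} {L : TangentSpace (𝓡 m) x →L[ℝ] TangentSpace (𝓡 n) y}
    (ζ : TangentSpace (homModel m n) (homPoint x y L)) :
    mfderiv (homModel m n) (𝓡 m) (fun p : HomBundle m n M N => p.1.1) (homPoint x y L) ζ =
      homSrc ζ := by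
  refine (mfderiv_apply_eq_of_eventuallyEq (Ψ := fun P => P.1.1)
    (contMDiff_hom_fst.mdifferentiable one_ne_zero _) ?_ ζ).trans ?_
  · filter_upwards [extChartAt_target_mem_nhds (I := homModel m n) (homPoint x y L)] with P hP
    rw [extChartAt_hom_target] at hP
    have h := extChartAt_hom_symm_apply (homPoint x y L) P.2 hP.1.1 hP.1.2
    rw [writtenInExtChartAt, Function.comp_apply, Function.comp_apply]
    exact (congrArg (fun p : HomBundle m n M N => extChartAt (𝓡 m) x p.1.1) h).trans
      ((extChartAt (𝓡 m) x).right_inv hP.1.1)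
  · exact congrArg (fun T : ((EuclideanSpace ℝ (Fin m) × EuclideanSpace ℝ (Fin n)) ×
      (EuclideanSpace ℝ (Fin m) →L[ℝ] EuclideanSpace ℝ (Fin n))) →L[ℝ] EuclideanSpace ℝ (Fin m) =>
        T ζ) (ContinuousLinearMap.fderiv ((ContinuousLinearMap.fst ℝ _ _).comp
          (ContinuousLinearMap.fst ℝ _ _)))

theorem mfderiv_hom_snd {x : M} {y : N} {L : TangentSpace (𝓡 m) x →L[ℝ] TangentSpace (𝓡 n) y}
    (ζ : TangentSpace (homModel m n) (homPoint x y L)) :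
    mfderiv (homModel m n) (𝓡 n) (fun p : HomBundle m n M N => p.1.2) (homPoint x y L) ζ =
      homTgt ζ := by
  refine (mfderiv_apply_eq_of_eventuallyEq (Ψ := fun P => P.1.2)
    (contMDiff_hom_snd.mdifferentiable one_ne_zero _) ?_ ζ).trans ?_
  · filter_upwards [extChartAt_target_mem_nhds (I := homModel m n) (homPoint x y L)] with P hP
    rw [extChartAt_hom_target] at hP
    have h := extChartAt_hom_symm_apply (homPoint x y L) P.2 hP.1.1 hP.1.2
    rw [writtenInExtChartAt, Function.comp_apply, Function.comp_apply]
    exact (congrArg (fun p : HomBundle m n M N => extChartAt (𝓡 n) y p.1.2) h).trans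
      ((extChartAt (𝓡 n) y).right_inv hP.1.2)
  · exact congrArg (fun T : ((EuclideanSpace ℝ (Fin m) × EuclideanSpace ℝ (Fin n)) ×
      (EuclideanSpace ℝ (Fin m) →L[ℝ] EuclideanSpace ℝ (Fin n))) →L[ℝ] EuclideanSpace ℝ (Fin n) =>
        T ζ) (ContinuousLinearMap.fderiv ((ContinuousLinearMap.snd ℝ _ _).comp
          (ContinuousLinearMap.fst ℝ _ _)))

theorem mfderiv_comp_hom_snd {g : N → ℝ} (hg : ContMDiff (𝓡 n) 𝓘(ℝ, ℝ) 1 g) {x : M} {y : N}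
    {L : TangentSpace (𝓡 m) x →L[ℝ] TangentSpace (𝓡 n) y}
    (ζ : TangentSpace (homModel m n) (homPoint x y L)) :
    mfderiv (homModel m n) 𝓘(ℝ, ℝ) (fun p : HomBundle m n M N => g p.1.2) (homPoint x y L) ζ =
      mfderiv (𝓡 n) 𝓘(ℝ, ℝ) g y (homTgt ζ) := by
  have h := mfderiv_comp (I'' := 𝓘(ℝ, ℝ)) (homPoint x y L) (hg.mdifferentiable one_ne_zero y)
    (contMDiff_hom_snd.mdifferentiable one_ne_zero (homPoint x y L))
  exact (congrArg (fun T : TangentSpace (homModel m n) (homPoint x y L) →L[ℝ] ℝ => T ζ) h).trans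
    (congrArg (mfderiv (𝓡 n) 𝓘(ℝ, ℝ) g y) (mfderiv_hom_snd ζ))

theorem mfderiv_cutoff_mul_hom_fst {g : M → ℝ} {ρ : HomBundle m n M N → ℝ} {x : M}
    (hg : MDifferentiableAt (𝓡 m) 𝓘(ℝ, ℝ) g x) {y : N}
    {L : TangentSpace (𝓡 m) x →L[ℝ] TangentSpace (𝓡 n) y}
    (hρ : ∀ᶠ p in 𝓝 (homPoint x y L), ρ p = 1)
    (ζ : TangentSpace (homModel m n) (homPoint x y L)) :
    mfderiv (homModel m n) 𝓘(ℝ, ℝ) (fun p : HomBundle m n M N => ρ p * g p.1.1)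
      (homPoint x y L) ζ = mfderiv (𝓡 m) 𝓘(ℝ, ℝ) g x (homSrc ζ) := by
  have he : (fun p : HomBundle m n M N => ρ p * g p.1.1) =ᶠ[𝓝 (homPoint x y L)]
      fun p => g p.1.1 := by
    filter_upwards [hρ] with p hp
    rw [hp, one_mul]
  have h3 := mfderiv_comp (I'' := 𝓘(ℝ, ℝ)) (homPoint x y L) hg
    (contMDiff_hom_fst.mdifferentiable one_ne_zero (homPoint x y L))
  refine (congrArg (fun T : TangentSpace (homModel m n) (homPoint x y L) →L[ℝ] ℝ =>
    T ζ) (he.mfderiv_eq.trans h3)).trans ?_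
  exact congrArg (mfderiv (𝓡 m) 𝓘(ℝ, ℝ) g x) (mfderiv_hom_fst ζ)

theorem contMDiffAt_extChartAt_coord {x₀ x : M} (hx : x ∈ (extChartAt (𝓡 m) x₀).source)
    (j : Fin m) : ContMDiffAt (𝓡 m) 𝓘(ℝ, ℝ) 1 (fun w => extChartAt (𝓡 m) x₀ w j) x :=
  (EuclideanSpace.proj j :
    EuclideanSpace ℝ (Fin m) →L[ℝ] ℝ).contDiff.contMDiff.contMDiffAt.comp x
      (contMDiffAt_extChartAt' (by rwa [← extChartAt_source (𝓡 m)]))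

theorem mfderiv_extChartAt_coord {x₀ x : M} (hx : x ∈ (extChartAt (𝓡 m) x₀).source)
    (j : Fin m) (e : EuclideanSpace ℝ (Fin m)) :
    mfderiv (𝓡 m) 𝓘(ℝ, ℝ) (fun w => extChartAt (𝓡 m) x₀ w j) x e =
      (tangentCoordChange (𝓡 m) x x₀ x e) j := by
  refine (mfderiv_apply_eq_of_eventuallyEq (Ψ := fun w => chartChange x x₀ w j)
    ((contMDiffAt_extChartAt_coord hx j).mdifferentiableAt one_ne_zero)
      (Eventually.of_forall fun w => rfl) e).trans ?_
  rw [tangentCoordChange_eq_fderiv_chartChange]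
  have hd := ((contDiffAt_chartChange (mem_extChartAt_target (I := 𝓡 m) x)
    (by rw [extChartAt_to_inv]; exact hx)).differentiableAt two_ne_zero).hasFDerivAt
  exact congrArg (fun T : EuclideanSpace ℝ (Fin m) →L[ℝ] ℝ => T e)
    ((EuclideanSpace.proj j : EuclideanSpace ℝ (Fin m) →L[ℝ] ℝ).hasFDerivAt.comp _ hd).fderiv

theorem tangentCoordChange_left_inverse {x₀ x : M} (hx : x ∈ (extChartAt (𝓡 m) x₀).source)
    (e : EuclideanSpace ℝ (Fin m)) :
    tangentCoordChange (𝓡 m) x₀ x x (tangentCoordChange (𝓡 m) x x₀ x e) = e :=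
  (tangentCoordChange_comp (I := 𝓡 m) (w := x) (x := x₀) (y := x) (v := e)
    ⟨⟨mem_extChartAt_source x, hx⟩, mem_extChartAt_source x⟩).trans
      (tangentCoordChange_self (I := 𝓡 m) (mem_extChartAt_source x))

theorem tangentCoordChange_right_inverse {x₀ x : M} (hx : x ∈ (extChartAt (𝓡 m) x₀).source)
    (e : EuclideanSpace ℝ (Fin m)) :
    tangentCoordChange (𝓡 m) x x₀ x (tangentCoordChange (𝓡 m) x₀ x x e) = e :=
  (tangentCoordChange_comp (I := 𝓡 m) (w := x₀) (x := x) (y := x₀) (v := e)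
    ⟨⟨hx, mem_extChartAt_source x⟩, hx⟩).trans (tangentCoordChange_self (I := 𝓡 m) hx)

theorem mfderiv_symm_tangentCoordChange {x₀ : M} {z : EuclideanSpace ℝ (Fin m)}
    (hz : z ∈ (extChartAt (𝓡 m) x₀).target) (e : EuclideanSpace ℝ (Fin m)) :
    (mfderiv 𝓘(ℝ, EuclideanSpace ℝ (Fin m)) (𝓡 m) (extChartAt (𝓡 m) x₀).symm z
      (tangentCoordChange (𝓡 m) ((extChartAt (𝓡 m) x₀).symm z) x₀
        ((extChartAt (𝓡 m) x₀).symm z) e) : EuclideanSpace ℝ (Fin m)) = e := by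
  rw [mfderiv_extChartAt_symm_eq_tangentCoordChange hz]
  exact tangentCoordChange_left_inverse ((extChartAt (𝓡 m) x₀).map_target hz) e

theorem isOpen_hom_chart (x₀ : M) :
    IsOpen {p : HomBundle m n M N | p.1.1 ∈ (extChartAt (𝓡 m) x₀).source} :=
  (isOpen_extChartAt_source x₀).preimage (continuous_fst.comp continuous_homBundle_proj)

variable [T2Space M] [SecondCountableTopology M] [T2Space N] [SecondCountableTopology N]
  {u : M → N} {Du : ∀ x : M, TangentSpace (𝓡 m) x →L[ℝ] TangentSpace (𝓡 n) (u x)}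
  {W : ∀ x : M, TangentSpace (𝓡 m) x →L[ℝ]
    TangentSpace (homModel m n) (homPoint x (u x) (Du x))}

/-- For a function pulled back from `N`, the weak derivative of its composition with `Tu` is known
in two ways, through `Du` and through `W`. Such a function is in general not compactly supported on
`T*M ⊗ TN`, so `IsWeakTangentMap` is needed beyond compactly supported tests. -/
theorem IsWeakTangentMap.homTgt_eq (hDu : IsColocalWeakDeriv u Du)
    (hW : IsWeakTangentMap (homModel m n) (fun x => homPoint x (u x) (Du x)) W) :
    ∀ᶠ x in manifoldAE m M, ∀ μ, homTgt (W x μ) = Du x μ := by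
  obtain ⟨S, hS, hcov⟩ := exists_countable_coordNhd_cover (𝓡 n) N
  have hinst : Countable S := hS.to_subtype
  have h : ∀ᶠ x in manifoldAE m M, ∀ p : S × Fin (Module.finrank ℝ (EuclideanSpace ℝ (Fin n))),
      (mfderiv (𝓡 n) 𝓘(ℝ, ℝ) (coordFun (𝓡 n) (p.1 : N) p.2) (u x)).comp (Du x) =
        (mfderiv (homModel m n) 𝓘(ℝ, ℝ)
          (fun q : HomBundle m n M N => coordFun (𝓡 n) (p.1 : N) p.2 q.1.2)
            (homPoint x (u x) (Du x))).comp (W x) := by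
    refine eventually_manifoldAE_countable.2 fun p => ?_
    have hc := contMDiff_coordFun (I := 𝓡 n) (r := 1) (by simp) (p.1 : N) p.2
    exact hW _ (hc.comp contMDiff_hom_snd) _ (hDu.2 _ hc (hasCompactSupport_coordFun _ _))
  filter_upwards [h] with x hx μ
  obtain ⟨y, hy, hxy⟩ := hcov (u x)
  rw [eq_symm_coord_of_mem hxy (homTgt (W x μ)), eq_symm_coord_of_mem hxy (Du x μ)]
  congr 2
  funext i
  have h1 := hx (⟨y, hy⟩, i)
  have hc := contMDiff_coordFun (I := 𝓡 n) (r := 1) (by simp) y i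
  have h2 := congrArg (fun T : TangentSpace (𝓡 m) x →L[ℝ] ℝ => T μ) h1
  exact ((mfderiv_comp_hom_snd hc (W x μ)).symm.trans h2.symm)

/-- Tested with cut-off coordinates of `M`. Where the cutoff equals 1 along `Tu`, the composition is
the linear coordinate `z j` itself, so its weak derivative is known almost everywhere on that
measurable set by `HasWeakFDerivOn.ae_eq_of_eq_clm`. -/
theorem IsWeakTangentMap.homSrc_eq
    (hT : ColocallyWeaklyDifferentiable m (homModel m n) (fun x => homPoint x (u x) (Du x)))
    (hW : IsWeakTangentMap (homModel m n) (fun x => homPoint x (u x) (Du x)) W) :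
    ∀ᶠ x in manifoldAE m M, ∀ μ, homSrc (W x μ) = μ := by
  refine eventually_manifoldAE.2 fun x₀ => ?_
  obtain ⟨t, ρ, χ, ht, hρ, hcov⟩ := exists_countable_cutoff_pairs (homModel m n)
    (isOpen_hom_chart (m := m) (n := n) (M := M) (N := N) x₀)
  have hinst : Countable t := ht.to_subtype
  have hf : ∀ (y : t) (j : Fin m), ContMDiff (homModel m n) 𝓘(ℝ, ℝ) 1
      (fun p : HomBundle m n M N => ρ y p * extChartAt (𝓡 m) x₀ p.1.1 j) := fun y j =>
    ContMDiffOn.cutoff_mul (isOpen_hom_chart x₀) (fun p hp =>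
      (ContMDiffAt.comp (f := fun p : HomBundle m n M N => p.1.1) p
        (contMDiffAt_extChartAt_coord hp j) (contMDiff_hom_fst p)).contMDiffWithinAt)
        (hρ y).1 (hρ y).2.2.1
  choose G hG using fun (y : t) (j : Fin m) => hT.2 _ (hf y j) (hρ y).2.1.mul_right
  have hae1 := ae_all_iff.2 fun y : t => ae_all_iff.2 fun j : Fin m =>
    eventually_manifoldAE.1 (hW _ (hf y j) (G y j) (hG y j)) x₀
  have hae2 := ae_all_iff.2 fun y : t => ae_all_iff.2 fun j : Fin m =>
    (hG y j x₀).ae_eq_of_eq_clm (isOpen_extChartAt_target x₀) (EuclideanSpace.proj j)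
  filter_upwards [hae1, hae2, ae_restrict_mem (isOpen_extChartAt_target x₀).measurableSet]
    with z h1 h2 hz
  have hxs := (extChartAt (𝓡 m) x₀).map_target hz
  have hrz := (extChartAt (𝓡 m) x₀).right_inv hz
  have hsymm := mfderiv_symm_tangentCoordChange hz
  generalize (extChartAt (𝓡 m) x₀).symm z = x at *
  obtain ⟨y, hy⟩ := hcov (homPoint x (u x) (Du x)) hxs
  have hρ1 := (hρ y).2.2.2.2.2 _ hy
  have hkey : ∀ μ : EuclideanSpace ℝ (Fin m), tangentCoordChange (𝓡 m) x x₀ x (homSrc (W x μ)) =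
      tangentCoordChange (𝓡 m) x x₀ x μ := by
    intro μ
    ext j
    refine (mfderiv_extChartAt_coord hxs j (homSrc (W x μ))).symm.trans ?_
    refine (mfderiv_cutoff_mul_hom_fst ((contMDiffAt_extChartAt_coord hxs j).mdifferentiableAt
      one_ne_zero) hρ1 (W x μ)).symm.trans ?_
    have h5 := h2 y j (by
      show ρ y (homPoint x (u x) (Du x)) * extChartAt (𝓡 m) x₀ x j = z j
      rw [hρ1.self_of_nhds, one_mul, hrz])
    refine (congrArg (fun T : TangentSpace (𝓡 m) x →L[ℝ] ℝ => T μ) (h1 y j)).symm.trans ?_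
    refine (congrArg (G y j x) (hsymm μ)).symm.trans ?_
    exact congrArg (fun T : EuclideanSpace ℝ (Fin m) →L[ℝ] ℝ =>
      T (tangentCoordChange (𝓡 m) x x₀ x μ)) h5
  intro μ
  exact ((tangentCoordChange_left_inverse hxs (homSrc (W x μ))).symm.trans
    (congrArg (tangentCoordChange (𝓡 m) x₀ x x) (hkey μ))).trans
      (tangentCoordChange_left_inverse hxs μ)

end SecondDerivative

/-! ### Uniqueness of the second derivative -/

section Coordinates

variable {F H Y : Type*} [NormedAddCommGroup F] [NormedSpace ℝ F] [FiniteDimensional ℝ F]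
  [TopologicalSpace H] {I : ModelWithCorners ℝ F H} [I.Boundaryless]
  [TopologicalSpace Y] [ChartedSpace H Y] [T2Space Y] [IsManifold I 1 Y]

theorem clm_eq_of_mfderiv_coordFun_comp_eq {E : Type*} [NormedAddCommGroup E] [NormedSpace ℝ E]
    {y p : Y} (hp : p ∈ coordNhd I y) {W W' : E →L[ℝ] TangentSpace I p}
    (h : ∀ i, (mfderiv I 𝓘(ℝ, ℝ) (coordFun I y i) p).comp W =
      (mfderiv I 𝓘(ℝ, ℝ) (coordFun I y i) p).comp W') : W = W' := by
  refine ContinuousLinearMap.ext fun μ => ?_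
  rw [eq_symm_coord_of_mem hp (W μ), eq_symm_coord_of_mem hp (W' μ)]
  congr 2
  funext i
  exact congrArg (fun T : E →L[ℝ] ℝ => T μ) (h i)

end Coordinates

section Uniqueness

variable {m n : ℕ}
  {M : Type*} [TopologicalSpace M] [ChartedSpace (EuclideanSpace ℝ (Fin m)) M]
  [IsManifold (𝓡 m) 2 M]
  {N : Type*} [TopologicalSpace N] [ChartedSpace (EuclideanSpace ℝ (Fin n)) N]
  [IsManifold (𝓡 n) 2 N]

theorem RepresentedBy.homTgt_eq {x : M} {y : N} {v : DoubleMor (m := m) (n := n) x y}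
    {W : TangentSpace (𝓡 m) x →L[ℝ] TangentSpace (homModel m n) (homPoint x y v.fst)}
    (h : RepresentedBy v W) (e μ ν : TangentSpace (𝓡 m) x) :
    homTgt (W μ) = secondHor (v.toFun e (secondVec ⟨x, e⟩ μ ν)) :=
  (congrArg secondHor (h.2 e μ ν)).symm

theorem RepresentedBy.homVer_eq {x : M} {y : N} {v : DoubleMor (m := m) (n := n) x y}
    {W : TangentSpace (𝓡 m) x →L[ℝ] TangentSpace (homModel m n) (homPoint x y v.fst)}
    (h : RepresentedBy v W) (e μ : TangentSpace (𝓡 m) x) :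
    homVer (W μ) e = secondVer (v.toFun e (secondVec ⟨x, e⟩ μ 0)) := by
  refine ((congrArg secondVer (h.2 e μ 0)).trans ?_).symm
  exact (congrArg (fun w : TangentSpace (𝓡 n) y => homVer (W μ) e + w) (map_zero v.fst)).trans
    (add_zero _)

/-- The component λ is the horizontal part of the values of `v`, `A e` is the vertical part at ν =
0, and the component along `M` is prescribed. -/
theorem RepresentedBy.unique {x : M} {y : N} {v : DoubleMor (m := m) (n := n) x y}
    {W W' : TangentSpace (𝓡 m) x →L[ℝ] TangentSpace (homModel m n) (homPoint x y v.fst)}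
    (h : RepresentedBy v W) (h' : RepresentedBy v W') : W = W' := by
  refine ContinuousLinearMap.ext fun μ => ?_
  have h1 : homSrc (W μ) = homSrc (W' μ) := (h.1 μ).trans (h'.1 μ).symm
  have h2 : homTgt (W μ) = homTgt (W' μ) := (h.homTgt_eq 0 μ 0).trans (h'.homTgt_eq 0 μ 0).symm
  have h3 : homVer (W μ) = homVer (W' μ) :=
    ContinuousLinearMap.ext fun e => (h.homVer_eq e μ).trans (h'.homVer_eq e μ).symm
  exact Prod.ext (Prod.ext h1 h2) h3

theorem RepresentedBy.eq_homMor {x : M} {y : N} {v : DoubleMor (m := m) (n := n) x y}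
    {W : TangentSpace (𝓡 m) x →L[ℝ] TangentSpace (homModel m n) (homPoint x y v.fst)}
    (h : RepresentedBy v W) : v = homMor x y v.fst W := by
  have h1 : v.snd = (homMor x y v.fst W).snd := by
    refine ContinuousLinearMap.ext fun μ => ?_
    have h2 := v.proj_toFun 0 (secondVec ⟨x, 0⟩ μ 0)
    rw [tangentProj_eq, tangentProj_eq] at h2
    exact h2.symm.trans (h.homTgt_eq 0 μ 0).symm
  have h2 : v.toFun = (homMor x y v.fst W).toFun := by
    funext e
    refine ContinuousLinearMap.ext fun ζ => ?_
    exact (h.2 e (secondHor ζ) (secondVer ζ)).trans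
      (homMor_toFun x y v.fst W e (secondHor ζ) (secondVer ζ)).symm
  exact DoubleMor.ext rfl h1 h2

variable [T2Space M] [SecondCountableTopology M] [T2Space N] [SecondCountableTopology N]

/-- `v.fst` is not assumed to be `L`: the equality of the values of the cutoff and coordinate
functions yields this first, and only then can differentials be compared at the same point. The
representing maps may depend on the test function; `RepresentedBy.unique` identifies them. -/
theorem eq_homMor_of_coord {x : M} {y : N} {L : TangentSpace (𝓡 m) x →L[ℝ] TangentSpace (𝓡 n) y}
    {W : TangentSpace (𝓡 m) x →L[ℝ] TangentSpace (homModel m n) (homPoint x y L)}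
    {v : DoubleMor (m := m) (n := n) x y} {q : HomBundle m n M N}
    (hq : homPoint x y L ∈ coordNhd (homModel m n) q)
    (h0 : ∃ W', RepresentedBy v W' ∧ coordCutoff (homModel m n) q (homPoint x y L) =
      coordCutoff (homModel m n) q (homPoint x y v.fst))
    (hi : ∀ i, ∃ W', RepresentedBy v W' ∧ coordFun (homModel m n) q i (homPoint x y L) =
      coordFun (homModel m n) q i (homPoint x y v.fst) ∧
      (mfderiv (homModel m n) 𝓘(ℝ, ℝ) (coordFun (homModel m n) q i) (homPoint x y L)).comp W =
        (mfderiv (homModel m n) 𝓘(ℝ, ℝ) (coordFun (homModel m n) q i)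
          (homPoint x y v.fst)).comp W') : v = homMor x y L W := by
  have hL : L = v.fst := by
    have h1 : homPoint x y L = homPoint x y v.fst := eq_of_coordFun_eq hq h0.choose_spec.2 fun i =>
      (hi i).choose_spec.2.1
    exact eq_of_heq (TotalSpace.mk.inj h1).2
  subst hL
  obtain ⟨W', hW', -⟩ := h0
  have hWW : W = W' := by
    refine clm_eq_of_mfderiv_coordFun_comp_eq (E := EuclideanSpace ℝ (Fin m)) hq fun i => ?_
    obtain ⟨W'', hW'', -, h2⟩ := hi i
    exact h2.trans (congrArg _ (hW''.unique hW'))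
  rw [hWW]
  exact hW'.eq_homMor

variable
  {u : M → N} {Du : ∀ x : M, TangentSpace (𝓡 m) x →L[ℝ] TangentSpace (𝓡 n) (u x)}
  {W : ∀ x : M, TangentSpace (𝓡 m) x →L[ℝ]
    TangentSpace (homModel m n) (homPoint x (u x) (Du x))}
  {V : ∀ x : M, DoubleMor (m := m) (n := n) x (u x)}

/-- Countably many compactly supported tests determine the morphism. Their compositions with `Tu`
are weakly differentiable by `hT`, so both `V` and `W` must satisfy the chain rule for them. -/
theorem IsSecondColocalWeakDeriv.eq_homMor
    (hT : ColocallyWeaklyDifferentiable m (homModel m n) (fun x => homPoint x (u x) (Du x)))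
    (hW : IsWeakTangentMap (homModel m n) (fun x => homPoint x (u x) (Du x)) W)
    (hV : IsSecondColocalWeakDeriv u Du V) :
    ∀ᶠ x in manifoldAE m M, V x = homMor x (u x) (Du x) (W x) := by
  obtain ⟨S, hS, hcov⟩ := exists_countable_coordNhd_cover (homModel m n) (HomBundle m n M N)
  have hinst : Countable S := hS.to_subtype
  have key : ∀ f : HomBundle m n M N → ℝ, ContMDiff (homModel m n) 𝓘(ℝ, ℝ) 1 f →
      HasCompactSupport f → ∀ᶠ x in manifoldAE m M, ∃ W', RepresentedBy (V x) W' ∧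
        f (homPoint x (u x) (Du x)) = f (homPoint x (u x) (V x).fst) ∧
        (mfderiv (homModel m n) 𝓘(ℝ, ℝ) f (homPoint x (u x) (Du x))).comp (W x) =
        (mfderiv (homModel m n) 𝓘(ℝ, ℝ) f (homPoint x (u x) (V x).fst)).comp W' := by
    intro f hf hc
    obtain ⟨G, hG⟩ := hT.2 f hf hc
    filter_upwards [hW f hf G hG, hV.2 f hf G hG] with x h1 ⟨W', h2, h3, h4⟩
    exact ⟨W', h2, h3, h1.symm.trans h4⟩
  have h0 := eventually_manifoldAE_countable.2 fun q : S => key _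
    (contMDiff_coordCutoff (I := homModel m n) (r := 1) (by simp) (q : HomBundle m n M N))
    (hasCompactSupport_coordCutoff _)
  have hi := eventually_manifoldAE_countable.2
    fun p : S × Fin (Module.finrank ℝ ((EuclideanSpace ℝ (Fin m) × EuclideanSpace ℝ (Fin n)) ×
      (EuclideanSpace ℝ (Fin m) →L[ℝ] EuclideanSpace ℝ (Fin n)))) => key _
    (contMDiff_coordFun (I := homModel m n) (r := 1) (by simp) (p.1 : HomBundle m n M N) p.2)
    (hasCompactSupport_coordFun _ _)
  filter_upwards [h0, hi] with x h0 hi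
  obtain ⟨q, hqS, hq⟩ := hcov (homPoint x (u x) (Du x))
  obtain ⟨W', h1, h2, -⟩ := h0 ⟨q, hqS⟩
  exact eq_homMor_of_coord hq ⟨W', h1, h2⟩ fun i => hi (⟨q, hqS⟩, i)

theorem SecondMeasurable.isSecondColocalWeakDeriv
    (hT : ColocallyWeaklyDifferentiable m (homModel m n) (fun x => homPoint x (u x) (Du x)))
    (hW : IsWeakTangentMap (homModel m n) (fun x => homPoint x (u x) (Du x)) W)
    (hV : SecondMeasurable u fun x => homMor x (u x) (Du x) (W x)) :
    IsSecondColocalWeakDeriv u Du fun x => homMor x (u x) (Du x) (W x) := by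
  refine ⟨hV, fun f hf G hG => ?_⟩
  filter_upwards [hW f hf G hG, hW.homSrc_eq hT] with x h1 h2
  exact ⟨W x, homMor_representedBy x (u x) (Du x) (W x) h2, rfl, h1⟩

end Uniqueness

/-! ### Measurability of the second derivative -/

section TangentMapProd

variable {E F E' H H' X Y : Type*} [NormedAddCommGroup E] [NormedSpace ℝ E]
  [NormedAddCommGroup F] [NormedSpace ℝ F] [NormedAddCommGroup E'] [NormedSpace ℝ E']
  [TopologicalSpace H] {I : ModelWithCorners ℝ E H} [TopologicalSpace H']
  {I' : ModelWithCorners ℝ E' H'} [TopologicalSpace X] [ChartedSpace H X] [IsManifold I 1 X]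
  [TopologicalSpace Y] [ChartedSpace H' Y] [IsManifold I' 1 Y]

/-- The tangent map of a `C¹` map is continuous, and freezing the second factor of the tangent
bundle of `X × F` keeps it continuous in `ζ`. -/
theorem isOpen_tangentMap_prod_preimage {f : X × F → Y} {O : Set X} (hO : IsOpen O)
    (hf : ∀ p ∈ O, ∀ e, ContMDiffAt (I.prod 𝓘(ℝ, F)) I' 1 f (p, e))
    {U : Set (TangentBundle I' Y)} (hU : IsOpen U) (e ν : F) :
    IsOpen {ζ : TangentBundle I X | ζ.1 ∈ O ∧
      tangentMap (I.prod 𝓘(ℝ, F)) I' f ⟨(ζ.1, e), (ζ.2, ν)⟩ ∈ U} := by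
  have hJ : Continuous fun ζ : TangentBundle I X =>
      (equivTangentBundleProd I X 𝓘(ℝ, F) F).symm (ζ, ⟨e, ν⟩) :=
    (contMDiff_equivTangentBundleProd_symm (n := 0)).continuous.comp
      (Continuous.prodMk continuous_id continuous_const)
  have hO' : IsOpen {p : X × F | p.1 ∈ O} := hO.preimage continuous_fst
  have hc : ContMDiffOn (I.prod 𝓘(ℝ, F)) I' 1 f {p | p.1 ∈ O} := fun p hp =>
    (hf p.1 hp p.2).contMDiffWithinAt
  have h1 := (hc.continuousOn_tangentMapWithin le_rfl hO'.uniqueMDiffOn).isOpen_inter_preimage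
    (hO'.preimage (FiberBundle.continuous_proj _ _)) hU
  convert h1.preimage hJ using 1
  ext ζ
  refine and_congr_right fun hζ => ?_
  have h2 := tangentMapWithin_eq_tangentMap (f := f)
    (p := (equivTangentBundleProd I X 𝓘(ℝ, F) F).symm (ζ, ⟨e, ν⟩))
    (hO'.uniqueMDiffOn (ζ.1, e) hζ) ((hf ζ.1 hζ e).mdifferentiableAt one_ne_zero)
  exact (iff_of_eq (congrArg (fun w => w ∈ U) h2)).symm

end TangentMapProd

section Measurability

variable {m n : ℕ}
  {M : Type*} [TopologicalSpace M] [ChartedSpace (EuclideanSpace ℝ (Fin m)) M]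
  [IsManifold (𝓡 m) 2 M]
  {N : Type*} [TopologicalSpace N] [ChartedSpace (EuclideanSpace ℝ (Fin n)) N]
  [IsManifold (𝓡 n) 2 N]

/-- The derivative of `homEval x₀` along a vector tangent to `T*M ⊗ TN`, and the constant vector
with components `(e, ν)`. -/
def homEvalTangent (x₀ : M) (e ν : EuclideanSpace ℝ (Fin m))
    (ζ : TangentBundle (homModel m n) (HomBundle m n M N)) : SecondTangent n N :=
  tangentMap ((homModel m n).prod 𝓘(ℝ, EuclideanSpace ℝ (Fin m))) (𝓡 n).tangent (homEval x₀)
    ⟨(ζ.1, e), (ζ.2, ν)⟩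

theorem isOpen_homEvalTangent_preimage (x₀ : M) (e ν : EuclideanSpace ℝ (Fin m))
    {U : Set (SecondTangent n N)} (hU : IsOpen U) :
    IsOpen {ζ : TangentBundle (homModel m n) (HomBundle m n M N) |
      ζ.1.1.1 ∈ (extChartAt (𝓡 m) x₀).source ∧ homEvalTangent x₀ e ν ζ ∈ U} := by
  exact isOpen_tangentMap_prod_preimage (f := homEval (n := n) (N := N) x₀) (isOpen_hom_chart x₀)
    (fun p hp e => contMDiffAt_homEval hp e) hU e ν

variable [T2Space M] [SecondCountableTopology M] [T2Space N] [SecondCountableTopology N]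
  {u : M → N} {Du : ∀ x : M, TangentSpace (𝓡 m) x →L[ℝ] TangentSpace (𝓡 n) (u x)}
  {W : ∀ x : M, TangentSpace (𝓡 m) x →L[ℝ]
    TangentSpace (homModel m n) (homPoint x (u x) (Du x))}

theorem mfderiv_symm_eq_fderiv_chartChange {x₀ : M} {z : EuclideanSpace ℝ (Fin m)}
    (hz : z ∈ (extChartAt (𝓡 m) x₀).target) (μ : EuclideanSpace ℝ (Fin m)) :
    (mfderiv 𝓘(ℝ, EuclideanSpace ℝ (Fin m)) (𝓡 m) (extChartAt (𝓡 m) x₀).symm z μ :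
      EuclideanSpace ℝ (Fin m)) =
      fderiv ℝ (chartChange x₀ ((extChartAt (𝓡 m) x₀).symm z)) z μ := by
  rw [mfderiv_extChartAt_symm_eq_tangentCoordChange hz, tangentCoordChange_eq_fderiv_chartChange,
    (extChartAt (𝓡 m) x₀).right_inv hz]
  rfl

theorem homEvalTangent_apply {x₀ : M} {z : EuclideanSpace ℝ (Fin m)}
    (hz : z ∈ (extChartAt (𝓡 m) x₀).target) (y : N)
    (L : TangentSpace (𝓡 m) ((extChartAt (𝓡 m) x₀).symm z) →L[ℝ] TangentSpace (𝓡 n) y)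
    (e μ ν : EuclideanSpace ℝ (Fin m))
    (ζ : TangentSpace (homModel m n) (homPoint ((extChartAt (𝓡 m) x₀).symm z) y L))
    (hζ : homSrc ζ = fderiv ℝ (chartChange x₀ ((extChartAt (𝓡 m) x₀).symm z)) z μ) :
    homEvalTangent x₀ e ν ⟨homPoint ((extChartAt (𝓡 m) x₀).symm z) y L, ζ⟩ =
      ⟨⟨y, L (fderiv ℝ (chartChange x₀ ((extChartAt (𝓡 m) x₀).symm z)) z e)⟩,
        secondVec ⟨y, _⟩ (homTgt ζ)
        (homVer ζ (fderiv ℝ (chartChange x₀ ((extChartAt (𝓡 m) x₀).symm z)) z e) +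
          L (fderiv ℝ (fderiv ℝ (chartChange x₀ ((extChartAt (𝓡 m) x₀).symm z))) z μ e +
            fderiv ℝ (chartChange x₀ ((extChartAt (𝓡 m) x₀).symm z)) z ν))⟩ := by
  have hxs := (extChartAt (𝓡 m) x₀).map_target hz
  have hrz := (extChartAt (𝓡 m) x₀).right_inv hz
  generalize (extChartAt (𝓡 m) x₀).symm z = x at *
  subst hrz
  have h := tangentMap_homEval hxs y L e ν ζ
  have hμ : tangentCoordChange (𝓡 m) x x₀ x (homSrc ζ) = μ := by
    rw [hζ, ← tangentCoordChange_eq_fderiv_chartChange]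
    exact tangentCoordChange_right_inverse hxs μ
  rw [tangentCoordChange_eq_fderiv_chartChange x₀ x x, hμ] at h
  exact h

/-- On the section with constant components `(e, μ, ν)`, the morphism is `homEvalTangent x₀ e ν`
applied to the value of `W` on the vector of components `μ`. That value is measurable by
`IsWeakTangentMap.nullMeasurableSet_tangent`. The identity uses `IsWeakTangentMap.homSrc_eq`, hence
holds almost everywhere. -/
theorem IsWeakTangentMap.secondMeasurable
    (hT : ColocallyWeaklyDifferentiable m (homModel m n) (fun x => homPoint x (u x) (Du x)))
    (hW : IsWeakTangentMap (homModel m n) (fun x => homPoint x (u x) (Du x)) W) :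
    SecondMeasurable u fun x => homMor x (u x) (Du x) (W x) := by
  intro x₀ e μ ν U hU
  refine (hW.nullMeasurableSet_tangent hT x₀ μ
    (isOpen_homEvalTangent_preimage x₀ e ν hU)).congr ?_
  have h := (ae_restrict_iff' (isOpen_extChartAt_target x₀).measurableSet).1
    (eventually_manifoldAE.1 (hW.homSrc_eq hT) x₀)
  refine eventuallyEq_set.2 (h.mono fun z hz => and_congr_right fun hzt => ?_)
  have h1 := homEvalTangent_apply hzt (u ((extChartAt (𝓡 m) x₀).symm z))
    (Du ((extChartAt (𝓡 m) x₀).symm z)) e μ ν (W ((extChartAt (𝓡 m) x₀).symm z)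
      (mfderiv 𝓘(ℝ, EuclideanSpace ℝ (Fin m)) (𝓡 m) (extChartAt (𝓡 m) x₀).symm z μ))
    ((hz hzt _).trans (mfderiv_symm_eq_fderiv_chartChange hzt μ))
  rw [extChartAt_second_symm_apply x₀ hzt]
  have h2 : ∀ ζ : SecondTangent n N, ζ = homEvalTangent x₀ e ν
      ⟨homPoint ((extChartAt (𝓡 m) x₀).symm z) (u ((extChartAt (𝓡 m) x₀).symm z))
        (Du ((extChartAt (𝓡 m) x₀).symm z)), W ((extChartAt (𝓡 m) x₀).symm z)
      (mfderiv 𝓘(ℝ, EuclideanSpace ℝ (Fin m)) (𝓡 m) (extChartAt (𝓡 m) x₀).symm z μ)⟩ →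
      ((homPoint ((extChartAt (𝓡 m) x₀).symm z) (u ((extChartAt (𝓡 m) x₀).symm z))
        (Du ((extChartAt (𝓡 m) x₀).symm z))).1.1 ∈ (extChartAt (𝓡 m) x₀).source ∧
        homEvalTangent x₀ e ν
      ⟨homPoint ((extChartAt (𝓡 m) x₀).symm z) (u ((extChartAt (𝓡 m) x₀).symm z))
        (Du ((extChartAt (𝓡 m) x₀).symm z)), W ((extChartAt (𝓡 m) x₀).symm z)
      (mfderiv 𝓘(ℝ, EuclideanSpace ℝ (Fin m)) (𝓡 m) (extChartAt (𝓡 m) x₀).symm z μ)⟩ ∈ U ↔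
        ζ ∈ U) := fun ζ hζ => by
    rw [hζ]
    exact and_iff_right ((extChartAt (𝓡 m) x₀).map_target hzt)
  refine h2 _ (Eq.trans ?_ h1.symm)
  rw [mfderiv_symm_eq_fderiv_chartChange hzt μ]
  rfl

end Measurability

/-! ### Symmetry of the second derivative -/

section HomEvalDeriv

variable {m n : ℕ}
  {M : Type*} [TopologicalSpace M] [ChartedSpace (EuclideanSpace ℝ (Fin m)) M]
  [IsManifold (𝓡 m) 2 M]
  {N : Type*} [TopologicalSpace N] [ChartedSpace (EuclideanSpace ℝ (Fin n)) N]
  [IsManifold (𝓡 n) 2 N] [T2Space M] [T2Space N]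

/-- The derivative of `f` along the vector `homEval x₀ (p, v)`. -/
def homEvalDeriv (f : N → ℝ) (x₀ : M) (v : EuclideanSpace ℝ (Fin m)) (p : HomBundle m n M N) : ℝ :=
  mfderiv (𝓡 n) 𝓘(ℝ, ℝ) f p.1.2 (homEval x₀ (p, v)).2

/-- The expression of `homEvalDeriv f x₀ v` in the chart around a point over `(x, y)`. -/
def homEvalDerivChart (f : N → ℝ) (x₀ x : M) (y : N) (v : EuclideanSpace ℝ (Fin m))
    (P : (EuclideanSpace ℝ (Fin m) × EuclideanSpace ℝ (Fin n)) ×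
      (EuclideanSpace ℝ (Fin m) →L[ℝ] EuclideanSpace ℝ (Fin n))) : ℝ :=
  fderiv ℝ (f ∘ (extChartAt (𝓡 n) y).symm) (homEvalChart n x₀ x (P, v)).1
    (homEvalChart n x₀ x (P, v)).2

theorem mfderiv_eq_fderiv_tangentCoordChange {f : M → ℝ} {x₀ x : M}
    (hx : x ∈ (extChartAt (𝓡 m) x₀).source) (hf : MDifferentiableAt (𝓡 m) 𝓘(ℝ, ℝ) f x)
    (e : EuclideanSpace ℝ (Fin m)) :
    mfderiv (𝓡 m) 𝓘(ℝ, ℝ) f x e = fderiv ℝ (f ∘ (extChartAt (𝓡 m) x₀).symm)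
      (extChartAt (𝓡 m) x₀ x) (tangentCoordChange (𝓡 m) x x₀ x e) := by
  have h1 := mfderiv_extChartAt_symm_apply hx hf (tangentCoordChange (𝓡 m) x x₀ x e)
  have h2 := mfderiv_symm_tangentCoordChange ((extChartAt (𝓡 m) x₀).map_source hx) e
  rw [(extChartAt (𝓡 m) x₀).left_inv hx] at h2
  exact (congrArg (mfderiv (𝓡 m) 𝓘(ℝ, ℝ) f x) h2).symm.trans h1

theorem homEvalDeriv_eq {f : N → ℝ} (hf : MDifferentiable (𝓡 n) 𝓘(ℝ, ℝ) f) {x₀ : M}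
    (v : EuclideanSpace ℝ (Fin m)) (q : HomBundle m n M N) {p : HomBundle m n M N}
    (hp : p ∈ (extChartAt (homModel m n) q).source) (hp₀ : p.1.1 ∈ (extChartAt (𝓡 m) x₀).source) :
    homEvalDeriv f x₀ v p =
      homEvalDerivChart f x₀ q.1.1 q.1.2 v (extChartAt (homModel m n) q p) := by
  have hy : p.1.2 ∈ (extChartAt (𝓡 n) q.1.2).source := by
    rw [extChartAt_hom_source] at hp
    exact hp.2
  rw [homEvalDerivChart, ← extChartAt_homEval q hp hp₀ 0 v, extChartAt_tangentBundle_apply]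
  exact mfderiv_eq_fderiv_tangentCoordChange hy (hf p.1.2) _

theorem contDiffAt_comp_extChartAt_symm {f : N → ℝ} (hf : ContMDiff (𝓡 n) 𝓘(ℝ, ℝ) 2 f) (y : N) :
    ContDiffAt ℝ 2 (f ∘ (extChartAt (𝓡 n) y).symm) (extChartAt (𝓡 n) y y) :=
  (ContMDiffAt.comp (extChartAt (𝓡 n) y y) (hf _)
    (contMDiffAt_extChartAt_symm (mem_extChartAt_target y))).contDiffAt

/-- The function to be differentiated is the differential of `f` applied to `L` applied to a moving
vector. The three terms come from these three dependences; `f` has to be `C²` for the first. -/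
theorem contDiffAt_homEvalDerivChart {f : N → ℝ} (hf : ContMDiff (𝓡 n) 𝓘(ℝ, ℝ) 2 f) {x₀ x : M}
    (hx : x ∈ (extChartAt (𝓡 m) x₀).source) (y : N) (v : EuclideanSpace ℝ (Fin m))
    (L : EuclideanSpace ℝ (Fin m) →L[ℝ] EuclideanSpace ℝ (Fin n)) :
    ContDiffAt ℝ 1 (homEvalDerivChart f x₀ x y v)
      ((extChartAt (𝓡 m) x x, extChartAt (𝓡 n) y y), L) ∧
    ∀ (μ : EuclideanSpace ℝ (Fin m)) (l : EuclideanSpace ℝ (Fin n))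
      (A : EuclideanSpace ℝ (Fin m) →L[ℝ] EuclideanSpace ℝ (Fin n)),
      fderiv ℝ (homEvalDerivChart f x₀ x y v)
        ((extChartAt (𝓡 m) x x, extChartAt (𝓡 n) y y), L) ((μ, l), A) =
      fderiv ℝ (fderiv ℝ (f ∘ (extChartAt (𝓡 n) y).symm)) (extChartAt (𝓡 n) y y) l
        (L (tangentCoordChange (𝓡 m) x₀ x x v)) +
      fderiv ℝ (f ∘ (extChartAt (𝓡 n) y).symm) (extChartAt (𝓡 n) y y)
        (A (tangentCoordChange (𝓡 m) x₀ x x v) +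
          L (fderiv ℝ (fderiv ℝ (chartChange x₀ x)) (extChartAt (𝓡 m) x₀ x)
            (tangentCoordChange (𝓡 m) x x₀ x μ) v)) := by
  obtain ⟨hc, hd⟩ := hasFDerivAt_homEvalChart (n := n) hx (extChartAt (𝓡 n) y y) L v
  have hf2 := contDiffAt_comp_extChartAt_symm hf y
  have hf1 : ContDiffAt ℝ 1 (fderiv ℝ (f ∘ (extChartAt (𝓡 n) y).symm)) (extChartAt (𝓡 n) y y) :=
    hf2.fderiv_right (m := 1) (by rw [one_add_one_eq_two])
  set P₀ : (EuclideanSpace ℝ (Fin m) × EuclideanSpace ℝ (Fin n)) ×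
      (EuclideanSpace ℝ (Fin m) →L[ℝ] EuclideanSpace ℝ (Fin n)) :=
    ((extChartAt (𝓡 m) x x, extChartAt (𝓡 n) y y), L) with hP₀
  have hH : ContDiffAt ℝ 1 (fun P : (EuclideanSpace ℝ (Fin m) × EuclideanSpace ℝ (Fin n)) ×
      (EuclideanSpace ℝ (Fin m) →L[ℝ] EuclideanSpace ℝ (Fin n)) => homEvalChart n x₀ x (P, v)) P₀ :=
    ContDiffAt.comp (f := fun P : (EuclideanSpace ℝ (Fin m) × EuclideanSpace ℝ (Fin n)) ×
      (EuclideanSpace ℝ (Fin m) →L[ℝ] EuclideanSpace ℝ (Fin n)) => (P, v)) P₀ hc (by fun_prop)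
  have hH1 : (homEvalChart n x₀ x (P₀, v)).1 = extChartAt (𝓡 n) y y := rfl
  have hH2 : (homEvalChart n x₀ x (P₀, v)).2 = L (tangentCoordChange (𝓡 m) x₀ x x v) := by
    rw [homEvalChart, tangentCoordChange_eq_fderiv_chartChange]
    have hχ : chartChange x x₀ (extChartAt (𝓡 m) x x) = extChartAt (𝓡 m) x₀ x := by
      rw [chartChange, Function.comp_apply, extChartAt_to_inv]
    rw [← hχ]
  have hD : ContDiffAt ℝ 1 (fun P => fderiv ℝ (f ∘ (extChartAt (𝓡 n) y).symm)
      (homEvalChart n x₀ x (P, v)).1) P₀ :=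
    ContDiffAt.comp (f := fun P : (EuclideanSpace ℝ (Fin m) × EuclideanSpace ℝ (Fin n)) ×
      (EuclideanSpace ℝ (Fin m) →L[ℝ] EuclideanSpace ℝ (Fin n)) => (homEvalChart n x₀ x (P, v)).1)
      P₀ hf1 hH.fst
  refine ⟨hD.clm_apply hH.snd, fun μ l A => ?_⟩
  have e1 := (hf1.differentiableAt one_ne_zero).hasFDerivAt
  have e2 := HasFDerivAt.comp P₀ (f := fun P : (EuclideanSpace ℝ (Fin m) ×
    EuclideanSpace ℝ (Fin n)) × (EuclideanSpace ℝ (Fin m) →L[ℝ] EuclideanSpace ℝ (Fin n)) => (P, v))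
    (hc.differentiableAt one_ne_zero).hasFDerivAt
    ((hasFDerivAt_id (𝕜 := ℝ) P₀).prodMk (hasFDerivAt_const v P₀))
  have e3 := (e1.comp P₀ (f := fun P : (EuclideanSpace ℝ (Fin m) × EuclideanSpace ℝ (Fin n)) ×
      (EuclideanSpace ℝ (Fin m) →L[ℝ] EuclideanSpace ℝ (Fin n)) =>
        (homEvalChart n x₀ x (P, v)).1) e2.fst).clm_apply e2.snd
  have e4 : fderiv ℝ (homEvalDerivChart f x₀ x y v) P₀ = _ := HasFDerivAt.fderiv e3
  have e5 := hd μ l A 0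
  rw [map_zero, add_zero] at e5
  rw [e4]
  change fderiv ℝ (f ∘ (extChartAt (𝓡 n) y).symm) (extChartAt (𝓡 n) y y)
      (fderiv ℝ (homEvalChart n x₀ x) (P₀, v) (((μ, l), A), 0)).2 +
    fderiv ℝ (fderiv ℝ (f ∘ (extChartAt (𝓡 n) y).symm)) (extChartAt (𝓡 n) y y)
      (fderiv ℝ (homEvalChart n x₀ x) (P₀, v) (((μ, l), A), 0)).1
      (homEvalChart n x₀ x (P₀, v)).2 = _
  rw [e5, hH2, add_comm]

theorem homEvalDeriv_eventuallyEq {f : N → ℝ} (hf : MDifferentiable (𝓡 n) 𝓘(ℝ, ℝ) f) {x₀ : M}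
    (v : EuclideanSpace ℝ (Fin m)) {q : HomBundle m n M N}
    (hq : q.1.1 ∈ (extChartAt (𝓡 m) x₀).source) :
    homEvalDeriv f x₀ v =ᶠ[𝓝 q] fun p =>
      homEvalDerivChart f x₀ q.1.1 q.1.2 v (extChartAt (homModel m n) q p) :=
  (eventually_mem_hom_chart hq).mono fun _ hp => homEvalDeriv_eq hf v q hp.1 hp.2

theorem contMDiffAt_homEvalDeriv {f : N → ℝ} (hf : ContMDiff (𝓡 n) 𝓘(ℝ, ℝ) 2 f) {x₀ : M}
    (v : EuclideanSpace ℝ (Fin m)) {x : M} (hx : x ∈ (extChartAt (𝓡 m) x₀).source) (y : N)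
    (L : TangentSpace (𝓡 m) x →L[ℝ] TangentSpace (𝓡 n) y) :
    ContMDiffAt (homModel m n) 𝓘(ℝ, ℝ) 1 (homEvalDeriv f x₀ v : HomBundle m n M N → ℝ)
      (homPoint x y L) := by
  have h1 := (contDiffAt_homEvalDerivChart hf hx y v L).1
  have h2 := extChartAt_homPoint_self (m := m) (n := n) x y L
  have h3 : ContDiffAt ℝ 1 (homEvalDerivChart f x₀ x y v)
      (extChartAt (homModel m n) (homPoint x y L) (homPoint x y L)) := by
    rw [h2]
    exact h1
  exact (ContMDiffAt.comp (homPoint x y L) h3.contMDiffAt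
    (contMDiffAt_extChartAt (I := homModel m n) (n := 1))).congr_of_eventuallyEq
    (homEvalDeriv_eventuallyEq (hf.mdifferentiable two_ne_zero) v (q := homPoint x y L) hx)

theorem mfderiv_homEvalDeriv {f : N → ℝ} (hf : ContMDiff (𝓡 n) 𝓘(ℝ, ℝ) 2 f) {x₀ : M}
    (v : EuclideanSpace ℝ (Fin m)) {x : M} (hx : x ∈ (extChartAt (𝓡 m) x₀).source) (y : N)
    (L : TangentSpace (𝓡 m) x →L[ℝ] TangentSpace (𝓡 n) y)
    (ζ : TangentSpace (homModel m n) (homPoint x y L)) :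
    mfderiv (homModel m n) 𝓘(ℝ, ℝ) (homEvalDeriv f x₀ v : HomBundle m n M N → ℝ)
      (homPoint x y L) ζ =
      fderiv ℝ (fderiv ℝ (f ∘ (extChartAt (𝓡 n) y).symm)) (extChartAt (𝓡 n) y y) (homTgt ζ)
        (L (tangentCoordChange (𝓡 m) x₀ x x v)) +
      fderiv ℝ (f ∘ (extChartAt (𝓡 n) y).symm) (extChartAt (𝓡 n) y y)
        (homVer ζ (tangentCoordChange (𝓡 m) x₀ x x v) +
          L (fderiv ℝ (fderiv ℝ (chartChange x₀ x)) (extChartAt (𝓡 m) x₀ x)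
            (tangentCoordChange (𝓡 m) x x₀ x (homSrc ζ)) v)) := by
  have h1 := (contDiffAt_homEvalDerivChart hf hx y v L).2 (homSrc ζ) (homTgt ζ) (homVer ζ)
  have h2 := extChartAt_homPoint_self (m := m) (n := n) x y L
  have h5 := congrArg (fun P : (EuclideanSpace ℝ (Fin m) × EuclideanSpace ℝ (Fin n)) ×
    (EuclideanSpace ℝ (Fin m) →L[ℝ] EuclideanSpace ℝ (Fin n)) =>
      fderiv ℝ (homEvalDerivChart f x₀ x y v) P ((homSrc ζ, homTgt ζ), homVer ζ)) h2
  refine (mfderiv_apply_eq_of_eventuallyEq (Ψ := homEvalDerivChart f x₀ x y v)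
    ((contMDiffAt_homEvalDeriv hf v hx y L).mdifferentiableAt one_ne_zero) ?_ ζ).trans
      (h5.trans h1)
  have h3 := (continuousAt_extChartAt_symm (I := homModel m n) (homPoint x y L)).tendsto
  rw [extChartAt_to_inv] at h3
  filter_upwards [extChartAt_target_mem_nhds (I := homModel m n) (homPoint x y L),
    h3.eventually (homEvalDeriv_eventuallyEq (hf.mdifferentiable two_ne_zero) v
      (q := homPoint x y L) hx)] with P hP h4
  refine h4.trans ?_
  rw [(extChartAt (homModel m n) (homPoint x y L)).right_inv hP]
  rfl

end HomEvalDeriv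

section Symmetry

variable {m n : ℕ}
  {M : Type*} [TopologicalSpace M] [ChartedSpace (EuclideanSpace ℝ (Fin m)) M]
  [IsManifold (𝓡 m) 2 M]
  {N : Type*} [TopologicalSpace N] [ChartedSpace (EuclideanSpace ℝ (Fin n)) N]
  [IsManifold (𝓡 n) 2 N] [T2Space M] [T2Space N]

theorem mfderiv_eq_fderiv_comp_symm {f : N → ℝ} {y : N}
    (hf : MDifferentiableAt (𝓡 n) 𝓘(ℝ, ℝ) f y) (a : TangentSpace (𝓡 n) y) :
    mfderiv (𝓡 n) 𝓘(ℝ, ℝ) f y a =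
      fderiv ℝ (f ∘ (extChartAt (𝓡 n) y).symm) (extChartAt (𝓡 n) y y) a :=
  (mfderiv_eq_fderiv_tangentCoordChange (mem_extChartAt_source y) hf a).trans
    (congrArg _ (tangentCoordChange_self (mem_extChartAt_source y)))

/-- Once `homSrc` and `homTgt` are known, the terms in the second derivatives of `f` and of the
transition map are symmetric in `v` and `w` by the classical Schwarz theorem. What remains of `h` is
the symmetry of the vertical component, seen through the coordinate functions of `N`. -/
theorem homVer_apply_comm_of_mfderiv {x₀ x : M} (hx : x ∈ (extChartAt (𝓡 m) x₀).source) {y : N}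
    {L : TangentSpace (𝓡 m) x →L[ℝ] TangentSpace (𝓡 n) y}
    {W : TangentSpace (𝓡 m) x →L[ℝ] TangentSpace (homModel m n) (homPoint x y L)}
    (hsrc : ∀ μ, homSrc (W μ) = μ) (htgt : ∀ μ, homTgt (W μ) = L μ) {q : N}
    (hq : y ∈ coordNhd (𝓡 n) q) (v w : EuclideanSpace ℝ (Fin m))
    (h : ∀ i, mfderiv (homModel m n) 𝓘(ℝ, ℝ)
        (homEvalDeriv (coordFun (𝓡 n) q i) x₀ v : HomBundle m n M N → ℝ) (homPoint x y L)
          (W (tangentCoordChange (𝓡 m) x₀ x x w)) =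
      mfderiv (homModel m n) 𝓘(ℝ, ℝ)
        (homEvalDeriv (coordFun (𝓡 n) q i) x₀ w : HomBundle m n M N → ℝ) (homPoint x y L)
          (W (tangentCoordChange (𝓡 m) x₀ x x v))) :
    homVer (W (tangentCoordChange (𝓡 m) x₀ x x w)) (tangentCoordChange (𝓡 m) x₀ x x v) =
      homVer (W (tangentCoordChange (𝓡 m) x₀ x x v)) (tangentCoordChange (𝓡 m) x₀ x x w) := by
  rw [eq_symm_coord_of_mem hq (homVer (W (tangentCoordChange (𝓡 m) x₀ x x w))
      (tangentCoordChange (𝓡 m) x₀ x x v)),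
    eq_symm_coord_of_mem hq (homVer (W (tangentCoordChange (𝓡 m) x₀ x x v))
      (tangentCoordChange (𝓡 m) x₀ x x w))]
  congr 2
  funext i
  have hf : ContMDiff (𝓡 n) 𝓘(ℝ, ℝ) 2 (coordFun (𝓡 n) q i) :=
    contMDiff_coordFun (I := 𝓡 n) (r := 2) (WithTop.coe_le_coe.2 (le_top : (2 : ℕ∞) ≤ ⊤)) q i
  have hz : extChartAt (𝓡 m) x₀ x ∈ (extChartAt (𝓡 m) x₀).target :=
    (extChartAt (𝓡 m) x₀).map_source hx
  have hxx : (extChartAt (𝓡 m) x₀).symm (extChartAt (𝓡 m) x₀ x) ∈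
      (extChartAt (𝓡 m) x).source := by
    rw [(extChartAt (𝓡 m) x₀).left_inv hx]
    exact mem_extChartAt_source x
  have s1 := (contDiffAt_comp_extChartAt_symm hf y).isSymmSndFDerivAt (by simp)
  have s2 := (contDiffAt_chartChange hz hxx).isSymmSndFDerivAt (by simp)
  have key : ∀ v w : EuclideanSpace ℝ (Fin m), mfderiv (homModel m n) 𝓘(ℝ, ℝ)
      (homEvalDeriv (coordFun (𝓡 n) q i) x₀ v : HomBundle m n M N → ℝ) (homPoint x y L)
        (W (tangentCoordChange (𝓡 m) x₀ x x w)) =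
      fderiv ℝ (fderiv ℝ (coordFun (𝓡 n) q i ∘ (extChartAt (𝓡 n) y).symm)) (extChartAt (𝓡 n) y y)
        (L (tangentCoordChange (𝓡 m) x₀ x x w)) (L (tangentCoordChange (𝓡 m) x₀ x x v)) +
      (fderiv ℝ (coordFun (𝓡 n) q i ∘ (extChartAt (𝓡 n) y).symm) (extChartAt (𝓡 n) y y)
        (homVer (W (tangentCoordChange (𝓡 m) x₀ x x w)) (tangentCoordChange (𝓡 m) x₀ x x v)) +
      fderiv ℝ (coordFun (𝓡 n) q i ∘ (extChartAt (𝓡 n) y).symm) (extChartAt (𝓡 n) y y)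
          (L (fderiv ℝ (fderiv ℝ (chartChange x₀ x)) (extChartAt (𝓡 m) x₀ x) w v))) := by
    intro v w
    have h2 : tangentCoordChange (𝓡 m) x x₀ x
        (homSrc (W (tangentCoordChange (𝓡 m) x₀ x x w))) = w :=
      (congrArg (tangentCoordChange (𝓡 m) x x₀ x) (hsrc _)).trans
        (tangentCoordChange_right_inverse hx w)
    refine (mfderiv_homEvalDeriv hf v hx y L _).trans ?_
    refine congrArg₂ (· + ·) (congrArg (fun l : EuclideanSpace ℝ (Fin n) =>
      fderiv ℝ (fderiv ℝ (coordFun (𝓡 n) q i ∘ (extChartAt (𝓡 n) y).symm)) (extChartAt (𝓡 n) y y) l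
        (L (tangentCoordChange (𝓡 m) x₀ x x v))) (htgt _)) ((map_add _ _ _).trans
      (congrArg (fun a : EuclideanSpace ℝ (Fin m) =>
        fderiv ℝ (coordFun (𝓡 n) q i ∘ (extChartAt (𝓡 n) y).symm) (extChartAt (𝓡 n) y y)
          (homVer (W (tangentCoordChange (𝓡 m) x₀ x x w)) (tangentCoordChange (𝓡 m) x₀ x x v)) +
        fderiv ℝ (coordFun (𝓡 n) q i ∘ (extChartAt (𝓡 n) y).symm) (extChartAt (𝓡 n) y y)
          (L (fderiv ℝ (fderiv ℝ (chartChange x₀ x)) (extChartAt (𝓡 m) x₀ x) a v))) h2))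
  have h1 := ((key v w).symm.trans (h i)).trans (key w v)
  have alg : ∀ {a a' b b' c c' : ℝ}, a + (b + c) = a' + (b' + c') → a = a' → c = c' → b = b' := by
    intros
    linarith
  refine (mfderiv_eq_fderiv_comp_symm (hf.mdifferentiable two_ne_zero y) _).trans
    (Eq.trans ?_ (mfderiv_eq_fderiv_comp_symm (hf.mdifferentiable two_ne_zero y) _).symm)
  exact alg h1 (s1 _ _) (congrArg (fun a : EuclideanSpace ℝ (Fin m) =>
    fderiv ℝ (coordFun (𝓡 n) q i ∘ (extChartAt (𝓡 n) y).symm) (extChartAt (𝓡 n) y y) (L a)) (s2 w v))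

theorem mfderiv_cutoff_mul {p : HomBundle m n M N} {ρ F : HomBundle m n M N → ℝ}
    (hρ : ∀ᶠ q in 𝓝 p, ρ q = 1) : mfderiv (homModel m n) 𝓘(ℝ, ℝ) (fun q => ρ q * F q) p =
      mfderiv (homModel m n) 𝓘(ℝ, ℝ) F p := by
  have he : (fun q => ρ q * F q) =ᶠ[𝓝 p] F := by
    filter_upwards [hρ] with q hq
    rw [hq, one_mul]
  have h := he.mfderiv_eq (I := homModel m n) (I' := 𝓘(ℝ, ℝ))
  exact h

variable [SecondCountableTopology M] [SecondCountableTopology N]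
  {u : M → N} {Du : ∀ x : M, TangentSpace (𝓡 m) x →L[ℝ] TangentSpace (𝓡 n) (u x)}
  {W : ∀ x : M, TangentSpace (𝓡 m) x →L[ℝ]
    TangentSpace (homModel m n) (homPoint x (u x) (Du x))}

/-- `homEvalDeriv f x₀ v ∘ Tu` is the derivative of `f ∘ u` in the direction `v`, but it is linear
in the fibre variable and so not an admissible test. Multiplied by `ρ` it becomes one, and is
unchanged where `χ ∘ Tu` does not vanish. -/
theorem IsWeakTangentMap.ae_mfderiv_homEvalDeriv_comm (hDu : IsColocalWeakDeriv u Du)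
    (hT : ColocallyWeaklyDifferentiable m (homModel m n) (fun x => homPoint x (u x) (Du x)))
    (hW : IsWeakTangentMap (homModel m n) (fun x => homPoint x (u x) (Du x)) W) {x₀ : M}
    {ρ χ : HomBundle m n M N → ℝ} (hρ : ContMDiff (homModel m n) 𝓘(ℝ, ℝ) 1 ρ)
    (hρc : HasCompactSupport ρ) (hρs : tsupport ρ ⊆ {p | p.1.1 ∈ (extChartAt (𝓡 m) x₀).source})
    (hχ : ContMDiff (homModel m n) 𝓘(ℝ, ℝ) 1 χ) (hχc : HasCompactSupport χ)
    (hρχ : ∀ p, χ p ≠ 0 → ∀ᶠ q in 𝓝 p, ρ q = 1) {f : N → ℝ}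
    (hf : ContMDiff (𝓡 n) 𝓘(ℝ, ℝ) 2 f) (hfc : HasCompactSupport f)
    (v w : EuclideanSpace ℝ (Fin m)) :
    ∀ᵐ z ∂volume.restrict (extChartAt (𝓡 m) x₀).target, ∀ x, x = (extChartAt (𝓡 m) x₀).symm z →
      χ (homPoint x (u x) (Du x)) ≠ 0 →
      mfderiv (homModel m n) 𝓘(ℝ, ℝ) (homEvalDeriv f x₀ v : HomBundle m n M N → ℝ)
        (homPoint x (u x) (Du x)) (W x (tangentCoordChange (𝓡 m) x₀ x x w)) =
      mfderiv (homModel m n) 𝓘(ℝ, ℝ) (homEvalDeriv f x₀ w : HomBundle m n M N → ℝ)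
        (homPoint x (u x) (Du x)) (W x (tangentCoordChange (𝓡 m) x₀ x x v)) := by
  have hΩ := isOpen_extChartAt_target (I := 𝓡 m) x₀
  have hF : ∀ v, ContMDiff (homModel m n) 𝓘(ℝ, ℝ) 1
      (fun p : HomBundle m n M N => ρ p * homEvalDeriv f x₀ v p) := fun v =>
    ContMDiffOn.cutoff_mul (isOpen_hom_chart x₀) (fun p hp =>
      (contMDiffAt_homEvalDeriv hf v hp p.1.2 p.2).contMDiffWithinAt) hρ hρs
  choose G hG using fun v => hT.2 _ (hF v) hρc.mul_right
  obtain ⟨K, hK⟩ := hT.2 χ hχ hχc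
  have hg := hDu.2 f (hf.of_le one_le_two) hfc x₀
  have hp : ∀ v, ∀ z ∈ (extChartAt (𝓡 m) x₀).target, ∀ x, x = (extChartAt (𝓡 m) x₀).symm z →
      χ (homPoint x (u x) (Du x)) ≠ 0 →
      ρ (homPoint x (u x) (Du x)) * homEvalDeriv f x₀ v (homPoint x (u x) (Du x)) =
        mfderiv (𝓡 n) 𝓘(ℝ, ℝ) f (u x) (Du x (tangentCoordChange (𝓡 m) x₀ x x v)) := by
    intro v z _ x _ hx
    rw [(hρχ _ hx).self_of_nhds, one_mul]
    rfl
  -- The gradient is that of `f ∘ u`, the field consists of the cut-off derivatives in the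
  -- directions `v` and `w`, and `χ ∘ Tu` plays the role of `h`.
  have hmix := HasWeakLineDerivOn.ae_mixed_eq hΩ (v := v) (w := w) (hg.lineDeriv hΩ v)
    (hg.lineDeriv hΩ w) ((hG v x₀).lineDeriv hΩ w) ((hG w x₀).lineDeriv hΩ v)
    ((hK x₀).lineDeriv hΩ v) ((hK x₀).lineDeriv hΩ w) (Eventually.of_forall fun z hz hne => by
      constructor
      · refine (hp v z hz _ rfl hne).trans ?_
        rw [← mfderiv_extChartAt_symm_eq_tangentCoordChange hz]
        rfl
      · refine (hp w z hz _ rfl hne).trans ?_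
        rw [← mfderiv_extChartAt_symm_eq_tangentCoordChange hz]
        rfl)
  filter_upwards [(ae_restrict_iff' hΩ.measurableSet).2 hmix,
    eventually_manifoldAE.1 (hW _ (hF v) (G v) (hG v)) x₀,
    eventually_manifoldAE.1 (hW _ (hF w) (G w) (hG w)) x₀, ae_restrict_mem hΩ.measurableSet]
    with z h1 h2 h3 hz x hx hne
  subst hx
  have h4 := h1 hne
  rw [mfderiv_cutoff_mul (hρχ _ hne)] at h2 h3
  have h5 := mfderiv_extChartAt_symm_eq_tangentCoordChange hz
  rw [← h5]
  have h6 := congrArg (fun T : EuclideanSpace ℝ (Fin m) →L[ℝ] ℝ => T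
    (mfderiv 𝓘(ℝ, EuclideanSpace ℝ (Fin m)) (𝓡 m) (extChartAt (𝓡 m) x₀).symm z w)) h2
  have h7 := congrArg (fun T : EuclideanSpace ℝ (Fin m) →L[ℝ] ℝ => T
    (mfderiv 𝓘(ℝ, EuclideanSpace ℝ (Fin m)) (𝓡 m) (extChartAt (𝓡 m) x₀).symm z v)) h3
  exact h6.symm.trans (h4.trans h7)

end Symmetry

/-- The symmetry is obtained outside a null set that depends on the two vectors; bilinearity reduces
it to the finitely many pairs of basis vectors. -/
theorem apply_comm_of_basis {m : ℕ} {F : Type*} [NormedAddCommGroup F] [NormedSpace ℝ F]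
    (A : EuclideanSpace ℝ (Fin m) →L[ℝ] EuclideanSpace ℝ (Fin m) →L[ℝ] F)
    {σ : EuclideanSpace ℝ (Fin m) →L[ℝ] EuclideanSpace ℝ (Fin m)} (hσ : Function.Surjective σ)
    (h : ∀ i j, A (σ (EuclideanSpace.basisFun (Fin m) ℝ i)) (σ (EuclideanSpace.basisFun (Fin m) ℝ j))
      = A (σ (EuclideanSpace.basisFun (Fin m) ℝ j)) (σ (EuclideanSpace.basisFun (Fin m) ℝ i)))
    (μ e : EuclideanSpace ℝ (Fin m)) : A μ e = A e μ := by
  obtain ⟨a, rfl⟩ := hσ μ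
  obtain ⟨b, rfl⟩ := hσ e
  let B : EuclideanSpace ℝ (Fin m) →ₗ[ℝ] EuclideanSpace ℝ (Fin m) →ₗ[ℝ] F :=
    LinearMap.mk₂ ℝ (fun a b => A (σ a) (σ b)) (by simp) (by simp) (by simp) (by simp)
  have hB : B = B.flip := LinearMap.ext_basis (EuclideanSpace.basisFun (Fin m) ℝ).toBasis
    (EuclideanSpace.basisFun (Fin m) ℝ).toBasis fun i j => by
      rw [OrthonormalBasis.coe_toBasis]
      exact h i j
  exact congrArg (fun T : EuclideanSpace ℝ (Fin m) →ₗ[ℝ] EuclideanSpace ℝ (Fin m) →ₗ[ℝ] F =>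
    T a b) hB

/-! ### The canonical flip and the vertical lift -/

section FlipAndLift

variable {m n : ℕ}
  {M : Type*} [TopologicalSpace M] [ChartedSpace (EuclideanSpace ℝ (Fin m)) M]
  [IsManifold (𝓡 m) 2 M]
  {N : Type*} [TopologicalSpace N] [ChartedSpace (EuclideanSpace ℝ (Fin n)) N]
  [IsManifold (𝓡 n) 2 N]
  {u : M → N}

theorem secondVec_mk_congr {y : N} {a a' b b' c c' : TangentSpace (𝓡 n) y} (ha : a = a')
    (hb : b = b') (hc : c = c') :
    (⟨⟨y, a⟩, secondVec ⟨y, a⟩ b c⟩ : SecondTangent n N) = ⟨⟨y, a'⟩, secondVec ⟨y, a'⟩ b' c'⟩ := by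
  subst ha hb hc
  rfl

theorem secondMap_of_eq_homMor {V : ∀ x : M, DoubleMor (m := m) (n := n) x (u x)} {x : M}
    {L : TangentSpace (𝓡 m) x →L[ℝ] TangentSpace (𝓡 n) (u x)}
    {W : TangentSpace (𝓡 m) x →L[ℝ] TangentSpace (homModel m n) (homPoint x (u x) L)}
    (hV : V x = homMor x (u x) L W) (e μ ν : TangentSpace (𝓡 m) x) :
    secondMap u V ⟨⟨x, e⟩, secondVec ⟨x, e⟩ μ ν⟩ =
      ⟨⟨u x, L e⟩, secondVec ⟨u x, L e⟩ (homTgt (W μ)) (homVer (W μ) e + L ν)⟩ := by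
  rw [← homMor_toFun]
  exact congrArg (fun v : DoubleMor (m := m) (n := n) x (u x) =>
    (⟨⟨u x, v.fst e⟩, v.toFun e (secondVec ⟨x, e⟩ μ ν)⟩ : SecondTangent n N)) hV

/-- Flipping exchanges the components `L e` and λ of the image. Since λ = `L μ`, they match those of
the image of the flipped vector, and the vertical components match by the symmetry of `A`. -/
theorem canonicalFlip_secondMap {V : ∀ x : M, DoubleMor (m := m) (n := n) x (u x)} {x : M}
    {L : TangentSpace (𝓡 m) x →L[ℝ] TangentSpace (𝓡 n) (u x)}
    {W : TangentSpace (𝓡 m) x →L[ℝ] TangentSpace (homModel m n) (homPoint x (u x) L)}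
    (hV : V x = homMor x (u x) L W) (htgt : ∀ μ, homTgt (W μ) = L μ)
    (hsymm : ∀ μ e, homVer (W μ) e = homVer (W e) μ) (ξ : SecondTangent m M)
    (hξ : ξ.proj.proj = x) : canonicalFlip (secondMap u V ξ) = secondMap u V (canonicalFlip ξ) := by
  obtain ⟨⟨x', e⟩, ζ⟩ := ξ
  obtain rfl : x' = x := hξ
  have h1 := congrArg canonicalFlip (secondMap_of_eq_homMor hV e (secondHor ζ) (secondVer ζ))
  refine h1.trans (Eq.trans ?_ (secondMap_of_eq_homMor hV (secondHor ζ) e (secondVer ζ)).symm)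
  exact secondVec_mk_congr (htgt _) (htgt e).symm
    (congrArg (fun a : TangentSpace (𝓡 n) (u x') => a + L (secondVer ζ)) (hsymm _ _))

/-- A vertical vector has `μ = 0`, where `W` vanishes by linearity; only the components 0 and `L ν`
are left. -/
theorem secondMap_vertLift {V : ∀ x : M, DoubleMor (m := m) (n := n) x (u x)} {x : M}
    {L : TangentSpace (𝓡 m) x →L[ℝ] TangentSpace (𝓡 n) (u x)}
    {W : TangentSpace (𝓡 m) x →L[ℝ] TangentSpace (homModel m n) (homPoint x (u x) L)}
    (hV : V x = homMor x (u x) L W) (e ν : TangentSpace (𝓡 m) x) :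
    secondMap u V ⟨⟨x, e⟩, vertLift x e ν⟩ = ⟨⟨u x, L e⟩, vertLift (u x) (L e) (L ν)⟩ := by
  rw [vertLift_eq, vertLift_eq]
  refine (secondMap_of_eq_homMor hV e 0 ν).trans (secondVec_mk_congr rfl ?_ ?_)
  · exact congrArg homTgt (map_zero W)
  · have h : homVer (W 0) = 0 := congrArg homVer (map_zero W)
    exact (congrArg (fun T : TangentSpace (𝓡 m) x →L[ℝ] TangentSpace (𝓡 n) (u x) => T e + L ν)
      h).trans (zero_add _)

theorem homVer_apply_comm_of_basis [T2Space M] [T2Space N] {x₀ x : M}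
    (hx : x ∈ (extChartAt (𝓡 m) x₀).source) {y : N}
    {L : TangentSpace (𝓡 m) x →L[ℝ] TangentSpace (𝓡 n) y}
    {W : TangentSpace (𝓡 m) x →L[ℝ] TangentSpace (homModel m n) (homPoint x y L)}
    (hsrc : ∀ μ, homSrc (W μ) = μ) (htgt : ∀ μ, homTgt (W μ) = L μ) {q : N}
    (hq : y ∈ coordNhd (𝓡 n) q)
    (h : ∀ i j k, mfderiv (homModel m n) 𝓘(ℝ, ℝ) (homEvalDeriv (coordFun (𝓡 n) q k) x₀
        (EuclideanSpace.basisFun (Fin m) ℝ i) : HomBundle m n M N → ℝ) (homPoint x y L)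
          (W (tangentCoordChange (𝓡 m) x₀ x x (EuclideanSpace.basisFun (Fin m) ℝ j))) =
      mfderiv (homModel m n) 𝓘(ℝ, ℝ) (homEvalDeriv (coordFun (𝓡 n) q k) x₀
        (EuclideanSpace.basisFun (Fin m) ℝ j) : HomBundle m n M N → ℝ) (homPoint x y L)
          (W (tangentCoordChange (𝓡 m) x₀ x x (EuclideanSpace.basisFun (Fin m) ℝ i))))
    (μ e : TangentSpace (𝓡 m) x) : homVer (W μ) e = homVer (W e) μ := by
  let W' : EuclideanSpace ℝ (Fin m) →L[ℝ] (EuclideanSpace ℝ (Fin m) × EuclideanSpace ℝ (Fin n)) ×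
    (EuclideanSpace ℝ (Fin m) →L[ℝ] EuclideanSpace ℝ (Fin n)) := W
  refine apply_comm_of_basis ((ContinuousLinearMap.snd ℝ _ _).comp W')
    (fun e => ⟨_, tangentCoordChange_left_inverse hx e⟩) (fun i j => ?_) μ e
  exact homVer_apply_comm_of_mfderiv hx hsrc htgt hq _ _ fun k => h j i k

variable [T2Space M] [SecondCountableTopology M] [T2Space N] [SecondCountableTopology N]
  {Du : ∀ x : M, TangentSpace (𝓡 m) x →L[ℝ] TangentSpace (𝓡 n) (u x)}
  {W : ∀ x : M, TangentSpace (𝓡 m) x →L[ℝ]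
    TangentSpace (homModel m n) (homPoint x (u x) (Du x))}

set_option maxHeartbeats 800000 in
theorem IsWeakTangentMap.homVer_apply_comm (hDu : IsColocalWeakDeriv u Du)
    (hT : ColocallyWeaklyDifferentiable m (homModel m n) (fun x => homPoint x (u x) (Du x)))
    (hW : IsWeakTangentMap (homModel m n) (fun x => homPoint x (u x) (Du x)) W) :
    ∀ᶠ x in manifoldAE m M, ∀ μ e, homVer (W x μ) e = homVer (W x e) μ := by
  obtain ⟨S, hS, hScov⟩ := exists_countable_coordNhd_cover (𝓡 n) N
  have hinst : Countable S := hS.to_subtype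
  have hsrc := eventually_manifoldAE.1 (hW.homSrc_eq hT)
  have htgt := eventually_manifoldAE.1 (hW.homTgt_eq hDu)
  refine eventually_manifoldAE.2 fun x₀ => ?_
  obtain ⟨t, ρ, χ, ht, hρ, hcov⟩ := exists_countable_cutoff_pairs (homModel m n)
    (isOpen_hom_chart (m := m) (n := n) (M := M) (N := N) x₀)
  have hinst' : Countable t := ht.to_subtype
  -- One null set serves all cutoff pairs, all charts of `N` in the cover, all their coordinates and
  -- all pairs of basis vectors, since these form a countable family.
  have hae := ae_all_iff.2 fun k : (t × S) × Fin (Module.finrank ℝ (EuclideanSpace ℝ (Fin n))) =>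
    ae_all_iff.2 fun l : Fin m × Fin m =>
    hW.ae_mfderiv_homEvalDeriv_comm hDu hT (hρ k.1.1).1 (hρ k.1.1).2.1 (hρ k.1.1).2.2.1
      (hρ k.1.1).2.2.2.1 (hρ k.1.1).2.2.2.2.1 (hρ k.1.1).2.2.2.2.2
      (contMDiff_coordFun (I := 𝓡 n) (r := 2) (WithTop.coe_le_coe.2 (le_top : (2 : ℕ∞) ≤ ⊤))
        (k.1.2 : N) k.2) (hasCompactSupport_coordFun (k.1.2 : N) k.2)
      (EuclideanSpace.basisFun (Fin m) ℝ l.1) (EuclideanSpace.basisFun (Fin m) ℝ l.2)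
  filter_upwards [hae, hsrc x₀, htgt x₀,
    ae_restrict_mem (isOpen_extChartAt_target x₀).measurableSet] with z h1 h2 h3 hz
  have hx := (extChartAt (𝓡 m) x₀).map_target hz
  have h1' := fun k l => h1 k l _ rfl
  clear h1
  generalize (extChartAt (𝓡 m) x₀).symm z = x at *
  obtain ⟨y, hy⟩ := hcov (homPoint x (u x) (Du x)) hx
  obtain ⟨q, hqS, hq⟩ := hScov (u x)
  exact homVer_apply_comm_of_basis hx h2 h3 hq fun i j k => h1' ((y, ⟨q, hqS⟩), k) (i, j) hy

end FlipAndLift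

end

theorem proposition2p1 {m n : ℕ}
    {M : Type*} [TopologicalSpace M] [ChartedSpace (EuclideanSpace ℝ (Fin m)) M]
    [IsManifold (𝓡 m) 2 M] [T2Space M] [SecondCountableTopology M]
    {N : Type*} [TopologicalSpace N] [ChartedSpace (EuclideanSpace ℝ (Fin n)) N]
    [IsManifold (𝓡 n) 2 N] [T2Space N] [SecondCountableTopology N]
    (u : M → N) (hu : TwiceColocallyWeaklyDifferentiable m n u) :
    (∃ Du : ∀ x : M, TangentSpace (𝓡 m) x →L[ℝ] TangentSpace (𝓡 n) (u x),
      IsColocalWeakDeriv u Du) ∧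
    ∀ Du : ∀ x : M, TangentSpace (𝓡 m) x →L[ℝ] TangentSpace (𝓡 n) (u x),
      IsColocalWeakDeriv u Du →
        (∃ V : ∀ x : M, DoubleMor (m := m) (n := n) x (u x), IsSecondColocalWeakDeriv u Du V) ∧
        (∀ V V' : ∀ x : M, DoubleMor (m := m) (n := n) x (u x),
          IsSecondColocalWeakDeriv u Du V → IsSecondColocalWeakDeriv u Du V' →
            ∀ᶠ x in manifoldAE m M, V x = V' x) ∧
        (∀ V : ∀ x : M, DoubleMor (m := m) (n := n) x (u x),
          IsSecondColocalWeakDeriv u Du V →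
            (∀ᶠ x in manifoldAE m M, ∀ ξ : SecondTangent m M, ξ.proj.proj = x →
              canonicalFlip (secondMap u V ξ) = secondMap u V (canonicalFlip ξ)) ∧
            (∀ᶠ x in manifoldAE m M, ∀ e ν : TangentSpace (𝓡 m) x,
              secondMap u V ⟨⟨x, e⟩, vertLift x e ν⟩ =
                ⟨⟨u x, Du x e⟩, vertLift (u x) (Du x e) (Du x ν)⟩)) := by
  refine ⟨exists_isColocalWeakDeriv hu.1, fun Du hDu => ?_⟩
  have hT := hu.2 Du hDu
  obtain ⟨W, hW⟩ := hT.exists_isWeakTangentMap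
  -- Every second derivative is almost everywhere the morphism of one and the same `W`, so
  -- uniqueness and the two identities become statements about `W`.
  have hV : ∀ V : ∀ x : M, DoubleMor (m := m) (n := n) x (u x), IsSecondColocalWeakDeriv u Du V →
      ∀ᶠ x in manifoldAE m M, V x = homMor x (u x) (Du x) (W x) := fun V h => h.eq_homMor hT hW
  refine ⟨⟨_, (hW.secondMeasurable hT).isSecondColocalWeakDeriv hT hW⟩, fun V V' h h' => ?_,
    fun V h => ⟨?_, ?_⟩⟩
  · filter_upwards [hV V h, hV V' h'] with x h1 h2
    exact h1.trans h2.symm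
  · filter_upwards [hV V h, hW.homTgt_eq hDu, hW.homVer_apply_comm hDu hT] with x h1 h2 h3 ξ hξ
    exact canonicalFlip_secondMap h1 h2 h3 ξ hξ
  · filter_upwards [hV V h] with x h1 e ν
    exact secondMap_vertLift h1 e ν
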